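/- A rectilinear angle sequence of length $n$ is a sequence $S=(s_1,\dots,s_n)$ of left ($+90^\circ$) and right ($-90^\circ$) turns. A simple polygon $P$ with axis-parallel edges and vertices on the integer grid, with interior angle $90^\circ$ or $270^\circ$ at every vertex, \emph{realizes} $S$ if the turns at the vertices of $P$ on some counterclockwise walk along its boundary form the sequence $S$ (an interior angle of $90^\circ$ is a left turn and one of $270^\circ$ is a right turn). The perimeter of $P$ is the sum of the lengths of its edges. A polygon is $x$-monotone if its boundary consists of two chains along each of which the $x$-coordinate is (weakly) monotone, and $S$ is $x$-monotone if it is realized by some $x$-monotone polygon. **Theorem.** There is an algorithm that, given an $x$-monotone angle sequence $S$ of length $n$, finds in $O(n^2)$ time a polygon $P$ that realizes $S$ and has minimum perimeter among all polygons that realize $S$. Here the time is the number of steps of a single fixed program on a word RAM with words of $O(\log n)$ bits (registers and arrays of integers; addition, subtraction, multiplication, comparison, load and store take one step each), which outputs the coordinates of the vertices of $P$. -/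

import Mathlib

/-! ## Rectilinear angle sequences and polygons on the integer grid -/

namespace RectPoly

/-- A left turn (`+90°`) or a right turn (`-90°`). -/
inductive Turn where
  | L
  | R

/-- An angle sequence of length `n` is a function `Fin n → Turn`. A polygon with `n` vertices is
given by its vertices `v 0, …, v (n - 1)` in cyclic order; indices are added modulo `n`, so the
`i`-th edge joins `v i` to `v (i + 1)`. -/
abbrev Vertices (n : ℕ) := Fin n → ℤ × ℤ

variable {n : ℕ} [NeZero n]

/-- The grid point `p`, as a point of the real plane. -/
def toPlane (p : ℤ × ℤ) : ℝ × ℝ := ((p.1 : ℝ), (p.2 : ℝ))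

/-- The `i`-th edge as a closed line segment in the plane. -/
def edge (v : Vertices n) (i : Fin n) : Set (ℝ × ℝ) :=
  segment ℝ (toPlane (v i)) (toPlane (v (i + 1)))

/-- The `i`-th edge is vertical (and not a single point). -/
def IsVertical (v : Vertices n) (i : Fin n) : Prop :=
  (v i).1 = (v (i + 1)).1 ∧ (v i).2 ≠ (v (i + 1)).2

/-- The `i`-th edge is horizontal (and not a single point). -/
def IsHorizontal (v : Vertices n) (i : Fin n) : Prop :=
  (v i).1 ≠ (v (i + 1)).1 ∧ (v i).2 = (v (i + 1)).2

/-- Twice the signed area enclosed by the closed polygonal line `v` (trapezoid formula). -/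
def twiceSignedArea (v : Vertices n) : ℤ :=
  ∑ i, ((v i).1 - (v (i + 1)).1) * ((v i).2 + (v (i + 1)).2)

/-- `v` lists, in counterclockwise order, the vertices of a simple rectilinear polygon:
every edge is horizontal or vertical; at each vertex a horizontal and a vertical edge meet;
two edges that are not consecutive are disjoint (two consecutive ones, being perpendicular, share
only their common vertex); and the orientation is counterclockwise. -/
structure IsPolygon (v : Vertices n) : Prop where
  rectilinear : ∀ i, IsHorizontal v i ∨ IsVertical v i
  corner : ∀ i, IsHorizontal v i ↔ IsVertical v (i + 1)
  simple : ∀ i j, i ≠ j → i + 1 ≠ j → j + 1 ≠ i → Disjoint (edge v i) (edge v j)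
  ccw : 0 < twiceSignedArea v

/-- Cross product of the edge that enters the vertex `v i` and the edge that leaves it. -/
def cross (v : Vertices n) (i : Fin n) : ℤ :=
  ((v i).1 - (v (i - 1)).1) * ((v (i + 1)).2 - (v i).2) -
    ((v i).2 - (v (i - 1)).2) * ((v (i + 1)).1 - (v i).1)

/-- The turn at the vertex `v i`. In a polygon the cross product is never zero. -/
def turnAt (v : Vertices n) (i : Fin n) : Turn :=
  if 0 < cross v i then Turn.L else Turn.R

/-- The polygon `v` realizes the angle sequence `S`: the turns on a counterclockwise walk around
`v`, started at a suitable vertex `v k`, form the sequence `S`. -/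
def Realizes (v : Vertices n) (S : Fin n → Turn) : Prop :=
  IsPolygon v ∧ ∃ k : Fin n, ∀ i : Fin n, turnAt v (k + i) = S i

/-- The sum of the lengths of the edges (of which each is horizontal or vertical). -/
def perimeter (v : Vertices n) : ℤ :=
  ∑ i, (|(v (i + 1)).1 - (v i).1| + |(v (i + 1)).2 - (v i).2|)

/-- The boundary splits into two `x`-monotone chains: starting from a suitable vertex `v k`, the
`x`-coordinate does not decrease along the first `m` edges and does not increase along the
remaining ones. -/
def IsXMonotone (v : Vertices n) : Prop :=
  ∃ (k : Fin n) (m : ℕ), ∀ i : Fin n,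
    (i.val < m → (v (k + i)).1 ≤ (v (k + i + 1)).1) ∧
    (m ≤ i.val → (v (k + i + 1)).1 ≤ (v (k + i)).1)

/-- An angle sequence is `x`-monotone if it is realized by an `x`-monotone polygon. -/
def IsXMonotoneSeq (S : Fin n → Turn) : Prop :=
  ∃ v : Vertices n, Realizes v S ∧ IsXMonotone v

/-- `v` realizes `S`, and no polygon that realizes `S` has a smaller perimeter. -/
def IsMinPerimeterRealization (v : Vertices n) (S : Fin n → Turn) : Prop :=
  Realizes v S ∧ ∀ w : Vertices n, Realizes w S → perimeter v ≤ perimeter w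

end RectPoly

/-! ## A word RAM

The machine has registers and zero-based arrays of integers. A program is a finite piece of syntax,
so it mentions only finitely many registers and arrays. Every instruction and every evaluation of a
test takes one step. -/

namespace WordRAM

/-- A memory configuration: `reg r` is the content of register `r`, and `arr A i` is the content
of cell `i` of array `A`. -/
structure State where
  reg : ℕ → ℤ
  arr : ℕ → ℕ → ℤ

/-- Write `z` into register `r`. -/
def State.setReg (s : State) (r : ℕ) (z : ℤ) : State where
  reg := fun r' => if r' = r then z else s.reg r'
  arr := s.arr

/-- Write `z` into cell `i` of array `A`. -/
def State.setArr (s : State) (A i : ℕ) (z : ℤ) : State where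
  reg := s.reg
  arr := fun A' i' => if A' = A ∧ i' = i then z else s.arr A' i'

/-- An operand is a constant or the content of a register. -/
inductive Operand where
  | const (z : ℤ)
  | reg (r : ℕ)

def Operand.val (s : State) : Operand → ℤ
  | .const z => z
  | .reg r => s.reg r

inductive Op where
  | add
  | sub
  | mul

def Op.eval : Op → ℤ → ℤ → ℤ
  | .add, x, y => x + y
  | .sub, x, y => x - y
  | .mul, x, y => x * y

inductive Rel where
  | lt
  | le
  | eq
  | ne

def Rel.Holds : Rel → ℤ → ℤ → Prop
  | .lt, x, y => x < y
  | .le, x, y => x ≤ y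
  | .eq, x, y => x = y
  | .ne, x, y => x ≠ y

/-- A test compares two operands. -/
structure Test where
  rel : Rel
  fst : Operand
  snd : Operand

def Test.Holds (b : Test) (s : State) : Prop :=
  b.rel.Holds (b.fst.val s) (b.snd.val s)

inductive Program where
  /-- do nothing -/
  | skip
  /-- `r := x o y` -/
  | op (r : ℕ) (o : Op) (x y : Operand)
  /-- `r := A[x]` -/
  | load (r A : ℕ) (x : Operand)
  /-- `A[x] := y` -/
  | store (A : ℕ) (x y : Operand)
  /-- `p; q` -/
  | seq (p q : Program)
  /-- if `b` then `p` else `q` -/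
  | cond (b : Test) (p q : Program)
  /-- while `b` do `p` -/
  | loop (b : Test) (p : Program)

/-- `Runs W p s t s'`: started in `s`, the program `p` halts after exactly `t` steps in `s'`, and
throughout the run every number that is written has absolute value at most `W`, and every array
index that is used lies in `{0, …, W}`. There is no run that violates this word size. -/
inductive Runs (W : ℕ) : Program → State → ℕ → State → Prop
  | skip (s : State) : Runs W .skip s 1 s
  | op (s : State) (r : ℕ) (o : Op) (x y : Operand)
      (hW : |o.eval (x.val s) (y.val s)| ≤ (W : ℤ)) :
      Runs W (.op r o x y) s 1 (s.setReg r (o.eval (x.val s) (y.val s)))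
  | load (s : State) (r A : ℕ) (x : Operand) (i : ℕ) (hi : x.val s = (i : ℤ)) (hiW : i ≤ W)
      (hW : |s.arr A i| ≤ (W : ℤ)) :
      Runs W (.load r A x) s 1 (s.setReg r (s.arr A i))
  | store (s : State) (A : ℕ) (x y : Operand) (i : ℕ) (hi : x.val s = (i : ℤ)) (hiW : i ≤ W)
      (hW : |y.val s| ≤ (W : ℤ)) :
      Runs W (.store A x y) s 1 (s.setArr A i (y.val s))
  | seq {p q : Program} {s s₁ s₂ : State} {t₁ t₂ : ℕ}
      (hp : Runs W p s t₁ s₁) (hq : Runs W q s₁ t₂ s₂) :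
      Runs W (.seq p q) s (t₁ + t₂) s₂
  | condTrue {b : Test} {p q : Program} {s s₁ : State} {t : ℕ}
      (hb : b.Holds s) (hp : Runs W p s t s₁) :
      Runs W (.cond b p q) s (t + 1) s₁
  | condFalse {b : Test} {p q : Program} {s s₁ : State} {t : ℕ}
      (hb : ¬ b.Holds s) (hq : Runs W q s t s₁) :
      Runs W (.cond b p q) s (t + 1) s₁
  | loopDone {b : Test} {p : Program} {s : State} (hb : ¬ b.Holds s) :
      Runs W (.loop b p) s 1 s
  | loopStep {b : Test} {p : Program} {s s₁ s₂ : State} {t₁ t₂ : ℕ}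
      (hb : b.Holds s) (hp : Runs W p s t₁ s₁) (hq : Runs W (.loop b p) s₁ t₂ s₂) :
      Runs W (.loop b p) s (t₁ + t₂ + 1) s₂

end WordRAM

/-! ## Input and output -/

namespace RectPoly

/-- A left turn is encoded by `1` and a right turn by `-1`. -/
def Turn.code : Turn → ℤ
  | .L => 1
  | .R => -1

/-- The initial state for the input `S`: register `0` holds the length `n`, the cells
`0, …, n - 1` of array `0` hold the turns, and everything else is `0`. -/
def inputState {n : ℕ} (S : Fin n → Turn) : WordRAM.State where
  reg := fun r => if r = 0 then (n : ℤ) else 0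
  arr := fun A i => if h : A = 0 ∧ i < n then (S ⟨i, h.2⟩).code else 0

/-- The polygon that is read off a final state: the coordinates of its `i`-th vertex are in cell
`i` of array `1` and in cell `i` of array `2`. -/
def outputVertices (n : ℕ) (s : WordRAM.State) : Vertices n :=
  fun i => (s.arr 1 i.val, s.arr 2 i.val)

end RectPoly

/-! Opposite turns at the ends of a vertical edge preserve the horizontal direction of travel, and
two left turns reverse it. An `x`-monotone sequence, read from a suitable vertex, has exactly two
vertical edges with two left turns and opposite turns at all others (`exists_isPattern`). Hence, up
to a rotation, every polygon realizing it consists of a lower chain of `a` eastward edges and an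
upper chain of `m - a` westward edges, where `n = 2 * m` (`exists_chains_of_realizes`). The upper
chain lies strictly above the lower one wherever closed steps of the two share an `x`-coordinate.
Conversely, two chains separated in this way bound a simple polygon (`Corners.isPolygon`).

By symmetry the lower chain has at least as many edges as the upper one. Let `P` and `Q` be the
heights of the two chains, both starting at `0`, when every vertical edge inside a chain has length
`1`. If lower step `i` and upper step `j` touch, the total vertical length is at least a constant
plus `2 * (1 + P i - Q j)` (`Separated.vertical_lower_bound`). Unit vertical edges attain the
largest of these bounds when the upper chain is lifted by one more than the maximum of `P i - Q j`.
Squeezing the polygon to the minimum width `a` raises that maximum by at most the width saved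
(`exists_compressed`), and the perimeter counts both amounts twice. So some optimal polygon has
width `a`, a lower chain with unit horizontal edges, and unit vertical edges except the leftmost and
the rightmost (`exists_admissible_le_perimeter`, `realizes_canonical`).

It remains to choose integer breakpoints of the upper chain that minimize the maximum of `P i - Q j`
over touching pairs. This is a bottleneck path problem on a table with `a` rows and `m - a` columns:
passing to the next lower step, the upper chain either stays on its step or changes step at the same
abscissa. The recurrence `bottleneck` gives the optimum (`Admissible.bottleneck_le`), and a
traceback recovers breakpoints attaining it (`Trace`). Finding a start by brute force and filling
the table each take `O(n ^ 2)` steps; the rest is linear. All numbers are bounded by a constant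
multiple of `n ^ 2`. -/

namespace RectPoly

/-! ### Two `x`-monotone chains over a common interval -/

/-- The `i`-th step of the lower chain and the `j`-th step of the upper chain have closed
`x`-ranges that meet. -/
def Touch (xl xu : ℕ → ℤ) (i j : ℕ) : Prop :=
  xl i ≤ xu (j + 1) ∧ xu j ≤ xl (i + 1)

/-- Wherever the two chains meet in their `x`-ranges, the upper one is above the lower one. -/
def Separated (a b : ℕ) (xl xu p q : ℕ → ℤ) : Prop :=
  ∀ i j, i < a → j < b → Touch xl xu i j → p i < q j

theorem strictMono_upto {a : ℕ} {x : ℕ → ℤ} (h : ∀ i < a, x i < x (i + 1)) {i j : ℕ}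
    (hij : i ≤ j) (hj : j ≤ a) : x i + ((j : ℤ) - i) ≤ x j := by
  induction j, hij using Nat.le_induction with
  | base => simp
  | succ j hij ih =>
    have := h j (by omega)
    have := ih (by omega)
    push_cast
    omega

theorem mono_upto {a : ℕ} {x : ℕ → ℤ} (h : ∀ i < a, x i < x (i + 1)) {i j : ℕ}
    (hij : i ≤ j) (hj : j ≤ a) : x i ≤ x j := by
  have := strictMono_upto h hij hj
  omega

theorem exists_step {a : ℕ} {x : ℕ → ℤ} {t : ℤ} (h0 : x 0 ≤ t) (ha : t < x a) :
    ∃ i < a, x i ≤ t ∧ t < x (i + 1) := by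
  induction a with
  | zero => omega
  | succ a ih =>
    by_cases h : t < x a
    · obtain ⟨i, hi, h1⟩ := ih h
      exact ⟨i, by omega, h1⟩
    · exact ⟨a, by omega, by omega, ha⟩

/-- If no vertical edge of one chain meets a horizontal edge of the other one, the chain that
starts above stays above. -/
theorem separated_of_noCross {a b : ℕ} {xl xu p q : ℕ → ℤ}
    (hl : ∀ i < a, xl i < xl (i + 1)) (hu : ∀ j < b, xu j < xu (j + 1))
    (h0 : xl 0 = xu 0) (h00 : p 0 < q 0)
    (hA : ∀ i j, i + 1 < a → j < b → xu j ≤ xl (i + 1) → xl (i + 1) ≤ xu (j + 1) →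
      ¬ (p i < q j ∧ q j ≤ p (i + 1)))
    (hB : ∀ i j, i < a → j + 1 < b → xl i ≤ xu (j + 1) → xu (j + 1) ≤ xl (i + 1) →
      ¬ (p i < q j ∧ q (j + 1) ≤ p i)) :
    Separated a b xl xu p q := by
  -- Sweep from left to right by induction on `i + j`. The step that starts last determines a
  -- previous touching pair, where the order is already known. A change of order would make the
  -- vertical edge between the two pairs hit a horizontal edge of the other chain.
  suffices H : ∀ N i j, i + j = N → i < a → j < b → Touch xl xu i j → p i < q j from
    fun i j => H _ i j rfl
  intro N
  induction N with
  | zero =>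
    intro i j hij _ _ _
    obtain ⟨rfl, rfl⟩ : i = 0 ∧ j = 0 := by omega
    exact h00
  | succ N ih =>
    intro i j hij hi hj ht
    by_contra hc
    by_cases h : 0 < i ∧ xu j ≤ xl i
    · obtain ⟨i, rfl⟩ : ∃ i', i = i' + 1 := ⟨i - 1, by omega⟩
      have h1 := hl i (by omega)
      have h2 := hu j hj
      refine hA i j hi hj h.2 ht.1 ⟨ih i j (by omega) (by omega) hj ⟨?_, h.2⟩, by omega⟩
      have := ht.1
      omega
    · have hj0 : 0 < j ∧ xl i ≤ xu j := by
        rcases Nat.eq_zero_or_pos i with rfl | hi0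
        · exact ⟨by omega, by rw [h0]; exact mono_upto hu (Nat.zero_le _) hj.le⟩
        · have h1 : ¬ xu j ≤ xl i := fun h' => h ⟨hi0, h'⟩
          refine ⟨?_, by omega⟩
          rcases Nat.eq_zero_or_pos j with rfl | hj0
          · exact absurd (h0 ▸ mono_upto hl (Nat.zero_le _) hi.le) h1
          · exact hj0
      obtain ⟨j, rfl⟩ : ∃ j', j = j' + 1 := ⟨j - 1, by omega⟩
      have h2 := hu j (by omega)
      refine hB i j hi hj hj0.2 ht.2 ⟨ih i j (by omega) hi (by omega) ⟨hj0.2, ?_⟩, by omega⟩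
      have := ht.2
      omega

/-- Rewriting the area as a sum over unit columns makes two chains with different breakpoints
comparable column by column. -/
theorem sum_steps_eq_sum_Ico {a : ℕ} {x p : ℕ → ℤ} {f : ℤ → ℤ}
    (hx : ∀ i < a, x i < x (i + 1))
    (hf : ∀ i < a, ∀ t, x i ≤ t → t < x (i + 1) → f t = p i) :
    ∑ i ∈ Finset.range a, (x (i + 1) - x i) * p i = ∑ t ∈ Finset.Ico (x 0) (x a), f t := by
  induction a with
  | zero => simp
  | succ a ih =>
    rw [Finset.sum_range_succ, ih (fun i hi => hx i (by omega)) (fun i hi => hf i (by omega))]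
    have h1 : x 0 ≤ x a := mono_upto hx (Nat.zero_le _) (Nat.le_succ a)
    have h2 := hx a (by omega)
    have h3 : ∑ t ∈ Finset.Ico (x a) (x (a + 1)), f t = (x (a + 1) - x a) * p a := by
      rw [Finset.sum_congr rfl (g := fun _ => p a)]
      · rw [Finset.sum_const, Int.card_Ico, nsmul_eq_mul, Int.natCast_toNat_eq_self.2 (by omega)]
      · intro t ht
        rw [Finset.mem_Ico] at ht
        exact hf a (by omega) t ht.1 ht.2
    rw [← h3, ← Finset.sum_union, Finset.Ico_union_Ico_eq_Ico h1 h2.le]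
    exact Finset.Ico_disjoint_Ico_consecutive _ _ _

theorem exists_stepFunction {a : ℕ} {x p : ℕ → ℤ} (hx : ∀ i < a, x i < x (i + 1)) :
    ∃ f : ℤ → ℤ, ∀ i < a, ∀ t, x i ≤ t → t < x (i + 1) → f t = p i := by
  classical
  refine ⟨fun t => if h : ∃ i < a, x i ≤ t ∧ t < x (i + 1) then p h.choose else 0, ?_⟩
  intro i hi t h1 h2
  have h : ∃ i < a, x i ≤ t ∧ t < x (i + 1) := ⟨i, hi, h1, h2⟩
  simp only [dif_pos h]
  obtain ⟨h3, h4, h5⟩ := h.choose_spec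
  congr 1
  rcases lt_trichotomy h.choose i with hlt | heq | hgt
  · have := mono_upto hx (show h.choose + 1 ≤ i from hlt) hi.le
    omega
  · exact heq
  · have := mono_upto hx (show i + 1 ≤ h.choose from hgt) h3.le
    omega

/-- The area below the lower chain is less than the area below the upper one. -/
theorem Separated.sum_lt {a b : ℕ} {xl xu p q : ℕ → ℤ} (h : Separated a b xl xu p q)
    (ha : 0 < a) (hl : ∀ i < a, xl i < xl (i + 1)) (hu : ∀ j < b, xu j < xu (j + 1))
    (h0 : xl 0 = xu 0) (h1 : xl a = xu b) :
    ∑ i ∈ Finset.range a, (xl (i + 1) - xl i) * p i <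
      ∑ j ∈ Finset.range b, (xu (j + 1) - xu j) * q j := by
  obtain ⟨f, hf⟩ := exists_stepFunction (p := p) hl
  obtain ⟨g, hg⟩ := exists_stepFunction (p := q) hu
  rw [sum_steps_eq_sum_Ico hl hf, sum_steps_eq_sum_Ico hu hg, h0, h1]
  have h2 := strictMono_upto hl (Nat.zero_le a) le_rfl
  refine Finset.sum_lt_sum_of_nonempty ⟨xu 0, by rw [Finset.mem_Ico]; omega⟩ fun t ht => ?_
  rw [Finset.mem_Ico] at ht
  obtain ⟨i, hi, h3, h4⟩ := exists_step (a := a) (h0 ▸ ht.1) (h1 ▸ ht.2)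
  obtain ⟨j, hj, h5, h6⟩ := exists_step ht.1 ht.2
  rw [hf i hi t h3 h4, hg j hj t h5 h6]
  exact h i j hi hj ⟨by omega, by omega⟩

/-! ### Heights with unit steps -/

theorem abs_sub_le_sum_range (e : ℕ → ℤ) {i k : ℕ} (hik : i ≤ k) :
    |e k - e i| ≤ ∑ r ∈ Finset.Ico i k, |e (r + 1) - e r| := by
  induction k, hik using Nat.le_induction with
  | base => simp
  | succ k hik ih =>
    rw [Finset.sum_Ico_succ_top hik]
    have := abs_add_le (e k - e i) (e (k + 1) - e k)
    rw [show e k - e i + (e (k + 1) - e k) = e (k + 1) - e i by ring] at this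
    omega

/-- A chain whose steps have the directions of the unit steps of `P` is at least as long as the
sum of the unit steps and the deviations from them. -/
theorem le_sum_abs_steps {k : ℕ} {p P : ℕ → ℤ}
    (h : ∀ i < k, |P (i + 1) - P i| = 1 ∧ 0 < (P (i + 1) - P i) * (p (i + 1) - p i))
    {i : ℕ} (hi : i ≤ k) :
    k + |(p i - P i) - (p 0 - P 0)| + |(p k - P k) - (p i - P i)| ≤
      ∑ r ∈ Finset.range k, |p (r + 1) - p r| := by
  -- A step in the prescribed direction has length at least `1`, and its excess over `1` is exactly
  -- the change of the deviation `p - P` in absolute value. The excesses are then bounded by the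
  -- variation of the deviation before and after `i`.
  have h1 : ∀ r ∈ Finset.range k, |p (r + 1) - p r| =
      1 + |(fun r => p r - P r) (r + 1) - (fun r => p r - P r) r| := by
    intro r hr
    obtain ⟨h2, h3⟩ := h r (Finset.mem_range.1 hr)
    rcases (abs_eq (by norm_num)).1 h2 with h4 | h4
    · rw [h4] at h3
      rw [abs_of_pos (by omega), abs_of_nonneg (by simp only; omega)]
      simp only
      omega
    · rw [h4] at h3
      rw [abs_of_neg (by omega), abs_of_nonpos (by simp only; omega)]
      simp only
      omega
  rw [Finset.sum_congr rfl h1, Finset.sum_add_distrib, Finset.sum_const, Finset.card_range,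
    nsmul_one]
  have h5 := abs_sub_le_sum_range (fun r => p r - P r) (Nat.zero_le i)
  have h6 := abs_sub_le_sum_range (fun r => p r - P r) hi
  have h7 := Finset.sum_Ico_consecutive
    (fun r => |(fun r => p r - P r) (r + 1) - (fun r => p r - P r) r|) (Nat.zero_le i) hi
  rw [Finset.range_eq_Ico]
  simp only at *
  omega

/-- Lower bound for the vertical extent of a polygon made of two separated chains. -/
theorem Separated.vertical_lower_bound {a b : ℕ} {xl xu p q P Q : ℕ → ℤ}
    (h : Separated (a + 1) (b + 1) xl xu p q)
    (hP : ∀ i < a, |P (i + 1) - P i| = 1 ∧ 0 < (P (i + 1) - P i) * (p (i + 1) - p i))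
    (hQ : ∀ j < b, |Q (j + 1) - Q j| = 1 ∧ 0 < (Q (j + 1) - Q j) * (q (j + 1) - q j))
    (hP0 : P 0 = 0) (hQ0 : Q 0 = 0) {i j : ℕ} (hi : i ≤ a) (hj : j ≤ b) (ht : Touch xl xu i j) :
    (a + b : ℤ) + Q b - P a + 2 * (1 + P i - Q j) ≤
      (q 0 - p 0) + (q b - p a) + ∑ r ∈ Finset.range a, |p (r + 1) - p r| +
        ∑ r ∈ Finset.range b, |q (r + 1) - q r| := by
  have h1 := le_sum_abs_steps hP hi
  have h2 := le_sum_abs_steps hQ hj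
  have h3 := h i j (by omega) (by omega) ht
  -- The left edge together with the deviations accumulated up to `i` and `j` accounts for at least
  -- `(q j - Q j) - (p i - P i)`, which is at least `1 + P i - Q j`. The right edge with the
  -- deviations after `i` and `j` gives the same amount again, plus `Q b - P a`; hence the factor
  -- `2`.
  have h4 := neg_abs_le ((p i - P i) - (p 0 - P 0))
  have h5 := le_abs_self ((p i - P i) - (p 0 - P 0))
  have h6 := le_abs_self ((p a - P a) - (p i - P i))
  have h7 := neg_abs_le ((q j - Q j) - (q 0 - Q 0))
  have h8 := le_abs_self ((q j - Q j) - (q 0 - Q 0))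
  have h9 := neg_abs_le ((q b - Q b) - (q j - Q j))
  omega

/-! ### Compressing the upper chain to minimum width -/

theorem abs_sub_le_of_unit_steps {k : ℕ} {P : ℕ → ℤ} (h : ∀ i < k, |P (i + 1) - P i| ≤ 1)
    {i i' : ℕ} (hi : i ≤ i') (hk : i' ≤ k) : |P i' - P i| ≤ i' - i := by
  induction i', hi using Nat.le_induction with
  | base => simp
  | succ r hr ih =>
    have h1 := ih (by omega)
    have h2 := h r (by omega)
    rw [abs_le] at *
    push_cast
    omega

/-- Any pair of chains can be replaced by one in which the lower chain has horizontal unit steps;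
the price, in the maximal difference of the heights with unit steps, is at most the amount by which
the width decreases. -/
theorem exists_compressed {a b : ℕ} {xl xu P Q : ℕ → ℤ} {C : ℤ} (ha : 0 < a) (hba : b ≤ a)
    (hl : ∀ i < a, xl i < xl (i + 1)) (hu : ∀ j < b, xu j < xu (j + 1))
    (h0 : xl 0 = xu 0) (h1 : xl a = xu b) (hP : ∀ i, i + 1 < a → |P (i + 1) - P i| ≤ 1)
    (hC : ∀ i j, i < a → j < b → Touch xl xu i j → P i - Q j ≤ C) :
    ∃ z : ℕ → ℤ, z 0 = 0 ∧ z b = a ∧ (∀ j < b, z j < z (j + 1)) ∧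
      ∀ i j, i < a → j < b → Touch (fun i => (i : ℤ)) z i j →
        P i - Q j ≤ C + (xl a - xl 0 - a) := by
  set U := xl a - xl 0 - a with hU
  have hU0 : 0 ≤ U := by
    have := strictMono_upto hl (Nat.zero_le a) le_rfl
    push_cast at this
    omega
  -- `U` is the width saved. Each lower breakpoint moves left, relative to the left end, by an
  -- amount between `0` and `U`.
  have hlo : ∀ i ≤ a, xl 0 + i ≤ xl i ∧ xl i ≤ xl 0 + i + U := fun i hi => by
    have h2 := strictMono_upto hl (Nat.zero_le i) hi
    have h3 := strictMono_upto hl hi le_rfl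
    push_cast at h2
    omega
  have huo : ∀ j ≤ b, xu 0 + j ≤ xu j := fun j hj => by
    have h2 := strictMono_upto hu (Nat.zero_le j) hj
    push_cast at h2
    omega
  have hPd : ∀ i i', i ≤ i' → i' < a → |P i' - P i| ≤ i' - i := fun i i' h2 h3 =>
    abs_sub_le_of_unit_steps (k := a - 1) (fun r hr => hP r (by omega)) h2 (by omega)
  -- Shift the upper breakpoints left by `U`, but leave room for `j` unit steps before the `j`-th
  -- one. The last breakpoint lands at `max b a = a`, by `b ≤ a`.
  refine ⟨fun j => max (j : ℤ) (xu j - xu 0 - U), by simp [hU0], ?_, ?_, ?_⟩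
  · simp only
    omega
  · intro j hj
    have := hu j hj
    simp only
    push_cast
    omega
  · intro i j hi hj ht
    obtain ⟨h2, h3⟩ := ht
    simp only at h2 h3
    push_cast at h2 h3
    have h4 := (hlo i hi.le)
    have h5 := (hlo (i + 1) hi)
    have h6 := huo j hj.le
    have h7 := huo (j + 1) hj
    have h8 := hu j hj
    have h9 := hl i hi
    push_cast at h5 h7
    -- If the original steps did not touch, some lower step `i'` that touched upper step `j` differs
    -- from `i` by at most `U` in index. Since `P` changes by at most `1` per step, this costs at
    -- most `U`. Here upper step `j` lay to the left of lower step `i`.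
    by_cases hc1 : xu (j + 1) < xl i
    · obtain ⟨i', hi', h10, h11⟩ := exists_step (x := xl) (a := i) (t := xu (j + 1))
        (by omega) hc1
      have h12 := hC i' j (by omega) hj ⟨h10, by omega⟩
      have h13 := strictMono_upto hl (show i' + 1 ≤ i from hi') hi.le
      have h14 := hPd i' i hi'.le hi
      rw [abs_le] at h14
      push_cast at h13
      omega
    · by_cases hc2 : xl (i + 1) < xu j
      -- Here it lay to the right. Taking the lower step over `xu j - 1` selects the leftmost one
      -- that touches upper step `j`; with `xu j` the index distance could exceed `U` by one.
      · obtain ⟨i', hi', h10, h11⟩ := exists_step (x := fun r => xl (i + 1 + r)) (a := a - (i + 1))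
          (t := xu j - 1) (by simp only [add_zero]; omega)
          (by
            have := mono_upto hu hj.le le_rfl
            rw [show i + 1 + (a - (i + 1)) = a by omega]
            omega)
        rw [← add_assoc] at h11
        have h12 := hC (i + 1 + i') j (by omega) hj ⟨by omega, by omega⟩
        have h13 := strictMono_upto hl (show i + 1 ≤ i + 1 + i' by omega) (by omega)
        have h14 := hPd i (i + 1 + i') (by omega) (by omega)
        rw [abs_le] at h14
        push_cast at h13 h14
        omega
      · have := hC i j hi hj ⟨by omega, by omega⟩
        omega

end RectPoly

/-! ### Coordinates of rectilinear polygons and separation of the two chains. -/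

namespace RectPoly

variable {n : ℕ} [NeZero n]

/-! ### Cyclic indices -/

/-- The index reached from `k` after `i` steps. -/
def idx (k : Fin n) (i : ℕ) : Fin n := k + Fin.ofNat n i

theorem idx_zero (k : Fin n) : idx k 0 = k := by simp [idx]

theorem val_idx (k : Fin n) (i : ℕ) : (idx k i).val = (k.val + i) % n := by
  simp [idx, Fin.val_add]

theorem idx_add (k : Fin n) (i j : ℕ) : idx k (i + j) = idx (idx k i) j := by
  ext
  simp [val_idx, add_assoc]

theorem idx_succ (k : Fin n) (i : ℕ) : idx k (i + 1) = idx k i + 1 := by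
  ext
  simp only [val_idx, Fin.val_add, Fin.val_one']
  simp [add_assoc]

theorem idx_add_length (k : Fin n) (i : ℕ) : idx k (i + n) = idx k i := by
  ext
  simp [val_idx, ← add_assoc]

theorem idx_mod (k : Fin n) (i : ℕ) : idx k (i % n) = idx k i := by
  ext
  simp [val_idx]

theorem exists_idx (k j : Fin n) : ∃ i < n, idx k i = j :=
  ⟨(j - k).val, (j - k).isLt, by simp [idx]⟩

theorem idx_inj {k : Fin n} {i j : ℕ} (h : idx k i = idx k j) : i % n = j % n := by
  have h1 : Fin.ofNat n i = Fin.ofNat n j := add_left_cancel h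
  simpa using congrArg Fin.val h1

theorem idx_sub_one (k : Fin n) (i : ℕ) : idx k (i + 1) - 1 = idx k i := by
  rw [idx_succ, add_sub_cancel_right]

theorem idx_inj_of_lt {k : Fin n} {i j : ℕ} (hi : i < n) (hj : j < n) (h : idx k i = idx k j) :
    i = j := by
  have := idx_inj h
  rwa [Nat.mod_eq_of_lt hi, Nat.mod_eq_of_lt hj] at this

theorem sum_eq_sum_range_idx (k : Fin n) (f : Fin n → ℤ) :
    ∑ i, f i = ∑ i ∈ Finset.range n, f (idx k i) := by
  rw [Finset.sum_range, ← Equiv.sum_comp (Equiv.addLeft k)]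
  refine Finset.sum_congr rfl fun i _ => ?_
  simp [idx]

theorem sum_range_two_mul (m : ℕ) (f : ℕ → ℤ) :
    ∑ i ∈ Finset.range (2 * m), f i = ∑ i ∈ Finset.range m, (f (2 * i) + f (2 * i + 1)) := by
  induction m with
  | zero => simp
  | succ m ih =>
    rw [Finset.sum_range_succ, ← ih, show 2 * (m + 1) = 2 * m + 1 + 1 by ring,
      Finset.sum_range_succ, Finset.sum_range_succ]
    ring

/-! ### Rectilinear polygons described by every other vertex -/

/-- Seen from the vertex `k`, the vertices of `v` are `(x 0, y 0), (x 1, y 0), (x 1, y 1), …`. -/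
structure Corners (v : Vertices n) (k : Fin n) (m : ℕ) (x y : ℕ → ℤ) : Prop where
  length : n = 2 * m
  even : ∀ i, v (idx k (2 * i)) = (x i, y i)
  odd : ∀ i, v (idx k (2 * i + 1)) = (x (i + 1), y i)

theorem exists_corners {v : Vertices n} (hv : IsPolygon v) {k : Fin n} (hk : IsHorizontal v k) :
    ∃ m x y, Corners v k m x y := by
  have hx : ∀ i, IsHorizontal v i → ¬ IsVertical v i := fun i h1 h2 => h1.1 h2.1
  have h1 : ∀ i, IsHorizontal v (idx k (2 * i)) ∧ IsVertical v (idx k (2 * i + 1)) := by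
    intro i
    induction i with
    | zero => exact ⟨by rwa [mul_zero, idx_zero], by
        rw [mul_zero, zero_add, ← zero_add 1, idx_succ, idx_zero]; exact (hv.corner k).1 hk⟩
    | succ i ih =>
      have h2 : IsHorizontal v (idx k (2 * (i + 1))) := by
        rw [show 2 * (i + 1) = 2 * i + 1 + 1 by ring, idx_succ]
        refine (hv.rectilinear _).resolve_right fun h => ?_
        exact hx _ ((hv.corner _).2 h) ih.2
      exact ⟨h2, by rw [idx_succ]; exact (hv.corner _).1 h2⟩
  -- Horizontal and vertical edges alternate, so after an odd number of edges the horizontal edge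
  -- `k` would come back as a vertical one.
  have hn : Even n := by
    by_contra hodd
    obtain ⟨r, hr⟩ := Nat.not_even_iff_odd.1 hodd
    have h2 := (h1 r).2
    rw [← hr] at h2
    have h3 := idx_add_length k 0
    rw [zero_add, idx_zero] at h3
    exact hx k hk (h3 ▸ h2)
  obtain ⟨m, hm⟩ := hn.exists_two_nsmul
  refine ⟨m, fun i => (v (idx k (2 * i))).1, fun i => (v (idx k (2 * i))).2, by simpa using hm,
    fun i => rfl, fun i => ?_⟩
  have h2 := (h1 i).1.2
  have h3 := (h1 i).2.1
  rw [← idx_succ] at h2 h3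
  exact Prod.ext (by simpa [mul_add] using h3) h2.symm

variable {v : Vertices n} {k : Fin n} {m : ℕ} {x y : ℕ → ℤ}

namespace Corners

theorem even_succ (h : Corners v k m x y) (i : ℕ) :
    v (idx k (2 * i + 1 + 1)) = (x (i + 1), y (i + 1)) := h.even (i + 1)

theorem periodic (h : Corners v k m x y) (i : ℕ) : x (i + m) = x i ∧ y (i + m) = y i := by
  have h1 := h.even (i + m)
  rw [show 2 * (i + m) = 2 * i + n by rw [h.length]; ring, idx_add_length, h.even] at h1
  simpa [eq_comm] using h1

theorem perimeter_eq (h : Corners v k m x y) :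
    perimeter v = ∑ i ∈ Finset.range m, (|x (i + 1) - x i| + |y (i + 1) - y i|) := by
  rw [perimeter, sum_eq_sum_range_idx k]
  simp only [← idx_succ]
  have := sum_range_two_mul m (fun i => |(v (idx k (i + 1))).1 - (v (idx k i)).1| +
    |(v (idx k (i + 1))).2 - (v (idx k i)).2|)
  simp only [h.even, h.odd, h.even_succ] at this
  rw [← h.length] at this
  rw [this]
  simp

theorem area_eq (h : Corners v k m x y) :
    twiceSignedArea v = 2 * ∑ i ∈ Finset.range m, (x i - x (i + 1)) * y i := by
  rw [twiceSignedArea, sum_eq_sum_range_idx k]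
  simp only [← idx_succ]
  have := sum_range_two_mul m (fun i => ((v (idx k i)).1 - (v (idx k (i + 1))).1) *
    ((v (idx k i)).2 + (v (idx k (i + 1))).2))
  simp only [h.even, h.odd, h.even_succ] at this
  rw [← h.length] at this
  rw [this, Finset.mul_sum]
  refine Finset.sum_congr rfl fun i _ => ?_
  ring

theorem cross_odd (h : Corners v k m x y) (i : ℕ) :
    cross v (idx k (2 * i + 1)) = (x (i + 1) - x i) * (y (i + 1) - y i) := by
  rw [cross, idx_sub_one, ← idx_succ, h.even, h.odd, h.even_succ]
  simp

theorem cross_even (h : Corners v k m x y) (i : ℕ) :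
    cross v (idx k (2 * i + 2)) = -((y (i + 1) - y i) * (x (i + 2) - x (i + 1))) := by
  have h1 := h.odd (i + 1)
  rw [show 2 * (i + 1) + 1 = 2 * i + 1 + 1 + 1 by ring] at h1
  rw [cross, show 2 * i + 2 = 2 * i + 1 + 1 by ring, idx_sub_one, ← idx_succ, h.even_succ, h.odd,
    h1]
  simp

theorem edge_even (h : Corners v k m x y) (i : ℕ) :
    edge v (idx k (2 * i)) = segment ℝ (toPlane (x i, y i)) (toPlane (x (i + 1), y i)) := by
  rw [edge, ← idx_succ, h.even, h.odd]

theorem edge_odd (h : Corners v k m x y) (i : ℕ) :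
    edge v (idx k (2 * i + 1)) =
      segment ℝ (toPlane (x (i + 1), y i)) (toPlane (x (i + 1), y (i + 1))) := by
  rw [edge, ← idx_succ, h.odd, h.even_succ]

theorem isHorizontal_iff (h : Corners v k m x y) (i : ℕ) :
    IsHorizontal v (idx k (2 * i)) ↔ x i ≠ x (i + 1) := by
  rw [IsHorizontal, ← idx_succ, h.even, h.odd]
  simp

theorem isVertical_iff (h : Corners v k m x y) (i : ℕ) :
    IsVertical v (idx k (2 * i + 1)) ↔ y i ≠ y (i + 1) := by
  rw [IsVertical, ← idx_succ, h.odd, h.even_succ]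
  simp

theorem not_isVertical (h : Corners v k m x y) (i : ℕ) : ¬ IsVertical v (idx k (2 * i)) := by
  rw [IsVertical, ← idx_succ, h.even, h.odd]
  simp

theorem not_isHorizontal (h : Corners v k m x y) (i : ℕ) :
    ¬ IsHorizontal v (idx k (2 * i + 1)) := by
  rw [IsHorizontal, ← idx_succ, h.odd, h.even_succ]
  simp

theorem ne (h : Corners v k m x y) (hv : IsPolygon v) (i : ℕ) :
    x i ≠ x (i + 1) ∧ y i ≠ y (i + 1) :=
  ⟨(h.isHorizontal_iff i).1 ((hv.rectilinear _).resolve_right (h.not_isVertical i)),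
    (h.isVertical_iff i).1 ((hv.rectilinear _).resolve_left (h.not_isHorizontal i))⟩

end Corners

theorem isHorizontal_or_succ (hv : IsPolygon v) (k : Fin n) :
    IsHorizontal v k ∨ IsHorizontal v (k + 1) := by
  by_contra hc
  rw [not_or] at hc
  have h1 := (hv.rectilinear (k + 1)).resolve_left hc.2
  exact hc.1 ((hv.corner k).2 h1)

/-! ### Axis-parallel segments -/

theorem mem_segment_bounds {p q : ℤ × ℤ} {z : ℝ × ℝ}
    (h : z ∈ segment ℝ (toPlane p) (toPlane q)) :
    (((min p.1 q.1 : ℤ) : ℝ) ≤ z.1 ∧ z.1 ≤ ((max p.1 q.1 : ℤ) : ℝ)) ∧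
      (((min p.2 q.2 : ℤ) : ℝ) ≤ z.2 ∧ z.2 ≤ ((max p.2 q.2 : ℤ) : ℝ)) := by
  have h1 := Prod.segment_subset _ _ h
  rw [Set.mem_prod, segment_eq_uIcc, segment_eq_uIcc] at h1
  obtain ⟨h2, h3⟩ := h1
  rw [Set.uIcc, Set.mem_Icc] at h2 h3
  push_cast
  exact ⟨h2, h3⟩

theorem bounds_of_mem_segments {p q p' q' : ℤ × ℤ} {z : ℝ × ℝ}
    (h : z ∈ segment ℝ (toPlane p) (toPlane q)) (h' : z ∈ segment ℝ (toPlane p') (toPlane q')) :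
    min p.1 q.1 ≤ max p'.1 q'.1 ∧ min p'.1 q'.1 ≤ max p.1 q.1 ∧
      min p.2 q.2 ≤ max p'.2 q'.2 ∧ min p'.2 q'.2 ≤ max p.2 q.2 := by
  obtain ⟨⟨h1, h2⟩, h3, h4⟩ := mem_segment_bounds h
  obtain ⟨⟨h5, h6⟩, h7, h8⟩ := mem_segment_bounds h'
  exact ⟨Int.cast_le.1 (h1.trans h6), Int.cast_le.1 (h5.trans h2), Int.cast_le.1 (h3.trans h8),
    Int.cast_le.1 (h7.trans h4)⟩

theorem mem_horizontal_segment {s t r y : ℤ} (h : min s t ≤ r ∧ r ≤ max s t) :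
    toPlane (r, y) ∈ segment ℝ (toPlane (s, y)) (toPlane (t, y)) := by
  rw [toPlane, toPlane, toPlane, ← Prod.image_mk_segment_left, segment_eq_uIcc]
  exact ⟨r, ⟨by rw [← Int.cast_min]; exact Int.cast_le.2 h.1,
    by rw [← Int.cast_max]; exact Int.cast_le.2 h.2⟩, rfl⟩

theorem mem_vertical_segment {s t r x : ℤ} (h : min s t ≤ r ∧ r ≤ max s t) :
    toPlane (x, r) ∈ segment ℝ (toPlane (x, s)) (toPlane (x, t)) := by
  rw [toPlane, toPlane, toPlane, ← Prod.image_mk_segment_right, segment_eq_uIcc]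
  exact ⟨r, ⟨by rw [← Int.cast_min]; exact Int.cast_le.2 h.1,
    by rw [← Int.cast_max]; exact Int.cast_le.2 h.2⟩, rfl⟩

/-- No vertical edge meets a horizontal edge (of those that are not consecutive). -/
def NoCross (m : ℕ) (x y : ℕ → ℤ) : Prop :=
  ∀ i j, i + 1 < m → j < m → j ≠ i → j ≠ i + 1 →
    ¬ ((min (x j) (x (j + 1)) ≤ x (i + 1) ∧ x (i + 1) ≤ max (x j) (x (j + 1))) ∧
      (min (y i) (y (i + 1)) ≤ y j ∧ y j ≤ max (y i) (y (i + 1))))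

/-- Reflection in a horizontal line; it serves to exclude the clockwise orientation. -/
theorem NoCross.neg (h : NoCross m x y) : NoCross m x (fun i => - y i) := by
  intro i j h1 h2 h3 h4 h5
  refine h i j h1 h2 h3 h4 ⟨h5.1, ?_⟩
  have := h5.2
  simp only at this
  omega

theorem Corners.noCross (h : Corners v k m x y) (hv : IsPolygon v) : NoCross m x y := by
  intro i j hi hj h1 h2 ⟨h3, h4⟩
  have hn := h.length
  have hd := hv.simple (idx k (2 * j)) (idx k (2 * i + 1))
    (fun e => by have := idx_inj_of_lt (by omega) (by omega) e; omega)
    (fun e => by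
      rw [← idx_succ] at e
      have := idx_inj_of_lt (by omega) (by omega) e; omega)
    (fun e => by
      rw [← idx_succ] at e
      have := idx_inj_of_lt (by omega) (by omega) e; omega)
  rw [h.edge_even, h.edge_odd] at hd
  exact Set.disjoint_left.1 hd (mem_horizontal_segment h3) (mem_vertical_segment h4)

/-! ### Polygons with an eastward and a westward chain -/

/-- The horizontal edges `0, …, a - 1` go east and the horizontal edges `a, …, m - 1` go west. -/
structure EastWest (a m : ℕ) (x y : ℕ → ℤ) : Prop where
  pos : 0 < a
  lt : a < m
  closed_x : x m = x 0
  closed_y : y m = y 0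
  east : ∀ i < a, x i < x (i + 1)
  west : ∀ i, a ≤ i → i < m → x (i + 1) < x i

/-- The `x`-coordinates of the upper chain, from left to right. -/
def upperX (m : ℕ) (x : ℕ → ℤ) (j : ℕ) : ℤ := x (m - j)

/-- The `y`-coordinates of the upper chain, from left to right. -/
def upperY (m : ℕ) (y : ℕ → ℤ) (j : ℕ) : ℤ := y (m - 1 - j)

variable {a : ℕ}

namespace EastWest

theorem neg (h : EastWest a m x y) : EastWest a m x (fun i => - y i) :=
  { h with closed_y := by simp only [h.closed_y] }

theorem upper_step (h : EastWest a m x y) (j : ℕ) (hj : j < m - a) :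
    upperX m x j < upperX m x (j + 1) := by
  have := h.west (m - (j + 1)) (by omega) (by omega)
  rwa [show m - (j + 1) + 1 = m - j by omega] at this

theorem left_eq (h : EastWest a m x y) : x 0 = upperX m x 0 := by
  simp [upperX, h.closed_x]

theorem right_eq (h : EastWest a m x y) : x a = upperX m x (m - a) := by
  rw [upperX, show m - (m - a) = a by have := h.lt; omega]

/-- The leftmost edge joins heights `y (m - 1)` and `y m = y 0`, so `h0` puts the westward chain on
top at the left end; absence of crossings propagates this. -/
theorem separated (h : EastWest a m x y) (hc : NoCross m x y) (h0 : y 0 < y (m - 1)) :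
    Separated a (m - a) x (upperX m x) y (upperY m y) := by
  have hlt := h.lt
  refine separated_of_noCross h.east h.upper_step h.left_eq (by simpa [upperY] using h0) ?_ ?_
  · rintro i j hi hj h1 h2 ⟨h3, h4⟩
    refine hc i (m - 1 - j) (by omega) (by omega) (by omega) (by omega) ⟨?_, ?_⟩
    · rw [show m - 1 - j + 1 = m - j by omega]
      rw [upperX, show m - (j + 1) = m - 1 - j by omega] at h2
      rw [upperX] at h1
      omega
    · rw [upperY] at h3 h4
      omega
  · rintro i j hi hj h1 h2 ⟨h3, h4⟩
    refine hc (m - 1 - (j + 1)) i (by omega) (by omega) (by omega) (by omega) ⟨?_, ?_⟩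
    · rw [show m - 1 - (j + 1) + 1 = m - (j + 1) by omega]
      rw [upperX] at h1 h2
      omega
    · rw [show m - 1 - (j + 1) + 1 = m - 1 - j by omega]
      rw [upperY] at h3 h4
      omega

/-- The trapezoid sum counts westward edges positively and eastward edges negatively, so it is the
area under the upper chain minus the area under the lower one. -/
theorem area_pos (h : EastWest a m x y)
    (hs : Separated a (m - a) x (upperX m x) y (upperY m y)) :
    0 < ∑ i ∈ Finset.range m, (x i - x (i + 1)) * y i := by
  have hlt := h.lt
  have h1 := hs.sum_lt h.pos h.east h.upper_step h.left_eq h.right_eq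
  have h2 : ∑ j ∈ Finset.range (m - a), (upperX m x (j + 1) - upperX m x j) * upperY m y j =
      ∑ i ∈ Finset.range (m - a), (x (a + i) - x (a + i + 1)) * y (a + i) := by
    rw [← Finset.sum_range_reflect]
    refine Finset.sum_congr rfl fun i hi => ?_
    rw [Finset.mem_range] at hi
    rw [upperX, upperX, upperY, show m - (m - a - 1 - i + 1) = a + i by omega,
      show m - (m - a - 1 - i) = a + i + 1 by omega,
      show m - 1 - (m - a - 1 - i) = a + i by omega]
  have h3 := Finset.sum_range_add (fun i => (x i - x (i + 1)) * y i) a (m - a)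
  rw [show a + (m - a) = m by omega] at h3
  have h4 : ∑ i ∈ Finset.range a, (x i - x (i + 1)) * y i =
      - ∑ i ∈ Finset.range a, (x (i + 1) - x i) * y i := by
    rw [← Finset.sum_neg_distrib]
    exact Finset.sum_congr rfl fun i _ => by ring
  rw [h3, h4, ← h2]
  omega

theorem le_east (h : EastWest a m x y) {i j : ℕ} (hij : i ≤ j) (hj : j ≤ a) :
    x i + ((j : ℤ) - i) ≤ x j := strictMono_upto h.east hij hj

theorem le_west (h : EastWest a m x y) {i j : ℕ} (hi : a ≤ i) (hij : i ≤ j) (hj : j ≤ m) :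
    x j + ((j : ℤ) - i) ≤ x i := by
  have := strictMono_upto h.upper_step (show m - j ≤ m - i by omega) (by omega)
  rw [upperX, upperX, show m - (m - j) = j by omega, show m - (m - i) = i by omega] at this
  push_cast [Nat.cast_sub hj, Nat.cast_sub (hij.trans hj)] at this
  omega

end EastWest

theorem Separated.lt_of_le {a : ℕ} (hs : Separated a (m - a) x (upperX m x) y (upperY m y))
    {i j : ℕ} (hi : i < a) (hj : a ≤ j) (hjm : j < m) (h1 : x i ≤ x j)
    (h2 : x (j + 1) ≤ x (i + 1)) : y i < y j := by
  have := hs i (m - 1 - j) hi (by omega) ⟨?_, ?_⟩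
  · rwa [upperY, show m - 1 - (m - 1 - j) = j by omega] at this
  · rwa [upperX, show m - (m - 1 - j + 1) = j by omega]
  · rwa [upperX, show m - (m - 1 - j) = j + 1 by omega]

end RectPoly

/-! ### From separated chains back to simple polygons, and rotations. -/

namespace RectPoly

variable {n : ℕ} [NeZero n] {v : Vertices n} {k : Fin n} {m a : ℕ} {x y : ℕ → ℤ}

/-! ### Separated chains bound a polygon -/

/-- Within one chain, strict monotonicity of `x` leaves only the adjacent edges. Across the chains,
an inner vertical edge lies on two horizontal steps of its chain; both touch step `j` of the other
chain, so both ends of the vertical edge are on the same side of it. -/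
theorem EastWest.noCross (h : EastWest a m x y)
    (hs : Separated a (m - a) x (upperX m x) y (upperY m y)) {i j : ℕ} (hi : i < m)
    (hj : j < m) (h1 : j ≠ i) (h2 : j ≠ i + 1)
    (h3 : i + 1 = m → j ≠ 0)
    (h4 : min (x j) (x (j + 1)) ≤ x (i + 1) ∧ x (i + 1) ≤ max (x j) (x (j + 1)))
    (h5 : min (y i) (y (i + 1)) ≤ y j ∧ y j ≤ max (y i) (y (i + 1))) : False := by
  have hcx := h.closed_x
  have hlt := h.lt
  by_cases hja : j < a
  · have e1 := h.east j hja
    by_cases hia : i < a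
    · have e2 := h.east i hia
      rcases lt_or_gt_of_ne h1 with h6 | h6
      · have := h.le_east (show j + 1 ≤ i from h6) hia.le
        push_cast at this
        omega
      · have := h.le_east (show i + 1 + 1 ≤ j by omega) hja.le
        have := h.le_east (show i + 1 ≤ i + 1 + 1 by omega) (by omega)
        push_cast at *
        omega
    · have e2 := h.west i (by omega) hi
      by_cases him : i + 1 = m
      · have := h.le_east (show 0 + 1 ≤ j by have := h3 him; omega) hja.le
        have := h.le_east (show 0 ≤ 0 + 1 by omega) (show 0 + 1 ≤ a by omega)
        rw [him] at h4
        push_cast at *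
        omega
      · have e3 := h.west (i + 1) (by omega) (by omega)
        have := hs.lt_of_le hja (by omega) hi (by omega) (by omega)
        have := hs.lt_of_le hja (show a ≤ i + 1 by omega) (by omega) (by omega) (by omega)
        omega
  · have e1 := h.west j (by omega) hj
    by_cases hia : i < a
    · have e2 := h.east i hia
      by_cases hia' : i + 1 = a
      · have := h.le_west le_rfl (show a ≤ a + 1 by omega) (by omega)
        have := h.le_west (show a ≤ a + 1 by omega) (show a + 1 ≤ j by omega) (by omega)
        rw [hia'] at h4
        push_cast at *
        omega
      · have e3 := h.east (i + 1) (by omega)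
        have := hs.lt_of_le hia (show a ≤ j by omega) hj (by omega) (by omega)
        have := hs.lt_of_le (show i + 1 < a by omega) (show a ≤ j by omega) hj (by omega)
          (by omega)
        omega
    · have e2 := h.west i (by omega) hi
      rcases lt_or_gt_of_ne h1 with h6 | h6
      · have := h.le_west (show a ≤ j + 1 by omega) (show j + 1 ≤ i from h6) hi.le
        push_cast at this
        omega
      · have := h.le_west (show a ≤ i + 1 + 1 by omega) (show i + 1 + 1 ≤ j by omega) hj.le
        have := h.le_west (show a ≤ i + 1 by omega) (show i + 1 ≤ i + 1 + 1 by omega) (by omega)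
        push_cast at *
        omega

/-- Edges of different chains that meet in `x` have different heights by separation; in one chain
only consecutive edges meet in `x`, and these differ in height by `hy`. -/
theorem EastWest.horizontal_disjoint (h : EastWest a m x y)
    (hs : Separated a (m - a) x (upperX m x) y (upperY m y))
    (hy : ∀ i < m, y i ≠ y (i + 1)) {i j : ℕ} (hij : i < j) (hj : j < m) (hyy : y i = y j)
    (h1 : min (x i) (x (i + 1)) ≤ max (x j) (x (j + 1)))
    (h2 : min (x j) (x (j + 1)) ≤ max (x i) (x (i + 1))) : False := by
  by_cases hja : j < a
  · have e1 := h.east i (by omega)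
    have e2 := h.east j hja
    have e3 := h.le_east (show i + 1 ≤ j from hij) hja.le
    push_cast at e3
    obtain rfl : j = i + 1 := by omega
    exact hy i (by omega) hyy
  · have e2 := h.west j (by omega) hj
    by_cases hia : i < a
    · have e1 := h.east i hia
      have := hs.lt_of_le hia (by omega) hj (by omega) (by omega)
      omega
    · have e1 := h.west i (by omega) (by omega)
      have e3 := h.le_west (show a ≤ i + 1 by omega) (show i + 1 ≤ j from hij) hj.le
      push_cast at e3
      obtain rfl : j = i + 1 := by omega
      exact hy i (by omega) hyy

/-- Two vertical edges with the same abscissa must be inner edges of different chains. Each of the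
four pairs of adjacent horizontal steps touches, so the whole upper edge is above the whole lower
edge. -/
theorem EastWest.vertical_disjoint (h : EastWest a m x y)
    (hs : Separated a (m - a) x (upperX m x) y (upperY m y)) {i j : ℕ} (hij : i < j) (hj : j < m)
    (hxx : x (i + 1) = x (j + 1))
    (h1 : min (y j) (y (j + 1)) ≤ max (y i) (y (i + 1))) : False := by
  have hcx := h.closed_x
  have hlt := h.lt
  by_cases hja : j < a
  · have := h.le_east (show i + 1 ≤ j + 1 by omega) hja
    push_cast at this
    omega
  · have e2 := h.west j (by omega) hj
    by_cases hia : i < a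
    · have e1 := h.east i hia
      by_cases hjm : j + 1 = m
      · have := h.le_east (show 0 ≤ i + 1 by omega) hia
        rw [hjm] at hxx
        push_cast at *
        omega
      · have e3 := h.west (j + 1) (by omega) (by omega)
        by_cases hia' : i + 1 = a
        · have := h.le_west le_rfl (show a ≤ j + 1 by omega) (by omega)
          rw [hia'] at hxx
          push_cast at *
          omega
        · have e4 := h.east (i + 1) (by omega)
          have := hs.lt_of_le hia (show a ≤ j by omega) hj (by omega) (by omega)
          have := hs.lt_of_le (show i + 1 < a by omega) (show a ≤ j by omega) hj (by omega)
            (by omega)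
          have := hs.lt_of_le hia (show a ≤ j + 1 by omega) (by omega) (by omega) (by omega)
          have := hs.lt_of_le (show i + 1 < a by omega) (show a ≤ j + 1 by omega) (by omega)
            (by omega) (by omega)
          omega
    · have := h.le_west (show a ≤ i + 1 by omega) (show i + 1 ≤ j + 1 by omega) hj
      push_cast at this
      omega

theorem Corners.disjoint_edge (hc : Corners v k m x y) (h : EastWest a m x y)
    (hs : Separated a (m - a) x (upperX m x) y (upperY m y)) (hy : ∀ i < m, y i ≠ y (i + 1))
    {e e' : ℕ} (he : e < n) (he' : e' < n) (hlt : e + 1 < e') (hwrap : ¬ (e = 0 ∧ e' + 1 = n)) :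
    Disjoint (edge v (idx k e)) (edge v (idx k e')) := by
  have hn := hc.length
  rw [Set.disjoint_left]
  intro z hz hz'
  rcases Nat.even_or_odd' e with ⟨i, rfl | rfl⟩ <;> rcases Nat.even_or_odd' e' with ⟨j, rfl | rfl⟩
  · rw [hc.edge_even] at hz hz'
    have := bounds_of_mem_segments hz hz'
    simp only at this
    exact h.horizontal_disjoint hs hy (show i < j by omega) (by omega) (by omega) this.1 this.2.1
  · rw [hc.edge_even] at hz
    rw [hc.edge_odd] at hz'
    have := bounds_of_mem_segments hz hz'
    simp only at this
    exact h.noCross hs (i := j) (j := i) (by omega) (by omega) (by omega) (by omega) (by omega)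
      (by omega) (by omega)
  · rw [hc.edge_odd] at hz
    rw [hc.edge_even] at hz'
    have := bounds_of_mem_segments hz hz'
    simp only at this
    exact h.noCross hs (i := i) (j := j) (by omega) (by omega) (by omega) (by omega) (by omega)
      (by omega) (by omega)
  · rw [hc.edge_odd] at hz hz'
    have := bounds_of_mem_segments hz hz'
    simp only at this
    exact h.vertical_disjoint hs (show i < j by omega) (by omega) (by omega) this.2.2.2

theorem Corners.isPolygon (hc : Corners v k m x y) (h : EastWest a m x y)
    (hs : Separated a (m - a) x (upperX m x) y (upperY m y)) (hy : ∀ i < m, y i ≠ y (i + 1)) :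
    IsPolygon v := by
  have hn := hc.length
  have hx : ∀ i < m, x i ≠ x (i + 1) := fun i hi => by
    by_cases hia : i < a
    · exact (h.east i hia).ne
    · exact (h.west i (by omega) hi).ne'
  have hm0 := h.lt
  -- The chain conditions only concern indices below `m`; periodicity extends the inequality to all
  -- indices.
  have hx' : ∀ i, x i ≠ x (i + 1) := by
    intro i
    have e1 := hx (i % m) (Nat.mod_lt _ (by omega))
    have hp : ∀ i r, x (i + m * r) = x i := fun i r => by
      induction r with
      | zero => simp
      | succ r ih => rw [← ih, Nat.mul_succ, ← add_assoc, (hc.periodic _).1]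
    rw [← Nat.mod_add_div i m, hp, show i % m + m * (i / m) + 1 = i % m + 1 + m * (i / m) by ring,
      hp]
    exact e1
  have hy' : ∀ i, y i ≠ y (i + 1) := by
    intro i
    have e1 := hy (i % m) (Nat.mod_lt _ (by omega))
    have hp : ∀ i r, y (i + m * r) = y i := fun i r => by
      induction r with
      | zero => simp
      | succ r ih => rw [← ih, Nat.mul_succ, ← add_assoc, (hc.periodic _).2]
    rw [← Nat.mod_add_div i m, hp, show i % m + m * (i / m) + 1 = i % m + 1 + m * (i / m) by ring,
      hp]
    exact e1
  refine ⟨fun e => ?_, fun e => ?_, fun e e' h1 h2 h3 => ?_, ?_⟩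
  · obtain ⟨e, he, rfl⟩ := exists_idx k e
    rcases Nat.even_or_odd' e with ⟨i, rfl | rfl⟩
    · exact Or.inl ((hc.isHorizontal_iff i).2 (hx' i))
    · exact Or.inr ((hc.isVertical_iff i).2 (hy' i))
  · obtain ⟨e, he, rfl⟩ := exists_idx k e
    rcases Nat.even_or_odd' e with ⟨i, rfl | rfl⟩
    · rw [← idx_succ]
      simp only [(hc.isHorizontal_iff i).2 (hx' i), (hc.isVertical_iff i).2 (hy' i)]
    · rw [← idx_succ]
      simp only [hc.not_isHorizontal i, show 2 * i + 1 + 1 = 2 * (i + 1) by ring,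
        hc.not_isVertical (i + 1)]
  · obtain ⟨e, he, rfl⟩ := exists_idx k e
    obtain ⟨e', he', rfl⟩ := exists_idx k e'
    rw [← idx_succ] at h2 h3
    have h4 : e ≠ e' := fun h => h1 (by rw [h])
    have h5 : e + 1 ≠ e' := fun h => h2 (by rw [h])
    have h6 : e' + 1 ≠ e := fun h => h3 (by rw [h])
    have h7 : ¬ (e = 0 ∧ e' + 1 = n) := fun h => h3 (by
      rw [h.1, h.2]; simpa using idx_add_length k 0)
    have h8 : ¬ (e' = 0 ∧ e + 1 = n) := fun h => h2 (by
      rw [h.1, h.2]; simpa using idx_add_length k 0)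
    rcases lt_or_gt_of_ne h4 with h9 | h9
    · exact hc.disjoint_edge h hs hy he he' (by omega) h7
    · exact (hc.disjoint_edge h hs hy he' he (by omega) h8).symm
  · rw [hc.area_eq]
    have := h.area_pos hs
    omega

/-! ### Quarter turns -/

/-- The polygon turned by `90°`. -/
def quarterTurn (v : Vertices n) : Vertices n := fun i => (-(v i).2, (v i).1)

/-- The quarter turn of the plane. -/
def quarterTurnMap : ℝ × ℝ →ₗ[ℝ] ℝ × ℝ :=
  LinearMap.prod (-LinearMap.snd ℝ ℝ ℝ) (LinearMap.fst ℝ ℝ ℝ)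

theorem quarterTurnMap_injective : Function.Injective quarterTurnMap := by
  rintro ⟨a, b⟩ ⟨c, d⟩ h
  simp only [quarterTurnMap, LinearMap.prod_apply, Function.prod_apply, LinearMap.neg_apply,
    LinearMap.snd_apply, LinearMap.fst_apply, Prod.mk.injEq, neg_inj] at h
  exact Prod.ext h.2 h.1

theorem toPlane_quarterTurn {n : ℕ} (v : Vertices n) (i : Fin n) :
    toPlane (quarterTurn v i) = quarterTurnMap (toPlane (v i)) := by
  simp [toPlane, quarterTurn, quarterTurnMap]

theorem edge_quarterTurn (v : Vertices n) (i : Fin n) :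
    edge (quarterTurn v) i = quarterTurnMap '' edge v i := by
  rw [edge, edge, toPlane_quarterTurn, toPlane_quarterTurn]
  exact (image_segment ℝ quarterTurnMap.toAffineMap _ _).symm

theorem isHorizontal_quarterTurn (v : Vertices n) (i : Fin n) :
    IsHorizontal (quarterTurn v) i ↔ IsVertical v i := by
  simp only [IsHorizontal, IsVertical, quarterTurn, ne_eq, neg_inj]
  tauto

theorem isVertical_quarterTurn (v : Vertices n) (i : Fin n) :
    IsVertical (quarterTurn v) i ↔ IsHorizontal v i := by
  simp only [IsHorizontal, IsVertical, quarterTurn, ne_eq, neg_inj]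
  tauto

theorem perimeter_quarterTurn (v : Vertices n) : perimeter (quarterTurn v) = perimeter v := by
  refine Finset.sum_congr rfl fun i _ => ?_
  simp only [quarterTurn]
  rw [← neg_sub', abs_neg, add_comm]

theorem cross_quarterTurn (v : Vertices n) (i : Fin n) : cross (quarterTurn v) i = cross v i := by
  simp only [cross, quarterTurn]
  ring

theorem turnAt_quarterTurn (v : Vertices n) (i : Fin n) :
    turnAt (quarterTurn v) i = turnAt v i := by
  rw [turnAt, turnAt, cross_quarterTurn]

/-- The trapezoid terms differ by twice the increment of the product of the coordinates, which sums
to zero around the cycle. -/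
theorem twiceSignedArea_quarterTurn (v : Vertices n) :
    twiceSignedArea (quarterTurn v) = twiceSignedArea v := by
  have h : ∑ i : Fin n, (v (i + 1)).1 * (v (i + 1)).2 = ∑ i : Fin n, (v i).1 * (v i).2 :=
    Equiv.sum_comp (Equiv.addRight (1 : Fin n)) (fun i => (v i).1 * (v i).2)
  have h2 : ∑ i : Fin n, ((v i).1 * (v i).2 - (v (i + 1)).1 * (v (i + 1)).2) = 0 := by
    rw [Finset.sum_sub_distrib, h, sub_self]
  rw [← sub_eq_zero, twiceSignedArea, twiceSignedArea, ← Finset.sum_sub_distrib,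
    ← mul_zero (-2 : ℤ), ← h2, Finset.mul_sum]
  refine Finset.sum_congr rfl fun i _ => ?_
  simp only [quarterTurn]
  ring

theorem IsPolygon.quarterTurn (h : IsPolygon v) : IsPolygon (quarterTurn v) where
  rectilinear i := by
    rw [isHorizontal_quarterTurn, isVertical_quarterTurn]
    exact (h.rectilinear i).symm
  corner i := by
    rw [isHorizontal_quarterTurn, isVertical_quarterTurn]
    have h1 := h.corner i
    have h2 := h.rectilinear i
    have h3 := h.rectilinear (i + 1)
    have h4 : ∀ i, ¬ (IsHorizontal v i ∧ IsVertical v i) := fun i hh => hh.1.1 hh.2.1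
    have h5 := h4 i
    have h6 := h4 (i + 1)
    tauto
  simple i j h1 h2 h3 := by
    rw [edge_quarterTurn, edge_quarterTurn, Set.disjoint_image_iff quarterTurnMap_injective]
    exact h.simple i j h1 h2 h3
  ccw := by
    rw [twiceSignedArea_quarterTurn]
    exact h.ccw

/-- Every polygon can be turned so that a given edge goes east. -/
theorem IsPolygon.exists_eastward (h : IsPolygon v) (k : Fin n) :
    ∃ w : Vertices n, IsPolygon w ∧ (∀ i, turnAt w i = turnAt v i) ∧ perimeter w = perimeter v ∧
      IsHorizontal w k ∧ (w k).1 < (w (k + 1)).1 := by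
  have key : ∀ v : Vertices n, IsPolygon v → IsHorizontal v k →
      ∃ w : Vertices n, IsPolygon w ∧ (∀ i, turnAt w i = turnAt v i) ∧
        perimeter w = perimeter v ∧ IsHorizontal w k ∧ (w k).1 < (w (k + 1)).1 := by
    intro v h hh
    rcases lt_or_gt_of_ne hh.1 with h1 | h1
    · exact ⟨v, h, fun _ => rfl, rfl, hh, h1⟩
    · refine ⟨_, h.quarterTurn.quarterTurn, fun i => ?_, ?_, ?_, ?_⟩
      · rw [turnAt_quarterTurn, turnAt_quarterTurn]
      · rw [perimeter_quarterTurn, perimeter_quarterTurn]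
      · rwa [isHorizontal_quarterTurn, isVertical_quarterTurn]
      · simpa [RectPoly.quarterTurn] using h1
  rcases h.rectilinear k with hh | hh
  · exact key v h hh
  · obtain ⟨w, h1, h2, h3, h4⟩ := key _ h.quarterTurn ((isHorizontal_quarterTurn v k).2 hh)
    exact ⟨w, h1, fun i => by rw [h2, turnAt_quarterTurn], by rw [h3, perimeter_quarterTurn], h4⟩

end RectPoly

/-! ### Turn patterns and their equivalence with pairs of chains. -/

namespace RectPoly

variable {n : ℕ} [NeZero n] {v : Vertices n} {k : Fin n} {m a : ℕ} {x y : ℕ → ℤ}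

/-! ### Turns and signs -/

/-- The code of the `i`-th turn of `S` after position `k`. -/
def code (S : Fin n → Turn) (k : Fin n) (i : ℕ) : ℤ := (S (idx k i)).code

theorem Turn.code_eq (t : Turn) : t.code = 1 ∨ t.code = -1 := by
  cases t <;> simp [Turn.code]

theorem code_eq (S : Fin n → Turn) (k : Fin n) (i : ℕ) : code S k i = 1 ∨ code S k i = -1 :=
  Turn.code_eq _

theorem code_add_length (S : Fin n → Turn) (k : Fin n) (i : ℕ) :
    code S k (i + n) = code S k i := by
  rw [code, code, idx_add_length]

theorem code_turnAt_mul_cross_pos (h : cross v k ≠ 0) : 0 < (turnAt v k).code * cross v k := by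
  rw [turnAt]
  split_ifs with h1
  · simpa [Turn.code] using h1
  · simp only [Turn.code]
    omega

theorem turnAt_eq_of_pos {t : Turn} (h : 0 < t.code * cross v k) : turnAt v k = t := by
  rw [turnAt]
  cases t <;> simp only [Turn.code] at h
  · rw [if_pos (by omega)]
  · rw [if_neg (by omega)]

/-- After position `k`, the sequence `S` has the turns of a polygon whose horizontal edges
`0, …, a - 1` go east and whose horizontal edges `a, …, m - 1` go west. -/
structure IsPattern (S : Fin n → Turn) (k : Fin n) (m a : ℕ) : Prop where
  length : n = 2 * m
  pos : 0 < a
  lt : a < m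
  sum : ∀ i < m, code S k (2 * i + 1) + code S k (2 * i + 2) =
    if i + 1 = a ∨ i + 1 = m then 2 else 0

namespace IsPattern

variable {S : Fin n → Turn}

/-- Starting at the first westward edge amounts to a half turn, which exchanges the chains; so one
may assume that the lower chain is the longer one. -/
theorem swap (h : IsPattern S k m a) : IsPattern S (idx k (2 * a)) m (m - a) := by
  have hlt := h.lt
  have hn := h.length
  have hc : ∀ i, code S (idx k (2 * a)) i = code S k (2 * a + i) := fun i => by
    rw [code, code, idx_add]
  refine ⟨h.length, by omega, by have := h.pos; omega, fun i hi => ?_⟩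
  rw [hc, hc]
  by_cases h1 : a + i < m
  · have h2 := h.sum (a + i) h1
    rw [show 2 * (a + i) + 1 = 2 * a + (2 * i + 1) by ring,
      show 2 * (a + i) + 2 = 2 * a + (2 * i + 2) by ring] at h2
    rw [h2]
    exact if_congr (by omega) rfl rfl
  · have h2 := h.sum (a + i - m) (by omega)
    rw [show 2 * a + (2 * i + 1) = 2 * (a + i - m) + 1 + n by omega,
      show 2 * a + (2 * i + 2) = 2 * (a + i - m) + 2 + n by omega, code_add_length,
      code_add_length, h2]
    exact if_congr (by omega) rfl rfl

theorem turns_of_extreme (h : IsPattern S k m a) {i : ℕ} (hi : i < m)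
    (hc : i + 1 = a ∨ i + 1 = m) : code S k (2 * i + 1) = 1 ∧ code S k (2 * i + 2) = 1 := by
  have h1 := h.sum i hi
  rw [if_pos hc] at h1
  have h2 := code_eq S k (2 * i + 1)
  have h3 := code_eq S k (2 * i + 2)
  omega

theorem turns_of_inner (h : IsPattern S k m a) {i : ℕ} (hi : i < m)
    (hc : ¬ (i + 1 = a ∨ i + 1 = m)) : code S k (2 * i + 2) = - code S k (2 * i + 1) := by
  have h1 := h.sum i hi
  rw [if_neg hc] at h1
  omega

end IsPattern

/-! ### Polygons that realize a pattern -/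

theorem Corners.sign_odd (hc : Corners v k m x y) (hv : IsPolygon v) (i : ℕ) :
    0 < (turnAt v (idx k (2 * i + 1))).code * ((x (i + 1) - x i) * (y (i + 1) - y i)) := by
  rw [← hc.cross_odd]
  refine code_turnAt_mul_cross_pos ?_
  rw [hc.cross_odd]
  have := hc.ne hv i
  exact mul_ne_zero (sub_ne_zero.2 this.1.symm) (sub_ne_zero.2 this.2.symm)

theorem Corners.sign_even (hc : Corners v k m x y) (hv : IsPolygon v) (i : ℕ) :
    0 < (turnAt v (idx k (2 * i + 2))).code *
      (-((y (i + 1) - y i) * (x (i + 2) - x (i + 1)))) := by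
  rw [← hc.cross_even]
  refine code_turnAt_mul_cross_pos ?_
  rw [hc.cross_even]
  have h1 := hc.ne hv i
  have h2 := hc.ne hv (i + 1)
  exact neg_ne_zero.2 (mul_ne_zero (sub_ne_zero.2 h1.2.symm) (sub_ne_zero.2 h2.1.symm))

/-- No monotonicity of `w` is assumed: the pattern alone forces it once edge `k` of the pattern is
turned eastward. The sign of each cross product is the turn code, so the two turns at a vertical
edge decide whether the next horizontal edge keeps the direction of the previous one. -/
theorem exists_chains_of_realizes {S : Fin n → Turn} (hp : IsPattern S k m a) {w : Vertices n}
    (hw : Realizes w S) :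
    ∃ x y, EastWest a m x y ∧ Separated a (m - a) x (upperX m x) y (upperY m y) ∧
      perimeter w = ∑ i ∈ Finset.range m, (|x (i + 1) - x i| + |y (i + 1) - y i|) ∧
      ∀ i < m, 0 < code S k (2 * i + 1) * ((x (i + 1) - x i) * (y (i + 1) - y i)) := by
  obtain ⟨hw, k₁, hk₁⟩ := hw
  obtain ⟨u, hu, htu, hpu, hhu, hxu⟩ := hw.exists_eastward (k₁ + k)
  obtain ⟨m', x, y, hc⟩ := exists_corners hu hhu
  obtain rfl : m = m' := by have := hp.length; have := hc.length; omega
  have hcode : ∀ i, (turnAt u (idx (k₁ + k) i)).code = code S k i := fun i => by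
    rw [htu, code, idx, add_assoc, hk₁, idx]
  have ho := hc.sign_odd hu
  have he := hc.sign_even hu
  simp only [hcode] at ho he
  have hcx := (hc.periodic 0).1
  have hcy := (hc.periodic 0).2
  rw [zero_add] at hcx hcy
  have hne := fun i => (hc.ne hu i).1
  have hpos := hp.pos
  have hlt := hp.lt
  have h0 : x 0 < x 1 := by
    have e1 := hc.even 0
    have e2 := hc.odd 0
    rw [mul_zero, idx_zero] at e1
    rw [mul_zero, idx_succ, idx_zero] at e2
    rwa [e1, e2] at hxu
  have heast : ∀ i < a, x i < x (i + 1) := by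
    intro i
    induction i with
    | zero => exact fun _ => h0
    | succ i ih =>
      intro hi
      have h1 := ih (by omega)
      have h2 := ho i
      have h3 := he i
      rw [hp.turns_of_inner (by omega) (by omega)] at h3
      have h4 : 0 < (code S k (2 * i + 1) * (y (i + 1) - y i)) * (x (i + 1) - x i) := by
        linarith
      have h5 := pos_of_mul_pos_left h4 (by omega)
      have h6 : 0 < (code S k (2 * i + 1) * (y (i + 1) - y i)) * (x (i + 2) - x (i + 1)) := by
        linarith
      have := pos_of_mul_pos_right h6 h5.le
      rw [show i + 1 + 1 = i + 2 by ring]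
      omega
  have hwest : ∀ i, a ≤ i → i < m → x (i + 1) < x i := by
    intro i hi
    induction i, hi using Nat.le_induction with
    | base =>
      intro _
      obtain ⟨i, rfl⟩ : ∃ i, a = i + 1 := ⟨a - 1, by omega⟩
      have h1 := heast i (by omega)
      have h2 := ho i
      have h3 := he i
      obtain ⟨h4, h5⟩ := hp.turns_of_extreme (i := i) (by omega) (by omega)
      rw [h4, one_mul] at h2
      rw [h5, one_mul] at h3
      have h6 := pos_of_mul_pos_right h2 (by omega)
      have h7 : 0 < (y (i + 1) - y i) * (x (i + 1) - x (i + 2)) := by linarith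
      have := pos_of_mul_pos_right h7 h6.le
      rw [show i + 1 + 1 = i + 2 by ring]
      omega
    | succ i hi ih =>
      intro him
      have h1 := ih (by omega)
      have h2 := ho i
      have h3 := he i
      rw [hp.turns_of_inner (by omega) (by omega)] at h3
      have h4 : 0 < (-code S k (2 * i + 1) * (y (i + 1) - y i)) * (x i - x (i + 1)) := by
        linarith
      have h5 := pos_of_mul_pos_left h4 (by omega)
      have h6 : 0 < (-code S k (2 * i + 1) * (y (i + 1) - y i)) * (x (i + 1) - x (i + 2)) := by
        linarith
      have := pos_of_mul_pos_right h6 h5.le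
      rw [show i + 1 + 1 = i + 2 by ring]
      omega
  have hew : EastWest a m x y := ⟨hpos, hlt, hcx, hcy, heast, hwest⟩
  refine ⟨x, y, hew, hew.separated (hc.noCross hu) ?_, ?_, fun i _ => ho i⟩
  -- The left turn after the last westward edge makes the leftmost edge go down, which puts the
  -- upper chain on top at the left end.
  · have h1 := hwest (m - 1) (by omega) (by omega)
    have h2 := ho (m - 1)
    obtain ⟨h4, -⟩ := hp.turns_of_extreme (i := m - 1) (by omega) (by omega)
    rw [h4, one_mul] at h2
    rw [show m - 1 + 1 = m by omega] at h1 h2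
    have h3 : 0 < (y (m - 1) - y m) * (x (m - 1) - x m) := by linarith
    have := pos_of_mul_pos_left h3 (by omega)
    omega
  · rw [← hpu, hc.perimeter_eq]

/-! ### Every `x`-monotone sequence has a pattern -/

/-- At an inner vertical edge the direction is kept, so the turns are opposite. At the two extreme
edges it reverses, and separation makes the right edge go up and the left edge go down, so all their
turns are left. -/
theorem EastWest.isPattern {S : Fin n → Turn} {k₁ : Fin n} (hc : Corners v k₁ m x y)
    (hv : IsPolygon v) (h : EastWest a m x y) (h0 : y 0 < y (m - 1))
    (hS : ∀ i, (turnAt v (idx k₁ i)).code = code S k i) : IsPattern S k m a := by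
  have hs := h.separated (hc.noCross hv) h0
  have ho := hc.sign_odd hv
  have he := hc.sign_even hv
  simp only [hS] at ho he
  have hlt := h.lt
  have hpos := h.pos
  refine ⟨hc.length, h.pos, h.lt, fun i hi => ?_⟩
  have h1 := ho i
  have h2 := he i
  have h3 := code_eq S k (2 * i + 1)
  have h4 := code_eq S k (2 * i + 2)
  by_cases hia : i < a
  · have e1 := h.east i hia
    by_cases hia' : i + 1 = a
    · rw [if_pos (Or.inl hia')]
      have e2 := h.west (i + 1) (by omega) (by omega)
      have e3 : y i < y (i + 1) :=
        hs.lt_of_le hia (by omega) (by omega) (by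
          subst hia'
          by_contra hc'
          exact absurd e1 (by omega)) (by omega)
      have e4 := pos_of_mul_pos_left h1 (mul_nonneg (by omega) (by omega))
      have e5 := pos_of_mul_pos_left h2 (by
        rw [← mul_neg]; exact mul_nonneg (by omega) (by rw [show i + 2 = i + 1 + 1 by ring]; omega))
      omega
    · rw [if_neg (by omega)]
      have e2 := h.east (i + 1) (by omega)
      rw [show i + 1 + 1 = i + 2 by ring] at e2
      rcases h3 with h3 | h3 <;> rcases h4 with h4 | h4 <;> rw [h3] at h1 <;> rw [h4] at h2 <;>
        rw [h3, h4] <;> norm_num <;> nlinarith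
  · have e1 := h.west i (by omega) hi
    by_cases him : i + 1 = m
    · rw [if_pos (Or.inr him)]
      have e2 := h.east 0 hpos
      have e3 := hc.periodic 1
      rw [show m - 1 = i by omega] at h0
      have hy := h.closed_y
      have hx := h.closed_x
      rw [him, hy, hx] at h1
      rw [him, hy, hx, show i + 2 = 1 + m by omega, e3.1] at h2
      rw [him, hx] at e1
      have e4 : 0 < (y 0 - y i) * (x 0 - x i) := mul_pos_of_neg_of_neg (by omega) (by omega)
      have e5 : 0 < -((y 0 - y i) * (x 1 - x 0)) := by
        rw [← neg_mul]
        exact mul_pos (by omega) (by simpa using e2)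
      have e6 := pos_of_mul_pos_left h1 (by linarith)
      have e7 := pos_of_mul_pos_left h2 e5.le
      omega
    · rw [if_neg (by omega)]
      have e2 := h.west (i + 1) (by omega) (by omega)
      rw [show i + 1 + 1 = i + 2 by ring] at e2
      rcases h3 with h3 | h3 <;> rcases h4 with h4 | h4 <;> rw [h3] at h1 <;> rw [h4] at h2 <;>
        rw [h3, h4] <;> norm_num <;> nlinarith

theorem exists_eastWest (hv : IsPolygon v) (hm : IsXMonotone v) :
    ∃ k m a x y, Corners v k m x y ∧ EastWest a m x y := by
  obtain ⟨k, d, hk⟩ := hm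
  have hk' : ∀ i < n, (i < d → (v (idx k i)).1 ≤ (v (idx k (i + 1))).1) ∧
      (d ≤ i → (v (idx k (i + 1))).1 ≤ (v (idx k i)).1) := by
    intro i hi
    have := hk (Fin.ofNat n i)
    rwa [Fin.val_ofNat, Nat.mod_eq_of_lt hi, ← idx, ← idx_succ] at this
  obtain ⟨r, hr, hhr⟩ : ∃ r, r ≤ 1 ∧ IsHorizontal v (idx k r) := by
    rcases isHorizontal_or_succ hv k with h | h
    · exact ⟨0, by omega, by rwa [idx_zero]⟩
    · exact ⟨1, le_rfl, by rwa [show 1 = 0 + 1 from rfl, idx_succ, idx_zero]⟩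
  obtain ⟨m, x, y, hc⟩ := exists_corners hv hhr
  have hn := hc.length
  have hn0 : n ≠ 0 := NeZero.ne n
  have hne := fun i => (hc.ne hv i).1
  have hx : ∀ i < m, (r + 2 * i < d → x i < x (i + 1)) ∧ (d ≤ r + 2 * i → x (i + 1) < x i) := by
    intro i hi
    have h1 := hk' (r + 2 * i) (by omega)
    rw [add_assoc, idx_add, idx_add, hc.even, hc.odd] at h1
    have h2 := hne i
    simp only at h1
    omega
  have hcx := (hc.periodic 0).1
  have hcy := (hc.periodic 0).2
  rw [zero_add] at hcx hcy
  -- The horizontal edge `i` has position `r + 2 * i` on the walk; `a` counts those among the first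
  -- `d` positions.
  set a := min m ((d - r + 1) / 2) with ha
  have heast : ∀ i < a, x i < x (i + 1) := fun i hi => (hx i (by omega)).1 (by omega)
  have hwest : ∀ i, a ≤ i → i < m → x (i + 1) < x i := fun i h1 h2 => (hx i h2).2 (by omega)
  refine ⟨idx k r, m, a, x, y, hc, ?_, ?_, hcx, hcy, heast, hwest⟩
  · by_contra ha0
    have h1 : ∀ j ≤ m, x j + j ≤ x 0 := by
      intro j
      induction j with
      | zero => simp
      | succ j ih =>
        intro hj
        have h1 := ih (by omega)
        have h2 := hwest j (by omega) (by omega)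
        push_cast
        omega
    have := h1 m le_rfl
    omega
  · by_contra ham
    have hma : m ≤ a := by omega
    have := strictMono_upto heast (Nat.zero_le m) hma
    push_cast at this
    omega

theorem exists_isPattern {S : Fin n → Turn} (hS : IsXMonotoneSeq S) :
    ∃ k m a, IsPattern S k m a ∧ m ≤ 2 * a := by
  suffices h : ∃ k m a, IsPattern S k m a by
    obtain ⟨k, m, a, h⟩ := h
    have := h.lt
    by_cases h2 : m ≤ 2 * a
    · exact ⟨k, m, a, h, h2⟩
    · exact ⟨_, m, m - a, h.swap, by omega⟩
  obtain ⟨v, ⟨hv, k₁, hk₁⟩, hm⟩ := hS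
  obtain ⟨k, m, a, x, y, hc, h⟩ := exists_eastWest hv hm
  have hcode : ∀ i, (turnAt v (idx k i)).code = code S (k - k₁) i := fun i => by
    rw [code, ← hk₁, idx, idx, ← add_assoc, add_sub_cancel]
  have hlt := h.lt
  rcases lt_or_gt_of_ne (hc.ne hv (m - 1)).2 with h1 | h1
  -- If the westward chain were below, the reflected polygon would have positive area and the
  -- original one negative area, against the counterclockwise orientation.
  · exfalso
    rw [show m - 1 + 1 = m by omega, h.closed_y] at h1
    have h2 := h.neg.area_pos (h.neg.separated (hc.noCross hv).neg (by simpa using h1))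
    have h3 := hv.ccw
    rw [hc.area_eq] at h3
    simp only [mul_neg, Finset.sum_neg_distrib] at h2
    omega
  · rw [show m - 1 + 1 = m by omega, h.closed_y] at h1
    exact ⟨_, m, a, h.isPattern hc hv h1 hcode⟩

end RectPoly

/-! ### Reduction to choosing the breakpoints of the upper chain. -/

namespace RectPoly

variable {n : ℕ} [NeZero n] {v : Vertices n} {k : Fin n} {m a : ℕ} {x y : ℕ → ℤ}

/-! ### The combinatorial optimization problem -/

/-- The heights of the lower chain when all its vertical edges have length `1`. -/
def lowerHeight (T : ℕ → ℤ) : ℕ → ℤ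
  | 0 => 0
  | i + 1 => lowerHeight T i + T (2 * i + 1)

/-- The heights of the upper chain, from left to right, when all its vertical edges have
length `1`. -/
def upperHeight (T : ℕ → ℤ) (m : ℕ) : ℕ → ℤ
  | 0 => 0
  | j + 1 => upperHeight T m j + T (2 * (m - 2 - j) + 1)

/-- The upper chain with breakpoints `z` fits above a lower chain with horizontal unit edges if it
is lifted by more than `C`. -/
structure Admissible (a b : ℕ) (P Q : ℕ → ℤ) (z : ℕ → ℤ) (C : ℤ) : Prop where
  first : z 0 = 0
  last : z b = a
  step : ∀ j < b, z j < z (j + 1)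
  le : ∀ i j, i < a → j < b → Touch (fun i => (i : ℤ)) z i j → P i - Q j ≤ C

/-- The perimeter of the polygon of width `a` whose left edge has length `C + 1`, while the other
vertical edges, except the rightmost one, have unit length. -/
def canonicalPerimeter (T : ℕ → ℤ) (m a : ℕ) (C : ℤ) : ℤ :=
  2 * a + (m - 2) + upperHeight T m (m - a - 1) - lowerHeight T (a - 1) + 2 * (1 + C)

theorem sum_range_split (f : ℕ → ℤ) {a m : ℕ} (ha : 0 < a) (hm : a < m) :
    ∑ i ∈ Finset.range m, f i = ∑ i ∈ Finset.range (a - 1), f i + f (a - 1) +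
      ∑ j ∈ Finset.range (m - a - 1), f (m - 2 - j) + f (m - 1) := by
  have h1 := Finset.sum_range_add f a (m - a)
  rw [show a + (m - a) = m by omega] at h1
  have h2 := Finset.sum_range_succ f (a - 1)
  rw [show a - 1 + 1 = a by omega] at h2
  have h3 := Finset.sum_range_succ (fun i => f (a + i)) (m - a - 1)
  rw [show m - a - 1 + 1 = m - a by omega, show a + (m - a - 1) = m - 1 by omega] at h3
  rw [h1, h2, h3, ← Finset.sum_range_reflect (fun i => f (a + i)), add_assoc, add_assoc, add_assoc]
  congr 3
  refine Finset.sum_congr rfl fun j hj => ?_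
  rw [Finset.mem_range] at hj
  congr 1
  omega

theorem EastWest.sum_abs (h : EastWest a m x y) :
    ∑ i ∈ Finset.range m, |x (i + 1) - x i| = 2 * (x a - x 0) := by
  have h1 := Finset.sum_range_add (fun i => |x (i + 1) - x i|) a (m - a)
  have hlt := h.lt
  rw [show a + (m - a) = m by omega] at h1
  have h2 : ∑ i ∈ Finset.range a, |x (i + 1) - x i| = x a - x 0 := by
    rw [← Finset.sum_range_sub]
    refine Finset.sum_congr rfl fun i hi => abs_of_pos ?_
    have := h.east i (Finset.mem_range.1 hi)
    omega
  have h3 : ∑ i ∈ Finset.range (m - a), |x (a + i + 1) - x (a + i)| = x a - x m := by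
    have := Finset.sum_range_sub' (fun i => x (a + i)) (m - a)
    rw [show a + (m - a) = m by omega, add_zero] at this
    rw [← this]
    refine Finset.sum_congr rfl fun i hi => ?_
    have := h.west (a + i) (by omega) (by have := Finset.mem_range.1 hi; omega)
    rw [abs_of_neg (by omega), neg_sub, add_assoc]
  rw [h1, h2, h3, h.closed_x]
  ring

/-- Lower bound half of the reduction: every realization is at least as long as some canonical
polygon. -/
theorem exists_admissible_le_perimeter {S : Fin n → Turn} (hp : IsPattern S k m a)
    (hma : m ≤ 2 * a) {w : Vertices n} (hw : Realizes w S) :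
    ∃ z C, Admissible a (m - a) (lowerHeight (code S k)) (upperHeight (code S k) m) z C ∧
      canonicalPerimeter (code S k) m a C ≤ perimeter w := by
  obtain ⟨x, y, h, hs, hper, hsign⟩ := exists_chains_of_realizes hp hw
  set T := code S k with hT
  have hpos := h.pos
  have hlt := h.lt
  rw [Finset.sum_add_distrib, h.sum_abs, sum_range_split (fun i => |y (i + 1) - y i|) hpos hlt]
    at hper
  have hTabs : ∀ i, |T i| = 1 := fun i => by rcases code_eq S k i with h | h <;> rw [hT, h] <;> rfl
  have hP : ∀ i < a - 1, |lowerHeight T (i + 1) - lowerHeight T i| = 1 ∧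
      0 < (lowerHeight T (i + 1) - lowerHeight T i) * (y (i + 1) - y i) := by
    intro i hi
    rw [lowerHeight, add_sub_cancel_left]
    refine ⟨hTabs _, ?_⟩
    have h1 := hsign i (by omega)
    have h2 := h.east i (by omega)
    refine pos_of_mul_pos_left (b := x (i + 1) - x i) ?_ (by omega)
    linarith
  have hQ : ∀ j < m - a - 1, |upperHeight T m (j + 1) - upperHeight T m j| = 1 ∧
      0 < (upperHeight T m (j + 1) - upperHeight T m j) *
        (upperY m y (j + 1) - upperY m y j) := by
    intro j hj
    rw [upperHeight, add_sub_cancel_left]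
    refine ⟨hTabs _, ?_⟩
    have h1 := hsign (m - 2 - j) (by omega)
    have h2 := h.west (m - 2 - j) (by omega) (by omega)
    refine pos_of_mul_pos_left (b := x (m - 2 - j) - x (m - 2 - j + 1)) ?_ (by omega)
    rw [upperY, upperY, show m - 1 - (j + 1) = m - 2 - j by omega,
      show m - 1 - j = m - 2 - j + 1 by omega]
    linarith
  have hs' : Separated (a - 1 + 1) (m - a - 1 + 1) x (upperX m x) y (upperY m y) := by
    rwa [show a - 1 + 1 = a by omega, show m - a - 1 + 1 = m - a by omega]
  -- The right side is the vertical lower bound solved for `P i - Q j`. Integer division rounds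
  -- down, which is harmless as the left side is an integer and only twice the quotient enters the
  -- perimeter.
  have hbound : ∀ i j, i < a → j < m - a → Touch x (upperX m x) i j →
      lowerHeight T i - upperHeight T m j ≤ (perimeter w - 2 * (x a - x 0) - (m - 2) -
        upperHeight T m (m - a - 1) + lowerHeight T (a - 1) - 2) / 2 := by
    intro i j hi hj ht
    have h1 := hs'.vertical_lower_bound hP hQ rfl rfl (show i ≤ a - 1 by omega)
      (show j ≤ m - a - 1 by omega) ht
    have h2 := hs 0 0 hpos (by omega) ⟨h.left_eq ▸ (h.upper_step 0 (by omega)).le,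
      h.left_eq ▸ (h.east 0 hpos).le⟩
    have h3 := hs (a - 1) (m - a - 1) (by omega) (by omega) (by
      have e1 := h.right_eq
      have e2 := h.east (a - 1) (by omega)
      have e3 := h.upper_step (m - a - 1) (by omega)
      rw [Touch]
      rw [show m - a - 1 + 1 = m - a by omega] at e3 ⊢
      rw [show a - 1 + 1 = a by omega] at e2 ⊢
      omega)
    have h4 : ∑ r ∈ Finset.range (m - a - 1), |upperY m y (r + 1) - upperY m y r| =
        ∑ j ∈ Finset.range (m - a - 1), |y (m - 2 - j + 1) - y (m - 2 - j)| := by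
      refine Finset.sum_congr rfl fun r hr => ?_
      rw [Finset.mem_range] at hr
      rw [abs_sub_comm, upperY, upperY, show m - 1 - (r + 1) = m - 2 - r by omega,
        show m - 1 - r = m - 2 - r + 1 by omega]
    rw [h4] at h1
    rw [show m - 1 + 1 = m by omega, show a - 1 + 1 = a by omega, h.closed_y] at hper
    rw [upperY, upperY, show m - 1 - 0 = m - 1 by omega,
      show m - 1 - (m - a - 1) = a by omega] at h1
    rw [upperY, show m - 1 - 0 = m - 1 by omega] at h2
    rw [upperY, show m - 1 - (m - a - 1) = a by omega] at h3
    rw [abs_of_pos (show 0 < y a - y (a - 1) by omega),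
      abs_of_neg (show y 0 - y (m - 1) < 0 by omega)] at hper
    omega
  -- Saving width `U` gains `2 * U`, while the larger bound on height differences costs at most `2 *
  -- U`.
  obtain ⟨z, hz0, hz1, hz2, hz3⟩ := exists_compressed hpos (by omega) h.east h.upper_step
    h.left_eq h.right_eq (fun i hi => (hP i (by omega)).1.le) hbound
  refine ⟨z, _, ⟨hz0, hz1, hz2, hz3⟩, ?_⟩
  rw [canonicalPerimeter]
  omega

/-! ### Canonical polygons -/

theorem corners_of_values {X Y : ℕ → ℤ} {A B : ℕ → ℤ} (hn : n = 2 * m)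
    (hA : ∀ i < m, A (2 * i) = X i ∧ A (2 * i + 1) = X (i + 1))
    (hB : ∀ i < m, B (2 * i) = Y i ∧ B (2 * i + 1) = Y i) (hX : X m = X 0) :
    Corners (fun i : Fin n => (A i.val, B i.val)) 0 m (fun i => X (i % m)) (fun i => Y (i % m)) := by
  have hm : 0 < m := by have := NeZero.ne n; omega
  refine ⟨hn, fun i => ?_, fun i => ?_⟩
  · have h1 := Nat.mod_lt i hm
    simp only [val_idx, Fin.val_zero, zero_add]
    rw [hn, Nat.mul_mod_mul_left, (hA _ h1).1, (hB _ h1).1]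
  · have h1 := Nat.mod_lt i hm
    have h2 : (2 * i + 1) % n = 2 * (i % m) + 1 := by
      rw [hn, Nat.mod_mul, show (2 * i + 1) / 2 = i by omega]
      omega
    simp only [val_idx, Fin.val_zero, zero_add]
    rw [h2, (hA _ h1).2, (hB _ h1).2]
    congr 1
    rw [← Nat.mod_add_mod]
    by_cases h3 : i % m + 1 = m
    · rw [h3, Nat.mod_self, hX]
    · rw [Nat.mod_eq_of_lt (show i % m + 1 < m by omega)]

/-- The `x`-coordinates of the canonical polygon. -/
def canonicalX (a m : ℕ) (z : ℕ → ℤ) (i : ℕ) : ℤ := if i ≤ a then i else z (m - i)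

/-- The `y`-coordinates of the canonical polygon. -/
def canonicalY (a m : ℕ) (P Q : ℕ → ℤ) (C : ℤ) (i : ℕ) : ℤ :=
  if i < a then P i else C + 1 + Q (m - 1 - i)

/-- Upper bound half of the reduction. `A` and `B` are abstract coordinate sequences, to be
instantiated by the output arrays of the program. -/
theorem realizes_canonical {S : Fin n → Turn} (hp : IsPattern S k m a) {z : ℕ → ℤ} {C : ℤ}
    (hz : Admissible a (m - a) (lowerHeight (code S k)) (upperHeight (code S k) m) z C)
    {A B : ℕ → ℤ}
    (hA : ∀ i < m, A (2 * i) = canonicalX a m z i ∧ A (2 * i + 1) = canonicalX a m z (i + 1))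
    (hB : ∀ i < m,
      B (2 * i) = canonicalY a m (lowerHeight (code S k)) (upperHeight (code S k) m) C i ∧
      B (2 * i + 1) = canonicalY a m (lowerHeight (code S k)) (upperHeight (code S k) m) C i) :
    Realizes (fun i : Fin n => (A i.val, B i.val)) S ∧
      perimeter (fun i : Fin n => (A i.val, B i.val)) = canonicalPerimeter (code S k) m a C := by
  set T := code S k with hT
  set P := lowerHeight T with hPdef
  set Q := upperHeight T m with hQdef
  have hpos := hp.pos
  have hlt := hp.lt
  have hTeq : ∀ i, T i = 1 ∨ T i = -1 := code_eq S k
  have hXm : canonicalX a m z m = canonicalX a m z 0 := by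
    rw [canonicalX, canonicalX, if_neg (by omega), if_pos (by omega), Nat.sub_self, hz.first]
    rfl
  have hc := corners_of_values hp.length hA hB hXm
  set v : Vertices n := fun i : Fin n => (A i.val, B i.val)
  set x : ℕ → ℤ := fun i => canonicalX a m z (i % m) with hxdef
  set y : ℕ → ℤ := fun i => canonicalY a m P Q C (i % m) with hydef
  have hx1 : ∀ i ≤ a, x i = i := fun i hi => by
    rw [hxdef]
    simp only
    rw [Nat.mod_eq_of_lt (by omega), canonicalX, if_pos hi]
  have hx2 : ∀ i, a ≤ i → i ≤ m → x i = z (m - i) := fun i h1 h2 => by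
    rcases h1.eq_or_lt with rfl | h1
    · rw [hx1 a le_rfl, hz.last]
    · rw [hxdef]
      simp only
      rcases h2.eq_or_lt with rfl | h2
      · rw [Nat.mod_self, Nat.sub_self, hz.first, canonicalX, if_pos (by omega)]
        rfl
      · rw [Nat.mod_eq_of_lt h2, canonicalX, if_neg (by omega)]
  have hy1 : ∀ i < a, y i = P i := fun i hi => by
    rw [hydef]
    simp only
    rw [Nat.mod_eq_of_lt (by omega), canonicalY, if_pos hi]
  have hy2 : ∀ i, a ≤ i → i < m → y i = C + 1 + Q (m - 1 - i) := fun i h1 h2 => by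
    rw [hydef]
    simp only
    rw [Nat.mod_eq_of_lt (by omega), canonicalY, if_neg (by omega)]
  have hym : y m = 0 := by
    rw [hydef]
    simp only
    rw [Nat.mod_self, canonicalY, if_pos hpos]
    rfl
  have hew : EastWest a m x y := by
    refine ⟨hpos, hlt, ?_, ?_, fun i hi => ?_, fun i h1 h2 => ?_⟩
    · rw [hx2 m (by omega) le_rfl, hx1 0 (by omega), Nat.sub_self, hz.first]
      rfl
    · rw [hym, hy1 0 hpos]
      rfl
    · rw [hx1 i hi.le, hx1 (i + 1) hi]
      push_cast
      omega
    · rw [hx2 i h1 h2.le, hx2 (i + 1) (by omega) h2]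
      have := hz.step (m - (i + 1)) (by omega)
      rwa [show m - (i + 1) + 1 = m - i by omega] at this
  have htouch : ∀ i j, i < a → j < m - a → Touch x (upperX m x) i j → P i - Q j ≤ C := by
    intro i j hi hj ht
    refine hz.le i j hi hj ?_
    rw [Touch, upperX, upperX, hx1 i hi.le, hx1 (i + 1) hi, hx2 _ (by omega) (by omega),
      hx2 _ (by omega) (by omega), show m - (m - (j + 1)) = j + 1 by omega,
      show m - (m - j) = j by omega] at ht
    exact ht
  have hs : Separated a (m - a) x (upperX m x) y (upperY m y) := by
    intro i j hi hj ht
    have := htouch i j hi hj ht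
    rw [upperY, hy1 i hi, hy2 _ (by omega) (by omega), show m - 1 - (m - 1 - j) = j by omega]
    omega
  -- The first steps of the chains touch, and so do the last ones; this makes the left and the right
  -- edge have positive length.
  have hleft : 0 ≤ C := htouch 0 0 hpos (by omega) ⟨by
    rw [hew.left_eq]; exact (hew.upper_step 0 (by omega)).le, by
    rw [← hew.left_eq]; exact (hew.east 0 hpos).le⟩
  have hright : P (a - 1) - Q (m - a - 1) ≤ C := htouch (a - 1) (m - a - 1) (by omega) (by omega)
    (by
      have e1 := hew.right_eq
      have e2 := hew.east (a - 1) (by omega)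
      have e3 := hew.upper_step (m - a - 1) (by omega)
      rw [Touch]
      rw [show m - a - 1 + 1 = m - a by omega] at e3 ⊢
      rw [show a - 1 + 1 = a by omega] at e2 ⊢
      omega)
  have hdy1 : ∀ i, i + 1 < a → y (i + 1) - y i = T (2 * i + 1) := fun i hi => by
    rw [hy1 _ hi, hy1 i (by omega), hPdef, lowerHeight, add_sub_cancel_left]
  have hdy2 : y a - y (a - 1) = C + 1 + Q (m - a - 1) - P (a - 1) := by
    rw [hy2 a le_rfl hlt, hy1 _ (by omega), show m - 1 - a = m - a - 1 by omega]
  have hdy3 : ∀ i, a ≤ i → i + 1 < m → y (i + 1) - y i = - T (2 * i + 1) := fun i h1 h2 => by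
    rw [hy2 _ h1 (by omega), hy2 (i + 1) (by omega) h2,
      show m - 1 - i = m - 1 - (i + 1) + 1 by omega, hQdef, upperHeight,
      show m - 2 - (m - 1 - (i + 1)) = i by omega]
    ring
  have hdy4 : y m - y (m - 1) = - (C + 1) := by
    rw [hym, hy2 _ (by omega) (by omega), Nat.sub_self, hQdef, upperHeight]
    ring
  have hsign : ∀ i < m, 0 < T (2 * i + 1) * ((x (i + 1) - x i) * (y (i + 1) - y i)) ∧
      0 < T (2 * i + 2) * (-((y (i + 1) - y i) * (x (i + 2) - x (i + 1)))) := by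
    intro i hi
    have hT2 := hTeq (2 * i + 1)
    by_cases hia : i < a
    · have e1 := hew.east i hia
      by_cases hia' : i + 1 = a
      · have e2 := hew.west (i + 1) (by omega) (by omega)
        rw [show i + 1 + 1 = i + 2 by ring] at e2
        obtain ⟨e3, e4⟩ := hp.turns_of_extreme hi (Or.inl hia')
        rw [← hT] at e3 e4
        rw [show a - 1 = i by omega, ← hia'] at hdy2
        rw [show a - 1 = i by omega, ← hia'] at hright
        rw [e3, e4, one_mul, one_mul, ← mul_neg]
        exact ⟨mul_pos (by omega) (by omega), mul_pos (by omega) (by omega)⟩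
      · have e2 := hew.east (i + 1) (by omega)
        rw [show i + 1 + 1 = i + 2 by ring] at e2
        have e3 := hp.turns_of_inner hi (by omega)
        rw [← hT] at e3
        rw [e3, hdy1 i (by omega)]
        rcases hT2 with e4 | e4 <;> rw [e4] <;> omega
    · have e1 := hew.west i (by omega) hi
      by_cases him : i + 1 = m
      · obtain ⟨e3, e4⟩ := hp.turns_of_extreme hi (Or.inr him)
        rw [← hT] at e3 e4
        rw [show m - 1 = i by omega] at hdy4
        have e5 := hew.east 0 hpos
        have e6 := (hc.periodic 1).1
        have e7 := hew.closed_x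
        rw [show i + 2 = 1 + m by omega, e6, e3, e4, one_mul, one_mul, him, hdy4, ← neg_mul]
        rw [him] at e1
        rw [zero_add] at e5
        exact ⟨mul_pos_of_neg_of_neg (by omega) (by omega), mul_pos (by omega) (by omega)⟩
      · have e2 := hew.west (i + 1) (by omega) (by omega)
        rw [show i + 1 + 1 = i + 2 by ring] at e2
        have e3 := hp.turns_of_inner hi (by omega)
        rw [← hT] at e3
        rw [e3, hdy3 i (by omega) (by omega)]
        rcases hT2 with e4 | e4 <;> rw [e4] <;> omega
  have hyne : ∀ i < m, y i ≠ y (i + 1) := by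
    intro i hi he
    have := (hsign i hi).1
    rw [he, sub_self, mul_zero, mul_zero] at this
    exact lt_irrefl _ this
  have hturn : ∀ e, turnAt v (idx 0 e) = S (idx k e) := by
    intro e
    have hn := hp.length
    -- Every vertex is an end of exactly one vertical edge; vertex `0` appears as `2 * (m - 1) + 2 =
    -- n`.
    obtain ⟨i, hi, he⟩ : ∃ i < m, e % n = (2 * i + 1) % n ∨ e % n = (2 * i + 2) % n := by
      have h1 : e % n < n := Nat.mod_lt _ (Nat.pos_of_ne_zero (NeZero.ne n))
      by_cases h2 : e % n = 0
      · exact ⟨m - 1, by omega, Or.inr (by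
          rw [show 2 * (m - 1) + 2 = n by omega, Nat.mod_self, h2])⟩
      · refine ⟨(e % n - 1) / 2, by omega, ?_⟩
        rcases Nat.even_or_odd' (e % n - 1) with ⟨r, h3 | h3⟩
        · left
          rw [Nat.mod_eq_of_lt (a := 2 * _ + 1) (by omega)]
          omega
        · right
          rw [Nat.mod_eq_of_lt (a := 2 * _ + 2) (by omega)]
          omega
    rw [← idx_mod 0 e, ← idx_mod k e]
    rcases he with he | he
    · rw [he, idx_mod, idx_mod]
      refine turnAt_eq_of_pos ?_
      rw [hc.cross_odd]
      exact (hsign i hi).1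
    · rw [he, idx_mod, idx_mod]
      refine turnAt_eq_of_pos ?_
      rw [hc.cross_even]
      exact (hsign i hi).2
  refine ⟨⟨hc.isPolygon hew hs hyne, -k, fun i => ?_⟩, ?_⟩
  · have h1 := hturn (i - k).val
    rwa [idx, idx, Fin.ofNat_val_eq_self, add_sub_cancel, zero_add, sub_eq_neg_add] at h1
  · rw [hc.perimeter_eq, Finset.sum_add_distrib, hew.sum_abs,
      sum_range_split (fun i => |y (i + 1) - y i|) hpos hlt]
    have h1 : ∑ i ∈ Finset.range (a - 1), |y (i + 1) - y i| = (a - 1 : ℕ) := by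
      rw [Finset.sum_congr rfl (g := fun _ => 1)]
      · simp
      · intro i hi
        rw [Finset.mem_range] at hi
        rw [hdy1 i (by omega)]
        rcases hTeq (2 * i + 1) with h | h <;> rw [h] <;> rfl
    have h2 : ∑ j ∈ Finset.range (m - a - 1), |y (m - 2 - j + 1) - y (m - 2 - j)| =
        (m - a - 1 : ℕ) := by
      rw [Finset.sum_congr rfl (g := fun _ => 1)]
      · simp
      · intro j hj
        rw [Finset.mem_range] at hj
        rw [hdy3 _ (by omega) (by omega)]
        rcases hTeq (2 * (m - 2 - j) + 1) with h | h <;> rw [h] <;> rfl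
    have h3 : |y a - y (a - 1)| = C + 1 + Q (m - a - 1) - P (a - 1) := by
      rw [hdy2, abs_of_pos (by omega)]
    have h4 : |y m - y (m - 1)| = C + 1 := by
      rw [hdy4, abs_neg, abs_of_pos (by omega)]
    rw [h1, h2, show a - 1 + 1 = a by omega, show m - 1 + 1 = m by omega, h3, h4, hx1 a le_rfl,
      hx1 0 (by omega), canonicalPerimeter, ← hPdef, ← hQdef]
    push_cast
    omega

end RectPoly

/-! ### The bottleneck recurrence: optimality and traceback. -/

namespace RectPoly

/-! ### The dynamic program -/

/-- The heights of the upper chain, shifted by one index. -/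
def shifted (Q : ℕ → ℤ) : ℕ → ℤ
  | 0 => 0
  | j + 1 => Q j

/-- `bottleneck P R inf i (j + 1)` is the least bound on the differences of heights that is possible
if step `i` of the lower chain lies below step `j` of the upper chain. Column `0` is a border that
cannot be reached. -/
def bottleneck (P R : ℕ → ℤ) (inf : ℤ) : ℕ → ℕ → ℤ
  | 0, j => if j = 1 then 0 else inf
  | _ + 1, 0 => inf
  | i + 1, j + 1 => max (P (i + 1) - R (j + 1))
      (min (bottleneck P R inf i (j + 1))
        (max (bottleneck P R inf i j) (max (P i - R (j + 1)) (P (i + 1) - R j))))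

variable {P Q R : ℕ → ℤ} {inf C : ℤ} {a b : ℕ} {z : ℕ → ℤ}

theorem bottleneck_col_zero (i : ℕ) : bottleneck P R inf i 0 = inf := by
  cases i <;> simp [bottleneck]

/-- Keeps the table entries within the word size; `inf` will be `n`. -/
theorem abs_bottleneck_le (h : ∀ i < a, ∀ j ≤ b, |P i - R j| ≤ inf) (i j : ℕ) (hi : i < a)
    (hj : j ≤ b) : |bottleneck P R inf i j| ≤ inf := by
  have h0 : 0 ≤ inf := (abs_nonneg _).trans (h i hi j hj)
  induction i generalizing j with
  | zero =>
    rw [bottleneck]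
    split_ifs
    · simpa using h0
    · rw [abs_of_nonneg h0]
  | succ i ih =>
    cases j with
    | zero => rw [bottleneck, abs_of_nonneg h0]
    | succ j =>
      have h1 := ih (j + 1) (by omega) hj
      have h2 := ih j (by omega) (by omega)
      have h3 := h (i + 1) hi (j + 1) hj
      have h4 := h i (by omega) (j + 1) hj
      have h5 := h (i + 1) hi j (by omega)
      rw [bottleneck]
      rw [abs_le] at *
      omega

/-- The bound `< inf` excludes the unreachable cells of row `0`, whose value has nothing to do with
the heights. -/
theorem le_bottleneck (hP : P 0 = 0) (hQ : Q 0 = 0) {i j : ℕ}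
    (h : bottleneck P (shifted Q) inf i (j + 1) < inf) :
    P i - Q j ≤ bottleneck P (shifted Q) inf i (j + 1) := by
  cases i with
  | zero =>
    rw [bottleneck] at h ⊢
    split_ifs at h ⊢ with h1
    · obtain rfl : j = 0 := by omega
      omega
    · omega
  | succ i =>
    rw [bottleneck]
    exact le_max_left _ _

/-- The breakpoints trace a path through the table: over the unit column from `i` to `i + 1` the
path is at the upper step containing that column. Breakpoints are strictly increasing integers, so
the step index grows by at most one per column. -/
theorem Admissible.bottleneck_le (hz : Admissible a b P Q z C) (ha : 0 < a) (hb : 0 < b)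
    (hP : P 0 = 0) (hQ : Q 0 = 0) :
    bottleneck P (shifted Q) inf (a - 1) b ≤ C := by
  have key : ∀ i < a, ∀ j < b, z j ≤ i → i < z (j + 1) →
      bottleneck P (shifted Q) inf i (j + 1) ≤ C := by
    intro i
    induction i with
    | zero =>
      intro hi j hj h1 h2
      have h3 := strictMono_upto hz.step (Nat.zero_le j) hj.le
      rw [hz.first] at h3
      push_cast at h3
      obtain rfl : j = 0 := by omega
      have h4 := hz.le 0 0 hi hj ⟨h2.le, by push_cast; omega⟩
      rw [bottleneck, if_pos rfl]
      omega
    | succ i ih =>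
      intro hi j hj h1 h2
      have e1 := hz.le (i + 1) j hi hj ⟨h2.le, by push_cast at *; omega⟩
      rw [bottleneck, max_le_iff, min_le_iff]
      refine ⟨e1, ?_⟩
      push_cast at h1 h2
      by_cases h3 : z j ≤ i
      · exact Or.inl (ih (by omega) j hj h3 (by omega))
      -- Now `z j = i + 1`: the upper chain changes step exactly where the lower one does. Because
      -- ranges are closed, all four pairs around this abscissa touch, which is why the recurrence
      -- has two extra terms on the diagonal.
      · right
        cases j with
        | zero => rw [hz.first] at h3; omega
        | succ j =>
          have h4 := hz.step j (by omega)
          have e2 := ih (by omega) j (by omega) (by omega) (by omega)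
          have e3 := hz.le i (j + 1) (by omega) hj
            ⟨by simp only; omega, by push_cast; omega⟩
          have e4 := hz.le (i + 1) j hi (by omega) ⟨by push_cast; omega, by push_cast; omega⟩
          rw [shifted, shifted]
          exact max_le e2 (max_le e3 e4)
  have h1 := hz.step (b - 1) (by omega)
  have h2 := hz.last
  have h3 := key (a - 1) (by omega) (b - 1) (by omega)
  rw [show b - 1 + 1 = b by omega] at h1 h3
  push_cast [Nat.cast_sub (show 1 ≤ a from ha)] at h3
  exact h3 (by omega) (by omega)

/-- Brings `C` below `inf`, so that the optimum is distinguishable from an unreachable cell. -/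
theorem Admissible.min (hz : Admissible a b P Q z C)
    (h : ∀ i < a, ∀ j < b, P i - Q j < inf) : Admissible a b P Q z (min C (inf - 1)) :=
  { hz with le := fun i j hi hj ht => le_min (hz.le i j hi hj ht) (by have := h i hi j hj; omega) }

/-- The state of the traceback: below step `i` of the lower chain is step `j - 1` of the upper one,
and the breakpoints `z j, …, z b` are known. -/
structure Trace (a b : ℕ) (P Q : ℕ → ℤ) (inf C : ℤ) (i j : ℕ) (z : ℕ → ℤ) : Prop where
  first : z 0 = 0
  last : z b = a
  pos : 0 < j
  le_b : j ≤ b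
  lt_a : i < a
  lt_z : i < z j
  step : ∀ r, j ≤ r → r < b → z r < z (r + 1)
  value : bottleneck P (shifted Q) inf i j ≤ C
  current : ∀ r, i ≤ r → r < a → r ≤ z j → P r - Q (j - 1) ≤ C
  done : ∀ r s, i ≤ r → r < a → j ≤ s → s < b → Touch (fun i => (i : ℤ)) z r s → P r - Q s ≤ C

theorem trace_start (ha : 0 < a) (hb : 0 < b) (h0 : z 0 = 0) (h1 : z b = a)
    (hC : C < inf) (hP : P 0 = 0) (hQ : Q 0 = 0)
    (h : bottleneck P (shifted Q) inf (a - 1) b ≤ C) : Trace a b P Q inf C (a - 1) b z where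
  first := h0
  last := h1
  pos := hb
  le_b := le_rfl
  lt_a := by omega
  lt_z := by rw [h1]; push_cast [Nat.cast_sub (show 1 ≤ a from ha)]; omega
  step r h2 h3 := by omega
  value := h
  current r h2 h3 _ := by
    obtain rfl : r = a - 1 := by omega
    have := le_bottleneck (inf := inf) (i := a - 1) (j := b - 1) hP hQ
    rw [show b - 1 + 1 = b by omega] at this
    exact (this (by omega)).trans h
  done r s h2 h3 h4 h5 := by omega

/-- Staying on the upper step is safe whenever the cell above has value at most `C`; the traceback
need not follow the exact minimizer. Later upper steps begin beyond `i + 1`, so lower step `i` adds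
no pair with them. -/
theorem Trace.lower_pred {i j : ℕ} (h : Trace a b P Q inf C (i + 1) j z) (hC : C < inf)
    (hP : P 0 = 0) (hQ : Q 0 = 0)
    (hv : bottleneck P (shifted Q) inf i j ≤ C) : Trace a b P Q inf C i j z := by
  have hlz := h.lt_z
  have hla := h.lt_a
  push_cast at hlz
  refine { h with lt_a := by omega, lt_z := by omega, value := hv, current := ?_, done := ?_ }
  · intro r h2 h3 h4
    rcases h2.eq_or_lt with rfl | h2
    · have := le_bottleneck (inf := inf) (i := i) (j := j - 1) hP hQ
      have hpos := h.pos
      rw [show j - 1 + 1 = j by omega] at this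
      exact (this (by omega)).trans hv
    · exact h.current r h2 h3 h4
  · intro r s h2 h3 h4 h5 ht
    rcases h2.eq_or_lt with rfl | h2
    · exfalso
      have h7 := ht.2
      have h6 : z j ≤ z s := by
        clear h7 ht
        induction s, h4 using Nat.le_induction with
        | base => exact le_rfl
        | succ s hs ih =>
          have := h.step s hs (by omega)
          have := ih (by omega)
          omega
      push_cast at h7
      omega
    · exact h.done r s h2 h3 h4 h5 ht

/-- When the cell above is too large, the minimum in the recurrence must come from the diagonal,
whose terms bound the pairs meeting at the new breakpoint `i + 1`. The new sequence is left abstract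
since it will be an updated array. -/
theorem Trace.upper_pred {i j : ℕ} (h : Trace a b P Q inf C (i + 1) j z) (hC : C < inf)
    (hP : P 0 = 0) (hQ : Q 0 = 0)
    (hv : C < bottleneck P (shifted Q) inf i j) :
    1 < j ∧ ∀ z' : ℕ → ℤ, (∀ r, r ≠ j - 1 → z' r = z r) → z' (j - 1) = ((i + 1 : ℕ) : ℤ) →
      Trace a b P Q inf C i (j - 1) z' := by
  have hlz := h.lt_z
  have hla := h.lt_a
  have hpos := h.pos
  have hjb := h.le_b
  have hval := h.value
  obtain ⟨j, rfl⟩ : ∃ j', j = j' + 1 := ⟨j - 1, by omega⟩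
  rw [bottleneck, max_le_iff, min_le_iff] at hval
  have h1 := hval.2.resolve_left (by omega)
  rw [max_le_iff, max_le_iff] at h1
  obtain ⟨h1, h2, h3⟩ := h1
  -- The border column has value `inf > C`, so the diagonal never leads into it.
  have hj0 : j ≠ 0 := by
    rintro rfl
    rw [bottleneck_col_zero] at h1
    omega
  refine ⟨by omega, fun z' hz hzj => ?_⟩
  rw [Nat.add_sub_cancel] at hz hzj ⊢
  have e1 : z' (j + 1) = z (j + 1) := hz _ (by omega)
  obtain ⟨j, rfl⟩ : ∃ j', j = j' + 1 := ⟨j - 1, by omega⟩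
  rw [shifted] at h2 h3
  push_cast at hzj hlz
  have h4 : P i - Q j ≤ C := (le_bottleneck (inf := inf) hP hQ (by omega)).trans h1
  constructor
  · rw [hz _ (by omega), h.first]
  · rw [hz _ (by omega), h.last]
  · omega
  · omega
  · omega
  · rw [hzj]; omega
  · intro r hr hrb
    rcases hr.eq_or_lt with rfl | hr
    · rw [hzj, e1]
      omega
    · rw [hz _ (by omega), hz _ (by omega)]
      exact h.step r hr hrb
  · exact h1
  · intro r h5 h6 h7
    rw [hzj] at h7
    rw [Nat.add_sub_cancel]
    rcases h5.eq_or_lt with rfl | h5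
    · exact h4
    · obtain rfl : r = i + 1 := by omega
      exact h3
  · intro r s h5 h6 h7 h8 ht
    rcases h7.eq_or_lt with rfl | h7
    · rcases h5.eq_or_lt with rfl | h5
      · exact h2
      · refine h.current r h5 h6 ?_
        rw [← e1]
        exact ht.1
    · rw [Touch, hz _ (by omega), hz _ (by omega)] at ht
      rcases h5.eq_or_lt with rfl | h5
      · exfalso
        have h9 := ht.2
        have h10 : z (j + 1 + 1) ≤ z s := by
          clear h9 ht
          induction s, h7 using Nat.le_induction with
          | base => exact le_rfl
          | succ s hs ih =>
            have := h.step s hs (by omega)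
            have := ih (by omega)
            omega
        push_cast at h9
        omega
      · exact h.done r s h5 h6 h7 h8 ht

/-- In row `0` only cell `1` is below `inf`, so the traceback has arrived at the first upper step.
-/
theorem Trace.admissible {j : ℕ} (h : Trace a b P Q inf C 0 j z) (hC : C < inf) :
    Admissible a b P Q z C := by
  have hval := h.value
  rw [bottleneck] at hval
  split_ifs at hval with h1
  · subst h1
    refine ⟨h.first, h.last, fun r hr => ?_, fun r s hr hs ht => ?_⟩
    · rcases Nat.eq_zero_or_pos r with rfl | hr0
      · have := h.lt_z
        rw [h.first]
        simpa using this
      · exact h.step r hr0 hr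
    · rcases Nat.eq_zero_or_pos s with rfl | hs0
      · exact h.current r (Nat.zero_le _) hr ht.1
      · exact h.done r s (Nat.zero_le _) hr hs0 hs ht
  · omega

end RectPoly

/-! ### Proof rules for the word RAM. -/

namespace WordRAM

/-! ### Program verification -/

/-- Started in `s`, the program `p` halts after at most `T` steps in a state with `Q`. -/
def Terminates (W : ℕ) (p : Program) (T : ℕ) (Q : State → Prop) (s : State) : Prop :=
  ∃ t s', Runs W p s t s' ∧ t ≤ T ∧ Q s'

@[simp] theorem State.setReg_reg (s : State) (r r' : ℕ) (z : ℤ) :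
    (s.setReg r z).reg r' = if r' = r then z else s.reg r' := rfl

@[simp] theorem State.setReg_arr (s : State) (r : ℕ) (z : ℤ) : (s.setReg r z).arr = s.arr := rfl

@[simp] theorem State.setArr_reg (s : State) (A i : ℕ) (z : ℤ) :
    (s.setArr A i z).reg = s.reg := rfl

@[simp] theorem State.setArr_arr (s : State) (A i A' i' : ℕ) (z : ℤ) :
    (s.setArr A i z).arr A' i' = if A' = A ∧ i' = i then z else s.arr A' i' := rfl

@[simp] theorem Operand.val_const (s : State) (z : ℤ) : (Operand.const z).val s = z := rfl

@[simp] theorem Operand.val_reg (s : State) (r : ℕ) : (Operand.reg r).val s = s.reg r := rfl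

@[simp] theorem Op.eval_add (x y : ℤ) : Op.add.eval x y = x + y := rfl

@[simp] theorem Op.eval_sub (x y : ℤ) : Op.sub.eval x y = x - y := rfl

@[simp] theorem Op.eval_mul (x y : ℤ) : Op.mul.eval x y = x * y := rfl

@[simp] theorem Test.holds_lt (s : State) (x y : Operand) :
    (Test.mk .lt x y).Holds s ↔ x.val s < y.val s := Iff.rfl

@[simp] theorem Test.holds_le (s : State) (x y : Operand) :
    (Test.mk .le x y).Holds s ↔ x.val s ≤ y.val s := Iff.rfl

@[simp] theorem Test.holds_eq (s : State) (x y : Operand) :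
    (Test.mk .eq x y).Holds s ↔ x.val s = y.val s := Iff.rfl

variable {W T T' T₁ : ℕ} {p q : Program} {Q R : State → Prop} {s : State}

theorem Terminates.mono (h : Terminates W p T Q s) (hT : T ≤ T') (hQ : ∀ s, Q s → R s) :
    Terminates W p T' R s := by
  obtain ⟨t, s', h1, h2, h3⟩ := h
  exact ⟨t, s', h1, h2.trans hT, hQ _ h3⟩

theorem terminates_skip (h : Q s) : Terminates W .skip (T + 1) Q s :=
  ⟨1, s, .skip s, by omega, h⟩

theorem terminates_seq (h : Terminates W p T₁ (Terminates W q T Q) s) (hT : T₁ + T ≤ T') :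
    Terminates W (.seq p q) T' Q s := by
  obtain ⟨t₁, s₁, h1, h2, t₂, s₂, h3, h4, h5⟩ := h
  exact ⟨t₁ + t₂, s₂, .seq h1 h3, by omega, h5⟩

/-- The instruction rules work forward on an instruction followed by a continuation. The value `z`
is supplied in closed form, so that states do not accumulate unevaluated expressions. -/
theorem terminates_op {r : ℕ} {o : Op} {x y : Operand} (z : ℤ)
    (hz : o.eval (x.val s) (y.val s) = z) (hW : |z| ≤ W)
    (h : Terminates W q T Q (s.setReg r z)) :
    Terminates W (.seq (.op r o x y) q) (T + 1) Q s := by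
  subst hz
  exact terminates_seq ⟨1, _, .op s r o x y hW, le_rfl, h⟩ (by omega)

theorem terminates_load {r A : ℕ} {x : Operand} (i : ℕ) (z : ℤ) (hi : x.val s = i)
    (hz : s.arr A i = z) (hiW : i ≤ W) (hW : |z| ≤ W)
    (h : Terminates W q T Q (s.setReg r z)) :
    Terminates W (.seq (.load r A x) q) (T + 1) Q s := by
  subst hz
  exact terminates_seq ⟨1, _, .load s r A x i hi hiW hW, le_rfl, h⟩ (by omega)

theorem terminates_store {A : ℕ} {x y : Operand} (i : ℕ) (z : ℤ) (hi : x.val s = i)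
    (hz : y.val s = z) (hiW : i ≤ W) (hW : |z| ≤ W)
    (h : Terminates W q T Q (s.setArr A i z)) :
    Terminates W (.seq (.store A x y) q) (T + 1) Q s := by
  subst hz
  exact terminates_seq ⟨1, _, .store s A x y i hi hiW hW, le_rfl, h⟩ (by omega)

theorem terminates_cond {b : Test} {p' : Program}
    (h1 : b.Holds s → Terminates W (.seq p q) T Q s)
    (h2 : ¬ b.Holds s → Terminates W (.seq p' q) T Q s) :
    Terminates W (.seq (.cond b p p') q) (T + 1) Q s := by
  by_cases hb : b.Holds s
  · obtain ⟨t, s', h3, h4, h5⟩ := h1 hb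
    cases h3 with
    | seq h6 h7 => exact ⟨_, s', .seq (.condTrue hb h6) h7, by omega, h5⟩
  · obtain ⟨t, s', h3, h4, h5⟩ := h2 hb
    cases h3 with
    | seq h6 h7 => exact ⟨_, s', .seq (.condFalse hb h6) h7, by omega, h5⟩

theorem terminates_skip_seq (h : Terminates W q T Q s) :
    Terminates W (.seq .skip q) (T + 1) Q s :=
  terminates_seq ⟨1, s, .skip s, le_rfl, h⟩ (by omega)

/-- Needed for branches that are themselves sequences: it exposes their first instruction. -/
theorem terminates_assoc {p' : Program} (h : Terminates W (.seq p (.seq p' q)) T Q s) :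
    Terminates W (.seq (.seq p p') q) T Q s := by
  obtain ⟨t, s', h1, h2, h3⟩ := h
  cases h1 with
  | seq h4 h5 =>
    cases h5 with
    | seq h6 h7 => exact ⟨_, s', .seq (.seq h4 h6) h7, by omega, h3⟩

theorem State.setReg_self (s : State) (r : ℕ) : s.setReg r (s.reg r) = s := by
  cases s
  simp only [State.setReg, State.mk.injEq, and_true]
  funext r'
  split_ifs with h
  · rw [h]
  · rfl

/-- Replace register `r` by the maximum of it and register `r'`. -/
def Program.max (r r' : ℕ) : Program :=
  .cond ⟨.lt, .reg r, .reg r'⟩ (.op r .add (.reg r') (.const 0)) .skip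

/-- Replace register `r` by the minimum of it and register `r'`. -/
def Program.min (r r' : ℕ) : Program :=
  .cond ⟨.lt, .reg r', .reg r⟩ (.op r .add (.reg r') (.const 0)) .skip

theorem terminates_max {r r' : ℕ} (z : ℤ) (hz : Max.max (s.reg r) (s.reg r') = z) (hW : |z| ≤ W)
    (h : Terminates W q T Q (s.setReg r z)) :
    Terminates W (.seq (.max r r') q) (T + 2) Q s := by
  refine terminates_cond (fun hb => ?_) fun hb => ?_
  · rw [Test.holds_lt, Operand.val_reg, Operand.val_reg] at hb
    refine terminates_op z ?_ hW h
    simpa [max_eq_right hb.le] using hz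
  · rw [Test.holds_lt, Operand.val_reg, Operand.val_reg, not_lt] at hb
    refine terminates_skip_seq ?_
    rw [max_eq_left hb] at hz
    rwa [← hz, State.setReg_self] at h

theorem terminates_min {r r' : ℕ} (z : ℤ) (hz : Min.min (s.reg r) (s.reg r') = z) (hW : |z| ≤ W)
    (h : Terminates W q T Q (s.setReg r z)) :
    Terminates W (.seq (.min r r') q) (T + 2) Q s := by
  refine terminates_cond (fun hb => ?_) fun hb => ?_
  · rw [Test.holds_lt, Operand.val_reg, Operand.val_reg] at hb
    refine terminates_op z ?_ hW h
    simpa [min_eq_right hb.le] using hz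
  · rw [Test.holds_lt, Operand.val_reg, Operand.val_reg, not_lt] at hb
    refine terminates_skip_seq ?_
    rw [min_eq_left hb] at hz
    rwa [← hz, State.setReg_self] at h

theorem terminates_loop_aux {b : Test} {N : ℕ} (I : ℕ → State → Prop)
    (hstep : ∀ k < N, ∀ s, I k s → b.Holds s ∧ Terminates W p T (I (k + 1)) s)
    (hend : ∀ s, I N s → ¬ b.Holds s) (k : ℕ) (hk : k ≤ N) (s : State) (h : I (N - k) s) :
    Terminates W (.loop b p) (k * (T + 1) + 1) (I N) s := by
  -- The induction is on the number `k` of remaining iterations.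
  induction k generalizing s with
  | zero => exact ⟨1, s, .loopDone (hend s h), by omega, h⟩
  | succ k ih =>
    obtain ⟨hb, t₁, s₁, h1, h2, h3⟩ := hstep (N - (k + 1)) (by omega) s h
    rw [show N - (k + 1) + 1 = N - k by omega] at h3
    obtain ⟨t₂, s₂, h4, h5, h6⟩ := ih (by omega) s₁ h3
    refine ⟨_, s₂, .loopStep hb h1 h4, ?_, h6⟩
    rw [Nat.succ_mul]
    omega

/-- A loop that runs exactly `N` times, with invariant `I`. -/
theorem terminates_loop {b : Test} (N : ℕ) (I : ℕ → State → Prop) (T : ℕ) (h0 : I 0 s)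
    (hstep : ∀ k < N, ∀ s, I k s → b.Holds s ∧ Terminates W p T (I (k + 1)) s)
    (hend : ∀ s, I N s → ¬ b.Holds s) (hq : ∀ s, I N s → Terminates W q T₁ Q s)
    (hT : N * (T + 1) + 1 + T₁ ≤ T') :
    Terminates W (.seq (.loop b p) q) T' Q s := by
  refine terminates_seq ((terminates_loop_aux I hstep hend N le_rfl s ?_).mono le_rfl hq) hT
  simpa using h0

end WordRAM

/-! ### The program: input and search for a pattern. -/

namespace RectPoly

open WordRAM

variable {n : ℕ} [NeZero n]

/-! ### Reading the input -/

/-- Compute half of the length and write down the input twice in a row. -/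
def readInput : Program :=
  .seq (.op 10 .add (.const 0) (.const 0)) <|
  .seq (.loop ⟨.lt, .reg 10, .reg 0⟩ <|
    .seq (.op 1 .add (.reg 1) (.const 1)) <|
    .seq (.op 10 .add (.reg 10) (.const 2)) .skip) <|
  .seq (.op 10 .add (.const 0) (.const 0)) <|
  .seq (.loop ⟨.lt, .reg 10, .reg 0⟩ <|
    .seq (.load 11 0 (.reg 10)) <|
    .seq (.store 3 (.reg 10) (.reg 11)) <|
    .seq (.op 12 .add (.reg 10) (.reg 0)) <|
    .seq (.store 3 (.reg 12) (.reg 11)) <|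
    .seq (.op 10 .add (.reg 10) (.const 1)) .skip)
  .skip

/-- The length, half the length, and the doubled input are available. -/
def InputRead (S : Fin n → Turn) (m : ℕ) (s : State) : Prop :=
  s.reg 0 = n ∧ s.reg 1 = m ∧ ∀ e < 2 * n, s.arr 3 e = code S 0 e

theorem abs_code (S : Fin n → Turn) (k : Fin n) (i : ℕ) : |code S k i| = 1 := by
  rcases code_eq S k i with h | h <;> rw [h] <;> rfl

/-- Counting in steps of two replaces a division by `2`. The doubled copy makes later cyclic
accesses possible without reduction modulo `n`. -/
theorem terminates_readInput {W m : ℕ} (S : Fin n → Turn) (hn : n = 2 * m) (hW : 4 * n ≤ W) :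
    Terminates W readInput (10 * n + 10) (InputRead S m) (inputState S) := by
  have hn0 : n ≠ 0 := NeZero.ne n
  unfold readInput
  refine terminates_op (T := 10 * n + 9) 0 rfl (by simp) ?_
  refine terminates_loop m (fun k s => s.reg 0 = n ∧ s.reg 1 = k ∧ s.reg 10 = 2 * k ∧
    ∀ e < n, s.arr 0 e = code S 0 e) 3 ?_ ?_ ?_ ?_ (T₁ := 7 * n + 7) (by omega)
  · refine ⟨rfl, rfl, rfl, fun e he => ?_⟩
    simp only [State.setReg_arr, inputState, code]
    rw [dif_pos ⟨trivial, he⟩]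
    congr 2
    ext
    simp [val_idx, Nat.mod_eq_of_lt he]
  · rintro k hk s ⟨h0, h1, h10, h3⟩
    refine ⟨by simp [h0, h10]; omega, ?_⟩
    refine terminates_op (T := 2) (k + 1) (by simp [h1]) (abs_le.2 ⟨by omega, by omega⟩) ?_
    refine terminates_op (T := 1) (2 * k + 2) (by simp [h10])
      (abs_le.2 ⟨by omega, by omega⟩) ?_
    refine terminates_skip ⟨by simp [h0], by simp, by simp; ring, by simpa using h3⟩
  · rintro s ⟨h0, h1, h10, h3⟩
    simp [h0, h10]
    omega
  rintro s ⟨h0, h1, h10, h3⟩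
  refine terminates_op (T := 7 * n + 6) 0 rfl (by simp) ?_
  refine terminates_loop n (fun k s => s.reg 0 = n ∧ s.reg 1 = m ∧ s.reg 10 = k ∧
    (∀ e < n, s.arr 0 e = code S 0 e) ∧ ∀ e < k, s.arr 3 e = code S 0 e ∧
      s.arr 3 (e + n) = code S 0 (e + n)) 6 ?_ ?_ ?_ ?_ (T₁ := 1) (by omega)
  · exact ⟨by simp [h0], by simp [h1], by simp, by simpa using h3, by simp⟩
  · rintro k hk s ⟨h0, h1, h10, h3, h4⟩
    refine ⟨by simp [h0, h10, hk], ?_⟩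
    have h5 := abs_code S 0 k
    refine terminates_load (T := 5) k (code S 0 k) (by simp [h10]) (h3 k hk) (by omega)
      (by omega) ?_
    refine terminates_store (T := 4) k (code S 0 k) (by simp [h10]) (by simp) (by omega)
      (by omega) ?_
    refine terminates_op (T := 3) (k + n) (by simp [h10, h0])
      (abs_le.2 ⟨by omega, by omega⟩) ?_
    refine terminates_store (T := 2) (k + n) (code S 0 k) (by simp) (by simp) (by omega)
      (by omega) ?_
    refine terminates_op (T := 1) (k + 1) (by simp [h10])
      (abs_le.2 ⟨by omega, by omega⟩) ?_
    refine terminates_skip ⟨by simp [h0], by simp [h1], by simp, by simpa using h3, ?_⟩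
    intro e he
    simp only [State.setReg_arr, State.setArr_arr, true_and]
    rw [code_add_length]
    rcases Nat.lt_succ_iff_lt_or_eq.1 he with he | rfl
    · rw [if_neg (by omega), if_neg (by omega), if_neg (by omega), if_neg (by omega)]
      have := h4 e he
      rwa [code_add_length] at this
    · rw [if_neg (by omega), if_pos rfl, if_pos rfl]
      exact ⟨rfl, rfl⟩
  · rintro s ⟨h0, h1, h10, -⟩
    simp [h0, h10]
  · rintro s ⟨h0, h1, h10, -, h4⟩
    refine terminates_skip (T := 0) ⟨h0, h1, fun e he => ?_⟩
    by_cases hen : e < n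
    · exact (h4 e hen).1
    · have := (h4 (e - n) (by omega)).2
      rwa [show e - n + n = e by omega] at this

end RectPoly

namespace RectPoly

open WordRAM

variable {n : ℕ} [NeZero n]

/-! ### Searching for the leftmost edge -/

/-- The sum of the codes of the turns at the ends of a vertical edge. -/
def pairSum (S : Fin n → Turn) (K i : ℕ) : ℤ :=
  code S 0 (K + (2 * i + 1)) + code S 0 (K + (2 * i + 2))

theorem pairSum_eq (S : Fin n → Turn) (K i : ℕ) :
    pairSum S K i = code S (idx 0 K) (2 * i + 1) + code S (idx 0 K) (2 * i + 2) := by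
  have h : ∀ e, code S 0 (K + e) = code S (idx 0 K) e := fun e => by rw [code, code, idx_add]
  rw [pairSum, h, h]

theorem pairSum_bounds (S : Fin n → Turn) (K i : ℕ) :
    |pairSum S K i| ≤ 2 ∧ 0 ≤ pairSum S K i * pairSum S K i ∧
      pairSum S K i * pairSum S K i ≤ 4 := by
  rw [pairSum]
  rcases code_eq S 0 (K + (2 * i + 1)) with h | h <;>
    rcases code_eq S 0 (K + (2 * i + 2)) with h' | h' <;> rw [h, h'] <;> norm_num

/-- The squares of the pair sums are nonnegative, and the edges `p` and `m - 1` already contribute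
`4 + 4 = 8`. Thus all other pair sums vanish. -/
theorem isPattern_of_sum {S : Fin n → Turn} {K m p : ℕ} (hn : n = 2 * m)
    (hsum : ∑ i ∈ Finset.range m, pairSum S K i * pairSum S K i = 8)
    (hlast : pairSum S K (m - 1) = 2) (hp : p + 1 < m) (h2 : pairSum S K p = 2) :
    IsPattern S (idx 0 K) m (p + 1) := by
  refine ⟨hn, by omega, hp, fun i hi => ?_⟩
  rw [← pairSum_eq]
  split_ifs with h
  · rcases h with h | h
    · rwa [show i = p by omega]
    · rwa [show i = m - 1 by omega]
  · have h3 : ∑ j ∈ ({i, p, m - 1} : Finset ℕ), pairSum S K j * pairSum S K j ≤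
        ∑ i ∈ Finset.range m, pairSum S K i * pairSum S K i := by
      refine Finset.sum_le_sum_of_subset_of_nonneg ?_ fun j _ _ => (pairSum_bounds S K j).2.1
      intro j hj
      simp only [Finset.mem_insert, Finset.mem_singleton] at hj
      rw [Finset.mem_range]
      omega
    rw [Finset.sum_insert, Finset.sum_insert, Finset.sum_singleton, hsum, h2, hlast] at h3
    · exact mul_self_eq_zero.1 (le_antisymm (by omega) (pairSum_bounds S K i).2.1)
    · simp only [Finset.mem_singleton]; omega
    · simp only [Finset.mem_insert, Finset.mem_singleton]; omega

theorem IsPattern.sum_eq {S : Fin n → Turn} {K m a : ℕ} (h : IsPattern S (idx 0 K) m a) :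
    ∑ i ∈ Finset.range m, pairSum S K i * pairSum S K i = 8 := by
  have hlt := h.lt
  have hpos := h.pos
  have h1 : ∑ j ∈ ({a - 1, m - 1} : Finset ℕ), pairSum S K j * pairSum S K j =
      ∑ i ∈ Finset.range m, pairSum S K i * pairSum S K i := by
    refine Finset.sum_subset ?_ fun j hj hj' => ?_
    · intro j hj
      simp only [Finset.mem_insert, Finset.mem_singleton] at hj
      rw [Finset.mem_range]
      omega
    · simp only [Finset.mem_insert, Finset.mem_singleton, Finset.mem_range] at hj hj'
      rw [pairSum_eq, h.sum j hj, if_neg (by omega), mul_zero]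
  rw [← h1, Finset.sum_insert (by simp only [Finset.mem_singleton]; omega), Finset.sum_singleton,
    pairSum_eq, pairSum_eq, h.sum _ (by omega), h.sum _ (by omega), if_pos (by omega),
    if_pos (by omega)]
  rfl

/-- For every starting vertex, scan the vertical edges; store the start and the number of eastward
edges if they belong to a pattern. -/
def searchStart : Program :=
  .seq (.op 10 .add (.const 0) (.const 0)) <|
  .seq (.loop ⟨.lt, .reg 10, .reg 0⟩ <|
    .seq (.op 11 .add (.const 0) (.const 0)) <|
    .seq (.op 12 .add (.const 0) (.const 0)) <|
    .seq (.op 13 .add (.const 0) (.const 0)) <|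
    .seq (.op 14 .add (.reg 10) (.const 1)) <|
    .seq (.loop ⟨.lt, .reg 11, .reg 1⟩ <|
      .seq (.load 15 3 (.reg 14)) <|
      .seq (.op 14 .add (.reg 14) (.const 1)) <|
      .seq (.load 16 3 (.reg 14)) <|
      .seq (.op 14 .add (.reg 14) (.const 1)) <|
      .seq (.op 15 .add (.reg 15) (.reg 16)) <|
      .seq (.op 16 .mul (.reg 15) (.reg 15)) <|
      .seq (.op 12 .add (.reg 12) (.reg 16)) <|
      .seq (.op 11 .add (.reg 11) (.const 1)) <|
      .seq (.cond ⟨.eq, .reg 15, .const 2⟩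
        (.cond ⟨.lt, .reg 11, .reg 1⟩ (.op 13 .add (.reg 11) (.const 0)) .skip) .skip)
      .skip) <|
    .seq (.op 16 .add (.reg 13) (.reg 13)) <|
    .seq (.cond ⟨.eq, .reg 12, .const 8⟩
      (.cond ⟨.eq, .reg 15, .const 2⟩
        (.cond ⟨.le, .reg 1, .reg 16⟩
          (.seq (.op 2 .add (.reg 10) (.const 0)) (.op 3 .add (.reg 13) (.const 0)))
          .skip) .skip) .skip) <|
    .seq (.op 10 .add (.reg 10) (.const 1)) .skip)
  .skip

/-- The last vertical edge with two left turns among the first `i` ones, except for the very last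
one; `0` if there is none. -/
def LastExtreme (S : Fin n → Turn) (K m i : ℕ) (pos : ℤ) : Prop :=
  (pos = 0 ∧ ∀ i' < i, i' + 1 < m → pairSum S K i' ≠ 2) ∨
    ∃ p < i, p + 1 < m ∧ pairSum S K p = 2 ∧ pos = (p : ℤ) + 1

/-- The invariant of the scan from a fixed start. -/
def ScanInvariant (S : Fin n → Turn) (K m i : ℕ) (s : State) : Prop :=
  s.reg 11 = i ∧ s.reg 12 = ∑ j ∈ Finset.range i, pairSum S K j * pairSum S K j ∧
    LastExtreme S K m i (s.reg 13) ∧ s.reg 14 = K + 2 * i + 1 ∧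
    (0 < i → s.reg 15 = pairSum S K (i - 1))

/-- Registers `2` and `3` hold the start and the number of eastward edges of a pattern. -/
def Found (S : Fin n → Turn) (m : ℕ) (s : State) : Prop :=
  ∃ K a : ℕ, s.reg 2 = K ∧ s.reg 3 = a ∧ K < n ∧ IsPattern S (idx 0 K) m a ∧ m ≤ 2 * a

theorem terminates_searchStart {W m : ℕ} (S : Fin n → Turn) (hn : n = 2 * m) (hW : 8 * n ≤ W)
    (hS : ∃ k a, IsPattern S k m a ∧ m ≤ 2 * a) {s : State} (hs : InputRead S m s) :
    Terminates W searchStart (n * (13 * m + 20) + 10)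
      (fun s => InputRead S m s ∧ Found S m s) s := by
  have hn0 : n ≠ 0 := NeZero.ne n
  unfold searchStart
  refine terminates_op (T := n * (13 * m + 20) + 9) 0 rfl (by simp) ?_
  -- The loop never stops early: either a pattern is stored, or no start tried so far carries one.
  -- Trying all `n` starts excludes the second case by `hS`.
  refine terminates_loop n (fun K s => InputRead S m s ∧ s.reg 10 = K ∧ (Found S m s ∨
    ∀ K' < K, ∀ a, ¬ (IsPattern S (idx 0 K') m a ∧ m ≤ 2 * a))) (13 * m + 15) ?_ ?_ ?_ ?_ (T₁ := 1)
    (by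
      have := Nat.mul_le_mul_left n (show 13 * m + 15 + 1 ≤ 13 * m + 20 by omega)
      omega)
  · exact ⟨by simpa [InputRead] using hs, by simp, Or.inr (by simp)⟩
  · rintro K hK s ⟨⟨h0, h1, h3⟩, h10, hf⟩
    refine ⟨by simp [h0, h10, hK], ?_⟩
    refine terminates_op (T := 13 * m + 14) 0 rfl (by simp) ?_
    refine terminates_op (T := 13 * m + 13) 0 rfl (by simp) ?_
    refine terminates_op (T := 13 * m + 12) 0 rfl (by simp) ?_
    refine terminates_op (T := 13 * m + 11) (K + 1) (by simp [h10])
      (abs_le.2 ⟨by omega, by omega⟩) ?_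
    refine terminates_loop m (fun i s => InputRead S m s ∧ s.reg 10 = K ∧ (Found S m s ∨
      ∀ K' < K, ∀ a, ¬ (IsPattern S (idx 0 K') m a ∧ m ≤ 2 * a)) ∧
      ScanInvariant S K m i s) 12 ?_ ?_ ?_ ?_ (T₁ := 9) (by omega)
    · refine ⟨by simpa [InputRead] using ⟨h0, h1, h3⟩, by simp [h10], ?_, ?_⟩
      · simpa [Found] using hf
      · simp [ScanInvariant, LastExtreme]
    · rintro i hi s ⟨⟨h0, h1, h3⟩, h10, hf, h11, h12, h13, h14, h15⟩
      refine ⟨by simp [h11, h1, hi], ?_⟩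
      obtain ⟨b1, b2, b3⟩ := pairSum_bounds S K i
      have b4 := abs_code S 0 (K + (2 * i + 1))
      have b5 := abs_code S 0 (K + (2 * i + 2))
      have b6 : 0 ≤ ∑ j ∈ Finset.range i, pairSum S K j * pairSum S K j ∧
          ∑ j ∈ Finset.range i, pairSum S K j * pairSum S K j ≤ 4 * i := by
        refine ⟨Finset.sum_nonneg fun j _ => (pairSum_bounds S K j).2.1, ?_⟩
        have := Finset.sum_le_card_nsmul (Finset.range i)
          (fun j => pairSum S K j * pairSum S K j) 4 fun j _ => (pairSum_bounds S K j).2.2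
        rw [Finset.card_range, nsmul_eq_mul] at this
        linarith
      refine terminates_load (T := 11) (K + (2 * i + 1)) (code S 0 (K + (2 * i + 1)))
        (by simp [h14]; ring) (h3 _ (by omega)) (by omega) (by omega) ?_
      refine terminates_op (T := 10) (K + (2 * i + 2)) (by simp [h14]; ring)
        (abs_le.2 ⟨by omega, by omega⟩) ?_
      refine terminates_load (T := 9) (K + (2 * i + 2)) (code S 0 (K + (2 * i + 2)))
        (by simp) (h3 _ (by omega)) (by omega) (by omega) ?_
      refine terminates_op (T := 8) (K + (2 * i + 3)) (by simp; ring)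
        (abs_le.2 ⟨by omega, by omega⟩) ?_
      refine terminates_op (T := 7) (pairSum S K i) (by simp [pairSum]) (by omega) ?_
      refine terminates_op (T := 6) (pairSum S K i * pairSum S K i) (by simp)
        (abs_le.2 ⟨by omega, by omega⟩) ?_
      refine terminates_op (T := 5)
        (∑ j ∈ Finset.range (i + 1), pairSum S K j * pairSum S K j)
        (by simp [h12, Finset.sum_range_succ])
        (by rw [Finset.sum_range_succ, abs_le]; constructor <;> omega) ?_
      refine terminates_op (T := 4) (i + 1) (by simp [h11])
        (abs_le.2 ⟨by omega, by omega⟩) ?_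
      have hfin : ∀ s' : State, InputRead S m s' → s'.reg 10 = K → (Found S m s' ∨
          ∀ K' < K, ∀ a, ¬ (IsPattern S (idx 0 K') m a ∧ m ≤ 2 * a)) →
          s'.reg 11 = (i : ℤ) + 1 →
          s'.reg 12 = ∑ j ∈ Finset.range (i + 1), pairSum S K j * pairSum S K j →
          s'.reg 14 = K + (2 * i + 3) → s'.reg 15 = pairSum S K i →
          LastExtreme S K m (i + 1) (s'.reg 13) →
          InputRead S m s' ∧ s'.reg 10 = K ∧ (Found S m s' ∨
          ∀ K' < K, ∀ a, ¬ (IsPattern S (idx 0 K') m a ∧ m ≤ 2 * a)) ∧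
          ScanInvariant S K m (i + 1) s' := by
        intro s' g1 g2 g3 g4 g5 g6 g7 g8
        exact ⟨g1, g2, g3, by push_cast; exact g4, g5, g8, by push_cast; rw [g6]; ring,
          fun _ => by simpa using g7⟩
      have hlast : pairSum S K i ≠ 2 ∨ ¬ i + 1 < m → LastExtreme S K m (i + 1) (s.reg 13) := by
        intro hc
        rcases h13 with ⟨g1, g2⟩ | ⟨p, g1, g2⟩
        · refine Or.inl ⟨g1, fun i' hi' him => ?_⟩
          rcases Nat.lt_succ_iff_lt_or_eq.1 hi' with hi' | rfl
          · exact g2 i' hi' him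
          · exact hc.resolve_right (by omega)
        · exact Or.inr ⟨p, by omega, g2⟩
      refine terminates_cond (T := 3) (fun hb => ?_) fun hb => ?_
      · have hb2 : pairSum S K i = 2 := by simpa using hb
        refine terminates_cond (T := 2) (fun hb => ?_) fun hb => ?_
        · have hb3 : i + 1 < m := by
            have : (i : ℤ) + 1 < m := by simpa [h1] using hb
            omega
          refine terminates_op (T := 1) (i + 1) (by simp) (abs_le.2 ⟨by omega, by omega⟩) ?_
          refine terminates_skip (hfin _ (by simpa [InputRead] using ⟨h0, h1, h3⟩) (by simp [h10])
            (by simpa [Found] using hf) (by simp) (by simp) (by simp) (by simp) ?_)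
          exact Or.inr ⟨i, by omega, hb3, hb2, by simp⟩
        · have hb3 : ¬ i + 1 < m := by
            have : ¬ (i : ℤ) + 1 < m := by simpa [h1] using hb
            omega
          refine terminates_skip_seq (T := 1) ?_
          exact terminates_skip (hfin _ (by simpa [InputRead] using ⟨h0, h1, h3⟩) (by simp [h10])
            (by simpa [Found] using hf) (by simp) (by simp) (by simp) (by simp)
            (by simpa using hlast (Or.inr hb3)))
      · have hb2 : pairSum S K i ≠ 2 := by simpa using hb
        refine terminates_skip_seq (T := 2) ?_
        exact terminates_skip (hfin _ (by simpa [InputRead] using ⟨h0, h1, h3⟩) (by simp [h10])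
          (by simpa [Found] using hf) (by simp) (by simp) (by simp) (by simp)
          (by simpa using hlast (Or.inl hb2)))
    · rintro s ⟨⟨-, h1, -⟩, -, -, h11, -⟩
      simp [h1, h11]
    · rintro s ⟨⟨h0, h1, h3⟩, h10, hf, h11, h12, h13, h14, h15⟩
      have h15 := h15 (by omega)
      have b1 : 0 ≤ s.reg 13 ∧ s.reg 13 ≤ m := by
        rcases h13 with ⟨g, -⟩ | ⟨p, -, g1, -, g2⟩ <;> omega
      refine terminates_op (T := 8) (s.reg 13 + s.reg 13) (by simp)
        (abs_le.2 ⟨by omega, by omega⟩) ?_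
      have hfin : ∀ s' : State, InputRead S m s' → s'.reg 10 = K → (Found S m s' ∨
          ∀ K' < K + 1, ∀ a, ¬ (IsPattern S (idx 0 K') m a ∧ m ≤ 2 * a)) →
          Terminates W (.seq (.op 10 .add (.reg 10) (.const 1)) .skip) 2
          (fun s => InputRead S m s ∧ s.reg 10 = (K + 1 : ℕ) ∧ (Found S m s ∨
            ∀ K' < K + 1, ∀ a, ¬ (IsPattern S (idx 0 K') m a ∧ m ≤ 2 * a))) s' := by
        intro s' g1 g2 g3
        refine terminates_op (T := 1) (K + 1) (by simp [g2]) (abs_le.2 ⟨by omega, by omega⟩) ?_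
        exact terminates_skip ⟨by simpa [InputRead] using g1, by simp, by simpa [Found] using g3⟩
      have hno : (∀ a, ¬ (IsPattern S (idx 0 K) m a ∧ m ≤ 2 * a)) → (Found S m s ∨
          ∀ K' < K + 1, ∀ a, ¬ (IsPattern S (idx 0 K') m a ∧ m ≤ 2 * a)) := by
        intro g
        refine hf.imp_right fun hf K' hK' => ?_
        rcases Nat.lt_succ_iff_lt_or_eq.1 hK' with hK' | rfl
        · exact hf K' hK'
        · exact g
      have hskip : (∀ a, ¬ (IsPattern S (idx 0 K) m a ∧ m ≤ 2 * a)) →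
          Terminates W (.seq (.op 10 .add (.reg 10) (.const 1)) .skip) 2
          (fun s => InputRead S m s ∧ s.reg 10 = (K + 1 : ℕ) ∧ (Found S m s ∨
            ∀ K' < K + 1, ∀ a, ¬ (IsPattern S (idx 0 K') m a ∧ m ≤ 2 * a)))
            (s.setReg 16 (s.reg 13 + s.reg 13)) := fun g =>
        hfin _ (by simpa [InputRead] using ⟨h0, h1, h3⟩) (by simp [h10])
          (by simpa [Found] using hno g)
      -- Completeness of the tests: a pattern at `K` passes the first two of them, and its `a` is
      -- the recorded position, so a failed test rules out every pattern with `m ≤ 2 * a` at `K`.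
      have hpat : ∀ a, IsPattern S (idx 0 K) m a →
          s.reg 12 = 8 ∧ s.reg 15 = 2 ∧ s.reg 13 = a := by
        intro a ha
        have hlt := ha.lt
        have hpos := ha.pos
        refine ⟨by rw [h12, ha.sum_eq], ?_, ?_⟩
        · rw [h15, pairSum_eq, ha.sum _ (by omega), if_pos (by omega)]
        · rcases h13 with ⟨-, g⟩ | ⟨p, g1, g2, g3, g4⟩
          · refine absurd ?_ (g (a - 1) (by omega) (by omega))
            rw [pairSum_eq, ha.sum _ (by omega), if_pos (by omega)]
          · rw [pairSum_eq, ha.sum _ g1] at g3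
            split_ifs at g3 with g5
            · omega
            · omega
      refine terminates_cond (T := 7) (fun hb => ?_) fun hb => ?_
      · have hb1 : s.reg 12 = 8 := by simpa using hb
        refine terminates_cond (T := 6) (fun hb => ?_) fun hb => ?_
        · have hb2 : s.reg 15 = 2 := by simpa using hb
          refine terminates_cond (T := 5) (fun hb => ?_) fun hb => ?_
          · have hb3 : (m : ℤ) ≤ s.reg 13 + s.reg 13 := by simpa [h1] using hb
            refine terminates_assoc ?_
            refine terminates_op (T := 4) K (by simp [h10]) (abs_le.2 ⟨by omega, by omega⟩) ?_
            refine terminates_op (T := 3) (s.reg 13) (by simp) (abs_le.2 ⟨by omega, by omega⟩) ?_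
            refine (hfin _ (by simpa [InputRead] using ⟨h0, h1, h3⟩) (by simp [h10])
              (Or.inl ?_)).mono (by omega) fun _ h => h
            rcases h13 with ⟨g, -⟩ | ⟨p, g1, g2, g3, g4⟩
            · omega
            · refine ⟨K, p + 1, by simp, by simp [g4], hK, ?_, by omega⟩
              exact isPattern_of_sum hn (h12 ▸ hb1) (h15 ▸ hb2) g2 g3
          · have hb3 : ¬ (m : ℤ) ≤ s.reg 13 + s.reg 13 := by simpa [h1] using hb
            refine terminates_skip_seq (T := 4) ((hskip fun a ha => hb3 ?_).mono (by omega)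
              fun _ h => h)
            have := (hpat a ha.1).2.2
            omega
        · have hb2 : ¬ s.reg 15 = 2 := by simpa using hb
          exact terminates_skip_seq (T := 5) ((hskip fun a ha => hb2 (hpat a ha.1).2.1).mono
            (by omega) fun _ h => h)
      · have hb1 : ¬ s.reg 12 = 8 := by simpa using hb
        exact terminates_skip_seq (T := 6) ((hskip fun a ha => hb1 (hpat a ha.1).1).mono
          (by omega) fun _ h => h)
  · rintro s ⟨⟨h0, -⟩, h10, -⟩
    simp [h0, h10]
  · rintro s ⟨h1, -, h2⟩
    refine terminates_skip ⟨h1, h2.resolve_right fun h => ?_⟩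
    obtain ⟨k, a, hk⟩ := hS
    obtain ⟨K, hK, rfl⟩ := exists_idx 0 k
    exact h K hK a hk

end RectPoly

/-! ### The program: heights and the table. -/

namespace RectPoly

open WordRAM

/-! ### Computing the heights -/

theorem abs_lowerHeight_le {T : ℕ → ℤ} (hT : ∀ i, |T i| = 1) (i : ℕ) :
    |lowerHeight T i| ≤ i := by
  induction i with
  | zero => simp [lowerHeight]
  | succ i ih =>
    rw [lowerHeight]
    have := abs_add_le (lowerHeight T i) (T (2 * i + 1))
    rw [hT] at this
    push_cast
    omega

theorem abs_upperHeight_le {T : ℕ → ℤ} (hT : ∀ i, |T i| = 1) (m j : ℕ) :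
    |upperHeight T m j| ≤ j := by
  induction j with
  | zero => simp [upperHeight]
  | succ j ih =>
    rw [upperHeight]
    have := abs_add_le (upperHeight T m j) (T (2 * (m - 2 - j) + 1))
    rw [hT] at this
    push_cast
    omega

/-- Compute the lengths of the two chains and the heights of the chains with unit steps. -/
def computeHeights : Program :=
  .seq (.op 4 .sub (.reg 1) (.reg 3)) <|
  .seq (.op 5 .add (.reg 4) (.const 1)) <|
  .seq (.op 10 .add (.const 0) (.const 0)) <|
  .seq (.op 11 .add (.reg 2) (.const 1)) <|
  .seq (.op 12 .add (.const 0) (.const 0)) <|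
  .seq (.loop ⟨.lt, .reg 10, .reg 3⟩ <|
    .seq (.store 4 (.reg 10) (.reg 12)) <|
    .seq (.load 13 3 (.reg 11)) <|
    .seq (.op 12 .add (.reg 12) (.reg 13)) <|
    .seq (.op 11 .add (.reg 11) (.const 2)) <|
    .seq (.op 10 .add (.reg 10) (.const 1)) .skip) <|
  .seq (.op 10 .add (.const 1) (.const 0)) <|
  .seq (.op 11 .add (.reg 2) (.reg 0)) <|
  .seq (.op 11 .sub (.reg 11) (.const 3)) <|
  .seq (.op 12 .add (.const 0) (.const 0)) <|
  .seq (.store 5 (.const 0) (.const 0)) <|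
  .seq (.loop ⟨.le, .reg 10, .reg 4⟩ <|
    .seq (.store 5 (.reg 10) (.reg 12)) <|
    .seq (.load 13 3 (.reg 11)) <|
    .seq (.op 12 .add (.reg 12) (.reg 13)) <|
    .seq (.op 11 .sub (.reg 11) (.const 2)) <|
    .seq (.op 10 .add (.reg 10) (.const 1)) .skip)
  .skip

/-- The lengths of the chains and their heights are available. -/
def HeightsReady (n a b : ℕ) (P R : ℕ → ℤ) (s : State) : Prop :=
  s.reg 0 = n ∧ s.reg 3 = a ∧ s.reg 4 = b ∧ s.reg 5 = b + 1 ∧ (∀ i < a, s.arr 4 i = P i) ∧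
    ∀ j ≤ b, s.arr 5 j = R j

theorem terminates_computeHeights {n : ℕ} [NeZero n] {W m a K : ℕ} (S : Fin n → Turn)
    (hW : 8 * n ≤ W) (hK : K < n) (hp : IsPattern S (idx 0 K) m a) {s : State}
    (hs : InputRead S m s) (h2 : s.reg 2 = K) (h3 : s.reg 3 = a) :
    Terminates W computeHeights (20 * n + 20)
      (HeightsReady n a (m - a) (lowerHeight (code S (idx 0 K)))
        (shifted (upperHeight (code S (idx 0 K)) m))) s := by
  obtain ⟨hn, hm, hD⟩ := hs
  have hn2 := hp.length
  have hpos := hp.pos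
  have hlt := hp.lt
  have hcode : ∀ e, code S 0 (K + e) = code S (idx 0 K) e := fun e => by
    rw [code, code, idx_add]
  set T := code S (idx 0 K)
  have hT : ∀ i, |T i| = 1 := abs_code S (idx 0 K)
  have hb : ((m - a : ℕ) : ℤ) = m - a := by omega
  unfold computeHeights
  refine terminates_op (T := 20 * n + 19) (m - a : ℕ) (by simp [hm, h3, hb])
    (abs_le.2 ⟨by omega, by omega⟩) ?_
  refine terminates_op (T := 20 * n + 18) ((m - a : ℕ) + 1) (by simp)
    (abs_le.2 ⟨by omega, by omega⟩) ?_
  refine terminates_op (T := 20 * n + 17) 0 rfl (by simp) ?_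
  refine terminates_op (T := 20 * n + 16) (K + 1) (by simp [h2])
    (abs_le.2 ⟨by omega, by omega⟩) ?_
  refine terminates_op (T := 20 * n + 15) 0 rfl (by simp) ?_
  refine terminates_loop a (fun k s => s.reg 0 = n ∧ s.reg 2 = K ∧ s.reg 3 = a ∧
    s.reg 4 = (m - a : ℕ) ∧ s.reg 5 = (m - a : ℕ) + 1 ∧ (∀ e < 2 * n, s.arr 3 e = code S 0 e) ∧
    s.reg 10 = k ∧ s.reg 11 = K + (2 * k + 1) ∧ s.reg 12 = lowerHeight T k ∧
    ∀ i < k, s.arr 4 i = lowerHeight T i) 6 ?_ ?_ ?_ ?_ (T₁ := 10 * n + 10) (by omega)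
  · exact ⟨by simp [hn], by simp [h2], by simp [h3], by simp, by simp, by simpa using hD, by simp,
      by simp, by simp [lowerHeight], by simp⟩
  · rintro k hk s ⟨g0, g2, g3, g4, g5, gD, g10, g11, g12, gP⟩
    have b1 := abs_le.1 (abs_lowerHeight_le hT k)
    have b2 := abs_le.1 (abs_lowerHeight_le hT (k + 1))
    refine ⟨by simp [g10, g3, hk], ?_⟩
    refine terminates_store (T := 5) k (lowerHeight T k) (by simp [g10]) (by simp [g12])
      (by omega) (abs_le.2 ⟨by omega, by omega⟩) ?_
    refine terminates_load (T := 4) (K + (2 * k + 1)) (T (2 * k + 1)) (by simp [g11])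
      (by simp [gD _ (show K + (2 * k + 1) < 2 * n by omega), hcode]) (by omega)
      (by have := hT (2 * k + 1); omega) ?_
    refine terminates_op (T := 3) (lowerHeight T (k + 1)) (by simp [g12, lowerHeight])
      (abs_le.2 ⟨by omega, by omega⟩) ?_
    refine terminates_op (T := 2) (K + (2 * k + 3)) (by simp [g11]; ring)
      (abs_le.2 ⟨by omega, by omega⟩) ?_
    refine terminates_op (T := 1) (k + 1) (by simp [g10])
      (abs_le.2 ⟨by omega, by omega⟩) ?_
    refine terminates_skip ⟨by simp [g0], by simp [g2], by simp [g3], by simp [g4], by simp [g5],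
      by simpa using gD, by simp, by simp; ring, by simp, fun i hi => ?_⟩
    simp only [State.setReg_arr, State.setArr_arr, true_and]
    rcases Nat.lt_succ_iff_lt_or_eq.1 hi with hi | rfl
    · rw [if_neg (by omega), gP i hi]
    · rw [if_pos rfl]
  · rintro s ⟨g0, g2, g3, g4, g5, gD, g10, -⟩
    simp [g10, g3]
  rintro s ⟨g0, g2, g3, g4, g5, gD, g10, g11, g12, gP⟩
  refine terminates_op (T := 10 * n + 9) 1 rfl (abs_le.2 ⟨by omega, by omega⟩) ?_
  refine terminates_op (T := 10 * n + 8) (K + n) (by simp [g2, g0])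
    (abs_le.2 ⟨by omega, by omega⟩) ?_
  -- The upper chain is read backwards; its first height change from the left is the turn at `2 * (m
  -- - 2) + 1 = n - 3` after `K`.
  refine terminates_op (T := 10 * n + 7) (K + n - 3) (by simp)
    (abs_le.2 ⟨by omega, by omega⟩) ?_
  refine terminates_op (T := 10 * n + 6) 0 rfl (by simp) ?_
  refine terminates_store (T := 10 * n + 5) 0 0 rfl rfl (by omega) (by simp) ?_
  refine terminates_loop (m - a) (fun k s => s.reg 0 = n ∧ s.reg 3 = a ∧
    s.reg 4 = (m - a : ℕ) ∧ s.reg 5 = (m - a : ℕ) + 1 ∧ (∀ e < 2 * n, s.arr 3 e = code S 0 e) ∧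
    (∀ i < a, s.arr 4 i = lowerHeight T i) ∧
    s.reg 10 = k + 1 ∧ s.reg 11 = K + n - 3 - 2 * k ∧ s.reg 12 = upperHeight T m k ∧
    ∀ j ≤ k, s.arr 5 j = shifted (upperHeight T m) j) 6 ?_ ?_ ?_ ?_ (T₁ := 1) (by omega)
  · refine ⟨by simp [g0], by simp [g3], by simp [g4], by simp [g5], by simpa using gD,
      by simpa using gP, by simp, by simp, by simp [upperHeight], fun j hj => ?_⟩
    obtain rfl : j = 0 := by omega
    simp [shifted]
  · rintro k hk s ⟨g0, g3, g4, g5, gD, gP, g10, g11, g12, gQ⟩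
    have b1 := abs_le.1 (abs_upperHeight_le hT m k)
    have b2 := abs_le.1 (abs_upperHeight_le hT m (k + 1))
    refine ⟨by simp only [Test.holds_le, Operand.val_reg, g10, g4]; omega, ?_⟩
    refine terminates_store (T := 5) (k + 1) (upperHeight T m k) (by simp [g10]) (by simp [g12])
      (by omega) (abs_le.2 ⟨by omega, by omega⟩) ?_
    refine terminates_load (T := 4) (K + (2 * (m - 2 - k) + 1)) (T (2 * (m - 2 - k) + 1))
      (by simp only [Operand.val_reg, State.setArr_reg, g11]; omega)
      (by simp [gD _ (show K + (2 * (m - 2 - k) + 1) < 2 * n by omega), hcode]) (by omega)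
      (by have := hT (2 * (m - 2 - k) + 1); omega) ?_
    refine terminates_op (T := 3) (upperHeight T m (k + 1)) (by simp [g12, upperHeight])
      (abs_le.2 ⟨by omega, by omega⟩) ?_
    refine terminates_op (T := 2) (K + n - 3 - 2 * k - 2) (by simp [g11])
      (abs_le.2 ⟨by omega, by omega⟩) ?_
    refine terminates_op (T := 1) (k + 1 + 1) (by simp [g10])
      (abs_le.2 ⟨by omega, by omega⟩) ?_
    refine terminates_skip ⟨by simp [g0], by simp [g3], by simp [g4], by simp [g5],
      by simpa using gD, by simpa using gP, by simp, by simp; ring, by simp, fun j hj => ?_⟩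
    simp only [State.setReg_arr, State.setArr_arr, true_and]
    rcases Nat.lt_succ_iff_lt_or_eq.1 (Nat.lt_succ_of_le hj) with hi | rfl
    · rw [if_neg (by omega), gQ j (by omega)]
    · rw [if_pos rfl, shifted]
  · rintro s ⟨g0, g3, g4, g5, gD, gP, g10, -⟩
    simp [g10, g4]
  · rintro s ⟨g0, g3, g4, g5, gD, gP, g10, g11, g12, gQ⟩
    exact terminates_skip ⟨g0, g3, g4, g5, gP, gQ⟩

/-! ### Filling the table -/

/-- Compute one cell of the table `bottleneck`. -/
def fillCell : Program :=
  .seq (.op 16 .sub (.reg 11) (.reg 5)) <|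
  .seq (.load 17 6 (.reg 16)) <|
  .seq (.op 16 .sub (.reg 16) (.const 1)) <|
  .seq (.load 18 6 (.reg 16)) <|
  .seq (.load 19 5 (.reg 12)) <|
  .seq (.op 16 .sub (.reg 12) (.const 1)) <|
  .seq (.load 20 5 (.reg 16)) <|
  .seq (.op 21 .sub (.reg 14) (.reg 19)) <|
  .seq (.max 18 21) <|
  .seq (.op 21 .sub (.reg 15) (.reg 20)) <|
  .seq (.max 18 21) <|
  .seq (.min 17 18) <|
  .seq (.op 21 .sub (.reg 15) (.reg 19)) <|
  .seq (.max 17 21) <|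
  .seq (.store 6 (.reg 11) (.reg 17)) <|
  .seq (.op 11 .add (.reg 11) (.const 1)) <|
  .seq (.op 12 .add (.reg 12) (.const 1)) .skip

/-- Compute the table `bottleneck`, row by row. -/
def fillTable : Program :=
  .seq (.op 10 .add (.const 0) (.const 0)) <|
  .seq (.loop ⟨.le, .reg 10, .reg 4⟩ <|
    .seq (.store 6 (.reg 10) (.reg 0)) <|
    .seq (.op 10 .add (.reg 10) (.const 1)) .skip) <|
  .seq (.store 6 (.const 1) (.const 0)) <|
  .seq (.op 10 .add (.const 1) (.const 0)) <|
  .seq (.op 11 .add (.reg 5) (.const 0)) <|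
  .seq (.loop ⟨.lt, .reg 10, .reg 3⟩ <|
    .seq (.op 13 .sub (.reg 10) (.const 1)) <|
    .seq (.load 14 4 (.reg 13)) <|
    .seq (.load 15 4 (.reg 10)) <|
    .seq (.store 6 (.reg 11) (.reg 0)) <|
    .seq (.op 11 .add (.reg 11) (.const 1)) <|
    .seq (.op 12 .add (.const 1) (.const 0)) <|
    .seq (.loop ⟨.le, .reg 12, .reg 4⟩ fillCell) <|
    .seq (.op 10 .add (.reg 10) (.const 1)) .skip)
  .skip

/-- The table `bottleneck` in one line, row after row. -/
def flatTable (b : ℕ) (P R : ℕ → ℤ) (inf : ℤ) (e : ℕ) : ℤ :=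
  bottleneck P R inf (e / (b + 1)) (e % (b + 1))

/-- Rows have `b + 1` cells because of the border column, so the cell above is `b + 1` places
earlier and its left neighbour `b + 2` places. -/
theorem flatTable_eq {b : ℕ} {P R : ℕ → ℤ} {inf : ℤ} (i : ℕ) {j : ℕ} (hj : j ≤ b) :
    flatTable b P R inf (i * (b + 1) + j) = bottleneck P R inf i j := by
  rw [flatTable, mul_comm, Nat.mul_add_div (by omega), Nat.mul_add_mod,
    Nat.div_eq_of_lt (by omega), Nat.mod_eq_of_lt (by omega), add_zero]

/-- The first `j + 1` cells of row `k + 1` have been computed. -/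
def RowInvariant (n a b : ℕ) (P R : ℕ → ℤ) (k j : ℕ) (s : State) : Prop :=
  HeightsReady n a b P R s ∧ s.reg 10 = (k + 1 : ℕ) ∧
    s.reg 11 = ((k + 1) * (b + 1) + (j + 1) : ℕ) ∧ s.reg 12 = (j + 1 : ℕ) ∧
    s.reg 14 = P k ∧ s.reg 15 = P (k + 1) ∧
    ∀ e < (k + 1) * (b + 1) + (j + 1), s.arr 6 e = flatTable b P R n e

theorem terminates_fillCell {W n a b k j : ℕ} {P R : ℕ → ℤ} (hW : 8 * n ≤ W)
    (hWab : (a + 1) * (b + 1) ≤ W) (hab : a + b ≤ n)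
    (hR : ∀ j ≤ b, |R j| ≤ n) (hPR : ∀ i < a, ∀ j ≤ b, |P i - R j| ≤ n)
    (hk : k < a - 1) (hj : j < b) {s : State}
    (hs : RowInvariant n a b P R k j s) :
    (Test.mk .le (.reg 12) (.reg 4)).Holds s ∧
      Terminates W fillCell 22 (RowInvariant n a b P R k (j + 1)) s := by
  obtain ⟨⟨g0, g3, g4, g5, gP, gR⟩, g10, g11, g12, g14, g15, g6⟩ := hs
  have hrow : (k + 1) * (b + 1) = k * (b + 1) + (b + 1) := Nat.succ_mul _ _
  have hrow' : (k + 2) * (b + 1) = (k + 1) * (b + 1) + (b + 1) := Nat.succ_mul _ _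
  have hWrow := (Nat.mul_le_mul_right (b + 1) (show k + 2 ≤ a + 1 by omega)).trans hWab
  unfold fillCell
  have bR := abs_le.1 (hR j (by omega))
  have bR' := abs_le.1 (hR (j + 1) (by omega))
  have b1 := abs_bottleneck_le hPR k j (by omega) (by omega)
  have b2 := abs_bottleneck_le hPR k (j + 1) (by omega) (by omega)
  have b3 := hPR k (by omega) (j + 1) (by omega)
  have b4 := hPR (k + 1) (by omega) j (by omega)
  have b5 := hPR (k + 1) (by omega) (j + 1) (by omega)
  have b6 := abs_bottleneck_le hPR (k + 1) (j + 1) (by omega) (by omega)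
  have e1 := g6 (k * (b + 1) + (j + 1)) (by omega)
  have e2 := g6 (k * (b + 1) + j) (by omega)
  rw [flatTable_eq k (by omega)] at e1 e2
  have hnW : (n : ℤ) ≤ W := by omega
  refine ⟨by simp only [Test.holds_le, Operand.val_reg, g12, g4]; omega, ?_⟩
  refine terminates_op (T := 21) (k * (b + 1) + (j + 1) : ℕ)
    (by simp only [Operand.val_reg, Op.eval_sub, g11, g5]; omega)
    (abs_le.2 ⟨by omega, by omega⟩) ?_
  refine terminates_load (T := 20) (k * (b + 1) + (j + 1)) _ (by simp) e1 (by omega)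
    (b2.trans hnW) ?_
  refine terminates_op (T := 19) (k * (b + 1) + j : ℕ)
    (by simp; ring) (abs_le.2 ⟨by omega, by omega⟩) ?_
  refine terminates_load (T := 18) (k * (b + 1) + j) _ (by simp) e2 (by omega)
    (b1.trans hnW) ?_
  refine terminates_load (T := 17) (j + 1) _ (by simp [g12]) (gR (j + 1) (by omega))
    (by omega) (abs_le.2 ⟨by omega, by omega⟩) ?_
  refine terminates_op (T := 16) (j : ℕ) (by simp [g12]) (abs_le.2 ⟨by omega, by omega⟩) ?_
  refine terminates_load (T := 15) j _ (by simp) (gR j (by omega)) (by omega)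
    (abs_le.2 ⟨by omega, by omega⟩) ?_
  refine terminates_op (T := 14) (P k - R (j + 1)) (by simp [g14]) (b3.trans hnW) ?_
  refine terminates_max (T := 12) (max (bottleneck P R n k j) (P k - R (j + 1))) (by simp)
    (by rw [abs_le] at *; omega) ?_
  refine terminates_op (T := 11) (P (k + 1) - R j) (by simp [g15]) (b4.trans hnW) ?_
  refine terminates_max (T := 9)
    (max (max (bottleneck P R n k j) (P k - R (j + 1))) (P (k + 1) - R j)) (by simp)
    (by rw [abs_le] at *; omega) ?_
  refine terminates_min (T := 7) (min (bottleneck P R n k (j + 1))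
    (max (max (bottleneck P R n k j) (P k - R (j + 1))) (P (k + 1) - R j))) (by simp)
    (by rw [abs_le] at *; omega) ?_
  refine terminates_op (T := 6) (P (k + 1) - R (j + 1)) (by simp [g15]) (b5.trans hnW) ?_
  refine terminates_max (T := 4) (bottleneck P R n (k + 1) (j + 1))
    (by
      simp only [State.setReg_reg]
      -- The program takes the cell's own height difference last and associates the diagonal maxima
      -- to the left.
      rw [bottleneck, max_comm, max_assoc]
      rfl) (b6.trans hnW) ?_
  refine terminates_store (T := 3) ((k + 1) * (b + 1) + (j + 1))
    (bottleneck P R n (k + 1) (j + 1)) (by simp [g11]) (by simp) (by omega)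
    (b6.trans hnW) ?_
  refine terminates_op (T := 2) ((k + 1) * (b + 1) + (j + 1 + 1) : ℕ)
    (by simp [g11]; ring) (abs_le.2 ⟨by omega, by omega⟩) ?_
  refine terminates_op (T := 1) (j + 1 + 1 : ℕ) (by simp [g12])
    (abs_le.2 ⟨by omega, by omega⟩) ?_
  refine terminates_skip ⟨by simpa [HeightsReady] using ⟨g0, g3, g4, g5, gP, gR⟩,
    by simp [g10], by simp, by simp, by simp [g14], by simp [g15], fun e he => ?_⟩
  simp only [State.setReg_arr, State.setArr_arr, true_and]
  by_cases h : e = (k + 1) * (b + 1) + (j + 1)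
  · rw [if_pos h, h, flatTable_eq (k + 1) (by omega)]
  · rw [if_neg h, g6 e (by omega)]

theorem terminates_fillTable {W n a b : ℕ} {P R : ℕ → ℤ} (hW : 8 * n ≤ W)
    (hWab : (a + 1) * (b + 1) ≤ W) (ha : 0 < a) (hb : 0 < b) (hab : a + b ≤ n)
    (hP : ∀ i < a, |P i| ≤ n) (hR : ∀ j ≤ b, |R j| ≤ n)
    (hPR : ∀ i < a, ∀ j ≤ b, |P i - R j| ≤ n) {s : State} (hs : HeightsReady n a b P R s) :
    Terminates W fillTable (a * (23 * b + 20) + 4 * b + 20) (fun s => HeightsReady n a b P R s ∧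
      s.reg 11 = (a * (b + 1) : ℕ) ∧ ∀ e < a * (b + 1), s.arr 6 e = flatTable b P R n e) s := by
  unfold fillTable
  refine terminates_op (T := a * (23 * b + 20) + 4 * b + 19) 0 rfl (by simp) ?_
  refine terminates_loop (b + 1) (fun k s => HeightsReady n a b P R s ∧ s.reg 10 = k ∧
    ∀ e < k, s.arr 6 e = n) 3 ?_ ?_ ?_ ?_ (T₁ := a * (23 * b + 20) + 10) (by omega)
  · exact ⟨by simpa [HeightsReady] using hs, by simp, by simp⟩
  · rintro k hk s ⟨⟨g0, g3, g4, g5, gP, gR⟩, g10, g6⟩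
    refine ⟨by simp only [Test.holds_le, Operand.val_reg, g10, g4]; omega, ?_⟩
    refine terminates_store (T := 2) k n (by simp [g10]) (by simp [g0]) (by omega)
      (abs_le.2 ⟨by omega, by omega⟩) ?_
    refine terminates_op (T := 1) (k + 1) (by simp [g10]) (abs_le.2 ⟨by omega, by omega⟩) ?_
    refine terminates_skip ⟨by simpa [HeightsReady] using ⟨g0, g3, g4, g5, gP, gR⟩, by simp,
      fun e he => ?_⟩
    simp only [State.setReg_arr, State.setArr_arr, true_and]
    rcases Nat.lt_succ_iff_lt_or_eq.1 he with he | rfl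
    · rw [if_neg (by omega), g6 e he]
    · rw [if_pos rfl]
  · rintro s ⟨⟨g0, g3, g4, g5, gP, gR⟩, g10, -⟩
    simp [g10, g4]
  rintro s ⟨⟨g0, g3, g4, g5, gP, gR⟩, g10, g6⟩
  refine terminates_store (T := a * (23 * b + 20) + 9) 1 0 rfl rfl (by omega) (by simp) ?_
  refine terminates_op (T := a * (23 * b + 20) + 8) 1 rfl (abs_le.2 ⟨by omega, by omega⟩) ?_
  refine terminates_op (T := a * (23 * b + 20) + 7) (b + 1) (by simp [g5])
    (abs_le.2 ⟨by omega, by omega⟩) ?_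
  refine terminates_loop (a - 1) (fun k s => HeightsReady n a b P R s ∧
    s.reg 10 = (k + 1 : ℕ) ∧ s.reg 11 = ((k + 1) * (b + 1) : ℕ) ∧
    ∀ e < (k + 1) * (b + 1), s.arr 6 e = flatTable b P R n e) (23 * b + 10) ?_ ?_ ?_ ?_ (T₁ := 1)
    (by
      have h1 := Nat.mul_le_mul_right (23 * b + 20) (show a - 1 ≤ a by omega)
      have h2 := Nat.mul_le_mul_left (a - 1) (show 23 * b + 10 + 1 ≤ 23 * b + 20 by omega)
      omega)
  · refine ⟨by simpa [HeightsReady] using ⟨g0, g3, g4, g5, gP, gR⟩, by simp, by simp,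
      fun e he => ?_⟩
    have h1 := flatTable_eq (P := P) (R := R) (inf := n) 0 (show e ≤ b by omega)
    rw [zero_mul, zero_add] at h1
    rw [h1, bottleneck]
    simp only [State.setReg_arr, State.setArr_arr, true_and]
    rw [g6 e (by omega)]
  · rintro k hk s ⟨⟨g0, g3, g4, g5, gP, gR⟩, g10, g11, g6⟩
    have hrow : (k + 1) * (b + 1) = k * (b + 1) + (b + 1) := Nat.succ_mul _ _
    have hrow' : (k + 2) * (b + 1) = (k + 1) * (b + 1) + (b + 1) := Nat.succ_mul _ _
    have hWrow := (Nat.mul_le_mul_right (b + 1) (show k + 2 ≤ a + 1 by omega)).trans hWab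
    have bP := abs_le.1 (hP k (by omega))
    have bP' := abs_le.1 (hP (k + 1) (by omega))
    refine ⟨by simp only [Test.holds_lt, Operand.val_reg, g10, g3]; omega, ?_⟩
    refine terminates_op (T := 23 * b + 9) k (by simp [g10]) (abs_le.2 ⟨by omega, by omega⟩) ?_
    refine terminates_load (T := 23 * b + 8) k (P k) (by simp) (gP k (by omega)) (by omega)
      (abs_le.2 ⟨by omega, by omega⟩) ?_
    refine terminates_load (T := 23 * b + 7) (k + 1) (P (k + 1)) (by simp [g10])
      (gP (k + 1) (by omega)) (by omega) (abs_le.2 ⟨by omega, by omega⟩) ?_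
    -- The border cell of the row; the length `n` plays the role of infinity.
    refine terminates_store (T := 23 * b + 6) ((k + 1) * (b + 1)) n (by simp [g11]) (by simp [g0])
      (by omega) (abs_le.2 ⟨by omega, by omega⟩) ?_
    refine terminates_op (T := 23 * b + 5) ((k + 1) * (b + 1) + 1 : ℕ) (by simp [g11])
      (abs_le.2 ⟨by omega, by omega⟩) ?_
    refine terminates_op (T := 23 * b + 4) 1 rfl (abs_le.2 ⟨by omega, by omega⟩) ?_
    refine terminates_loop b (RowInvariant n a b P R k) 22 ?_ ?_ ?_ ?_ (T₁ := 2)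
      (by omega)
    · refine ⟨by simpa [HeightsReady] using ⟨g0, g3, g4, g5, gP, gR⟩, by simp [g10], by simp,
        by simp, by simp, by simp, fun e he => ?_⟩
      simp only [State.setReg_arr, State.setArr_arr, true_and]
      rcases Nat.lt_succ_iff_lt_or_eq.1 he with he | rfl
      · have : e < (k + 1) * (b + 1) := he
        rw [if_neg (by omega), g6 e this]
      · have := flatTable_eq (P := P) (R := R) (inf := n) (k + 1) (Nat.zero_le b)
        simp only [add_zero] at this
        simp only [if_true]
        rw [this, bottleneck]
    · intro j hj s hs
      exact terminates_fillCell hW hWab hab hR hPR hk hj hs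
    · rintro s ⟨⟨g0, g3, g4, g5, gP, gR⟩, g10, g11, g12, -⟩
      simp [g12, g4]
    · rintro s ⟨⟨g0, g3, g4, g5, gP, gR⟩, g10, g11, g12, g14, g15, g6⟩
      refine terminates_op (T := 1) (k + 1 + 1 : ℕ) (by simp [g10])
        (abs_le.2 ⟨by omega, by omega⟩) ?_
      refine terminates_skip ⟨by simpa [HeightsReady] using ⟨g0, g3, g4, g5, gP, gR⟩, by simp,
        ?_, fun e he => ?_⟩
      · simp only [State.setReg_reg, g11]
        norm_num
        ring
      · rw [Nat.succ_mul] at he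
        exact g6 e he
  · rintro s ⟨⟨g0, g3, g4, g5, gP, gR⟩, g10, -⟩
    simp only [Test.holds_lt, Operand.val_reg, g10, g3]
    omega
  · rintro s ⟨g, -, g11, g6⟩
    rw [show a - 1 + 1 = a by omega] at g6 g11
    exact terminates_skip ⟨g, g11, g6⟩

end RectPoly

/-! ### The program: traceback, output and total running time. -/

namespace RectPoly

open WordRAM

/-! ### Tracing back -/

/-- Read off the breakpoints of the upper chain from the table. -/
def traceBack : Program :=
  .seq (.op 16 .sub (.reg 11) (.const 1)) <|
  .seq (.load 6 6 (.reg 16)) <|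
  .seq (.store 7 (.const 0) (.const 0)) <|
  .seq (.store 7 (.reg 4) (.reg 3)) <|
  .seq (.op 10 .sub (.reg 3) (.const 1)) <|
  .seq (.op 12 .add (.reg 4) (.const 0)) <|
  .seq (.loop ⟨.lt, .const 0, .reg 10⟩ <|
    .seq (.op 16 .sub (.reg 16) (.reg 5)) <|
    .seq (.load 17 6 (.reg 16)) <|
    .seq (.cond ⟨.lt, .reg 6, .reg 17⟩
      (.seq (.op 12 .sub (.reg 12) (.const 1)) <|
        .seq (.store 7 (.reg 12) (.reg 10)) (.op 16 .sub (.reg 16) (.const 1)))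
      .skip) <|
    .seq (.op 10 .sub (.reg 10) (.const 1)) .skip)
  .skip

theorem terminates_traceBack {W n a b : ℕ} {P Q : ℕ → ℤ} {C : ℤ} (hW : 8 * n ≤ W)
    (hWab : (a + 1) * (b + 1) ≤ W) (ha : 0 < a) (hb : 0 < b) (hab : a + b ≤ n)
    (hP0 : P 0 = 0) (hQ0 : Q 0 = 0)
    (hPR : ∀ i < a, ∀ j ≤ b, |P i - shifted Q j| ≤ n)
    (hC : bottleneck P (shifted Q) n (a - 1) b = C) (hCn : C < n) {s : State}
    (hs : HeightsReady n a b P (shifted Q) s) (h11 : s.reg 11 = (a * (b + 1) : ℕ))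
    (h6 : ∀ e < a * (b + 1), s.arr 6 e = flatTable b P (shifted Q) n e) :
    Terminates W traceBack (9 * a + 20) (fun s => HeightsReady n a b P (shifted Q) s ∧
      s.reg 6 = C ∧ Admissible a b P Q (s.arr 7) C) s := by
  obtain ⟨g0, g3, g4, g5, gP, gR⟩ := hs
  have hsplit : (a + 1) * (b + 1) = a * (b + 1) + (b + 1) := Nat.succ_mul _ _
  have hsplit' : a * (b + 1) = (a - 1) * (b + 1) + (b + 1) := by
    rw [← Nat.succ_mul, Nat.succ_eq_add_one, show a - 1 + 1 = a by omega]
  have bC := abs_bottleneck_le hPR (a - 1) b (by omega) le_rfl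
  rw [hC] at bC
  have bC' := abs_le.1 bC
  unfold traceBack
  refine terminates_op (T := 9 * a + 19) ((a - 1) * (b + 1) + b : ℕ)
    (by simp only [Operand.val_reg, Operand.val_const, Op.eval_sub, h11]; omega)
    (abs_le.2 ⟨by omega, by omega⟩) ?_
  refine terminates_load (T := 9 * a + 18) ((a - 1) * (b + 1) + b) C (by simp)
    (by rw [State.setReg_arr, h6 _ (by omega), flatTable_eq _ le_rfl, hC]) (by omega)
    (abs_le.2 ⟨by omega, by omega⟩) ?_
  refine terminates_store (T := 9 * a + 17) 0 0 rfl rfl (by omega) (by simp) ?_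
  refine terminates_store (T := 9 * a + 16) b a (by simp [g4]) (by simp [g3]) (by omega)
    (abs_le.2 ⟨by omega, by omega⟩) ?_
  refine terminates_op (T := 9 * a + 15) (a - 1 : ℕ) (by simp [g3]; omega)
    (abs_le.2 ⟨by omega, by omega⟩) ?_
  refine terminates_op (T := 9 * a + 14) b (by simp [g4]) (abs_le.2 ⟨by omega, by omega⟩) ?_
  refine terminates_loop (a - 1) (fun k s => HeightsReady n a b P (shifted Q) s ∧ s.reg 6 = C ∧
    (∀ e < a * (b + 1), s.arr 6 e = flatTable b P (shifted Q) n e) ∧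
    s.reg 10 = (a - 1 - k : ℕ) ∧ ∃ j : ℕ, s.reg 12 = j ∧
      s.reg 16 = ((a - 1 - k) * (b + 1) + j : ℕ) ∧
      Trace a b P Q n C (a - 1 - k) j (s.arr 7)) 8 ?_ ?_ ?_ ?_ (T₁ := 1) (by omega)
  · refine ⟨by simpa [HeightsReady] using ⟨g0, g3, g4, g5, gP, gR⟩, by simp, by simpa using h6,
      by simp, b, by simp, by simp, ?_⟩
    refine trace_start ha hb ?_ (by simp) hCn hP0 hQ0 hC.le
    simp only [State.setReg_arr, State.setArr_arr, true_and]
    rw [if_neg (by omega), if_pos trivial]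
  · rintro k hk s ⟨⟨g0, g3, g4, g5, gP, gR⟩, gC, g6, g10, j, g12, g16, ht⟩
    obtain ⟨i, hi⟩ : ∃ i, a - 1 - k = i + 1 := ⟨a - 1 - k - 1, by omega⟩
    have hi' : a - 1 - (k + 1) = i := by omega
    rw [hi] at g10 g16 ht
    have hrow : (i + 1) * (b + 1) = i * (b + 1) + (b + 1) := Nat.succ_mul _ _
    have hrow2 := Nat.mul_le_mul_right (b + 1) (show i + 1 + 1 ≤ a by omega)
    have hrow3 : (i + 1 + 1) * (b + 1) = (i + 1) * (b + 1) + (b + 1) := Nat.succ_mul _ _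
    have hjb := ht.le_b
    have hj0 := ht.pos
    have b1 := abs_bottleneck_le hPR i j (by omega) hjb
    have hnW : (n : ℤ) ≤ W := by omega
    refine ⟨by rw [Test.holds_lt, Operand.val_const, Operand.val_reg, g10]; omega, ?_⟩
    refine terminates_op (T := 7) (i * (b + 1) + j : ℕ)
      (by simp only [Operand.val_reg, Op.eval_sub, g16, g5]; omega)
      (abs_le.2 ⟨by omega, by omega⟩) ?_
    refine terminates_load (T := 6) (i * (b + 1) + j) (bottleneck P (shifted Q) n i j) (by simp)
      (by rw [State.setReg_arr, g6 _ (by omega), flatTable_eq _ hjb]) (by omega)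
      (b1.trans hnW) ?_
    -- The single comparison with the optimum `C` decides between the diagonal move, which stores a
    -- breakpoint, and staying on the upper step.
    refine terminates_cond (T := 5) (fun hc => ?_) fun hc => ?_
    · have hc : C < bottleneck P (shifted Q) n i j := by simpa [gC] using hc
      obtain ⟨hj1, ht'⟩ := ht.upper_pred hCn hP0 hQ0 hc
      refine terminates_assoc ?_
      refine terminates_op (T := 4) (j - 1 : ℕ) (by simp [g12]; omega)
        (abs_le.2 ⟨by omega, by omega⟩) ?_
      refine terminates_assoc ?_
      refine terminates_store (T := 3) (j - 1) (i + 1 : ℕ) (by simp) (by simp [g10])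
        (by omega) (abs_le.2 ⟨by omega, by omega⟩) ?_
      refine terminates_op (T := 2) (i * (b + 1) + (j - 1) : ℕ)
        (by
          simp only [Operand.val_reg, Operand.val_const, Op.eval_sub, State.setReg_reg,
            State.setArr_reg]
          norm_num
          omega)
        (abs_le.2 ⟨by omega, by omega⟩) ?_
      refine terminates_op (T := 1) i (by simp [g10]) (abs_le.2 ⟨by omega, by omega⟩) ?_
      refine terminates_skip ⟨by simpa [HeightsReady] using ⟨g0, g3, g4, g5, gP, gR⟩,
        by simp [gC], by simpa using g6, by simp [hi'], j - 1, by simp, by simp [hi'], ?_⟩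
      rw [hi']
      refine ht' _ (fun r hr => ?_) ?_
      · simp only [State.setReg_arr, State.setArr_arr, true_and]
        rw [if_neg hr]
      · simp only [State.setReg_arr, State.setArr_arr, true_and, if_true]
    · have hc : bottleneck P (shifted Q) n i j ≤ C := by simpa [gC] using hc
      refine terminates_skip_seq (T := 4) ?_
      refine terminates_op (T := 3) i (by simp [g10]) (abs_le.2 ⟨by omega, by omega⟩) ?_
      refine terminates_skip ⟨by simpa [HeightsReady] using ⟨g0, g3, g4, g5, gP, gR⟩,
        by simp [gC], by simpa using g6, by simp [hi'], j, by simp [g12], by simp [hi'], ?_⟩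
      rw [hi']
      exact ht.lower_pred hCn hP0 hQ0 hc
  · rintro s ⟨-, -, -, g10, -⟩
    simp [g10]
  · rintro s ⟨g, gC, -, -, j, -, -, ht⟩
    rw [Nat.sub_self] at ht
    exact terminates_skip ⟨g, gC, ht.admissible hCn⟩

/-! ### Writing the polygon -/

/-- Write down the vertices of the canonical polygon. -/
def writePolygon : Program :=
  .seq (.op 10 .add (.const 0) (.const 0)) <|
  .seq (.op 11 .add (.const 0) (.const 0)) <|
  .seq (.loop ⟨.lt, .reg 10, .reg 3⟩ <|
    .seq (.load 12 4 (.reg 10)) <|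
    .seq (.store 1 (.reg 11) (.reg 10)) <|
    .seq (.store 2 (.reg 11) (.reg 12)) <|
    .seq (.op 11 .add (.reg 11) (.const 1)) <|
    .seq (.op 10 .add (.reg 10) (.const 1)) <|
    .seq (.store 1 (.reg 11) (.reg 10)) <|
    .seq (.store 2 (.reg 11) (.reg 12)) <|
    .seq (.op 11 .add (.reg 11) (.const 1)) .skip) <|
  .seq (.op 13 .add (.reg 4) (.const 0)) <|
  .seq (.loop ⟨.lt, .const 0, .reg 13⟩ <|
    .seq (.load 12 5 (.reg 13)) <|
    .seq (.op 12 .add (.reg 6) (.reg 12)) <|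
    .seq (.op 12 .add (.reg 12) (.const 1)) <|
    .seq (.load 14 7 (.reg 13)) <|
    .seq (.store 1 (.reg 11) (.reg 14)) <|
    .seq (.store 2 (.reg 11) (.reg 12)) <|
    .seq (.op 11 .add (.reg 11) (.const 1)) <|
    .seq (.op 13 .sub (.reg 13) (.const 1)) <|
    .seq (.load 14 7 (.reg 13)) <|
    .seq (.store 1 (.reg 11) (.reg 14)) <|
    .seq (.store 2 (.reg 11) (.reg 12)) <|
    .seq (.op 11 .add (.reg 11) (.const 1)) .skip)
  .skip

/-- The first `2 * r` vertices of the canonical polygon are stored in the arrays `A` and `B`. -/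
def Written (a m : ℕ) (P Q z : ℕ → ℤ) (C : ℤ) (r : ℕ) (A B : ℕ → ℤ) : Prop :=
  ∀ i < r, (A (2 * i) = canonicalX a m z i ∧ A (2 * i + 1) = canonicalX a m z (i + 1)) ∧
    B (2 * i) = canonicalY a m P Q C i ∧ B (2 * i + 1) = canonicalY a m P Q C i

theorem Written.succ {a m r : ℕ} {P Q z : ℕ → ℤ} {C : ℤ} {A B A' B' : ℕ → ℤ}
    (h : Written a m P Q z C r A B)
    (hA : ∀ e, A' e = if e = 2 * r + 1 then canonicalX a m z (r + 1) else
      if e = 2 * r then canonicalX a m z r else A e)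
    (hB : ∀ e, B' e = if e = 2 * r + 1 then canonicalY a m P Q C r else
      if e = 2 * r then canonicalY a m P Q C r else B e) :
    Written a m P Q z C (r + 1) A' B' := by
  intro i hi
  rw [hA, hA, hB, hB]
  rcases Nat.lt_succ_iff_lt_or_eq.1 hi with hi | rfl
  · rw [if_neg (by omega), if_neg (by omega), if_neg (by omega), if_neg (by omega),
      if_neg (by omega), if_neg (by omega), if_neg (by omega), if_neg (by omega)]
    exact h i hi
  · rw [if_neg (by omega), if_pos rfl, if_pos rfl, if_neg (by omega), if_pos rfl, if_pos rfl]
    exact ⟨⟨rfl, rfl⟩, rfl, rfl⟩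

theorem terminates_writePolygon {W n a m : ℕ} {P Q z : ℕ → ℤ} {C : ℤ} (hW : 8 * n ≤ W)
    (hn : n = 2 * m) (ham : a < m)
    (hP : ∀ i < a, |P i| ≤ n) (hR : ∀ j ≤ m - a, |shifted Q j| ≤ n) (hC : |C| ≤ n)
    (hz : Admissible a (m - a) P Q z C) {s : State}
    (hs : HeightsReady n a (m - a) P (shifted Q) s) (h6 : s.reg 6 = C) (h7 : s.arr 7 = z) :
    Terminates W writePolygon (20 * n + 20)
      (fun s => Written a m P Q z C m (s.arr 1) (s.arr 2)) s := by
  obtain ⟨g0, g3, g4, g5, gP, gR⟩ := hs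
  have hC' := abs_le.1 hC
  have hzb : ∀ j ≤ m - a, 0 ≤ z j ∧ z j ≤ a := fun j hj => by
    have h1 := mono_upto hz.step (Nat.zero_le j) hj
    have h2 := mono_upto hz.step hj le_rfl
    rw [hz.first] at h1
    rw [hz.last] at h2
    exact ⟨h1, h2⟩
  unfold writePolygon
  refine terminates_op (T := 20 * n + 19) 0 rfl (by simp) ?_
  refine terminates_op (T := 20 * n + 18) 0 rfl (by simp) ?_
  refine terminates_loop a (fun k s => HeightsReady n a (m - a) P (shifted Q) s ∧ s.reg 6 = C ∧
    s.arr 7 = z ∧ s.reg 10 = k ∧ s.reg 11 = 2 * k ∧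
    Written a m P Q z C k (s.arr 1) (s.arr 2)) 9 ?_ ?_ ?_ ?_ (T₁ := 10 * n + 5) (by omega)
  · exact ⟨by simpa [HeightsReady] using ⟨g0, g3, g4, g5, gP, gR⟩, by simp [h6], by simp [h7],
      by simp, by simp, by simp [Written]⟩
  · rintro k hk s ⟨⟨g0, g3, g4, g5, gP, gR⟩, g6, g7, g10, g11, gW⟩
    have bP := abs_le.1 (hP k hk)
    refine ⟨by simp [g10, g3, hk], ?_⟩
    refine terminates_load (T := 8) k (P k) (by simp [g10]) (gP k hk) (by omega)
      (abs_le.2 ⟨by omega, by omega⟩) ?_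
    refine terminates_store (T := 7) (2 * k) k (by simp [g11]) (by simp [g10]) (by omega)
      (abs_le.2 ⟨by omega, by omega⟩) ?_
    refine terminates_store (T := 6) (2 * k) (P k) (by simp [g11]) (by simp) (by omega)
      (abs_le.2 ⟨by omega, by omega⟩) ?_
    refine terminates_op (T := 5) (2 * k + 1) (by simp [g11]) (abs_le.2 ⟨by omega, by omega⟩) ?_
    refine terminates_op (T := 4) (k + 1) (by simp [g10]) (abs_le.2 ⟨by omega, by omega⟩) ?_
    refine terminates_store (T := 3) (2 * k + 1) (k + 1) (by simp) (by simp) (by omega)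
      (abs_le.2 ⟨by omega, by omega⟩) ?_
    refine terminates_store (T := 2) (2 * k + 1) (P k) (by simp) (by simp) (by omega)
      (abs_le.2 ⟨by omega, by omega⟩) ?_
    refine terminates_op (T := 1) (2 * k + 2) (by simp; ring)
      (abs_le.2 ⟨by omega, by omega⟩) ?_
    refine terminates_skip ⟨by simpa [HeightsReady] using ⟨g0, g3, g4, g5, gP, gR⟩,
      by simp [g6], ?_, by simp, by simp; ring, gW.succ (fun e => ?_) fun e => ?_⟩
    · funext e
      simp [← g7]
    · have e1 : canonicalX a m z k = k := if_pos hk.le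
      have e2 : canonicalX a m z (k + 1) = k + 1 := if_pos hk
      rw [e1, e2]
      simp
    · have e1 : canonicalY a m P Q C k = P k := if_pos hk
      rw [e1]
      simp
  · rintro s ⟨⟨g0, g3, -⟩, -, -, g10, -⟩
    simp [g10, g3]
  rintro s ⟨⟨g0, g3, g4, g5, gP, gR⟩, g6, g7, g10, g11, gW⟩
  refine terminates_op (T := 10 * n + 4) (m - a : ℕ) (by simp [g4])
    (abs_le.2 ⟨by omega, by omega⟩) ?_
  refine terminates_loop (m - a) (fun k s => s.reg 6 = C ∧
    (∀ j ≤ m - a, s.arr 5 j = shifted Q j) ∧ s.arr 7 = z ∧ s.reg 13 = (m - a - k : ℕ) ∧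
    s.reg 11 = (2 * (a + k) : ℕ) ∧ Written a m P Q z C (a + k) (s.arr 1) (s.arr 2)) 13
    ?_ ?_ ?_ ?_ (T₁ := 1) (by omega)
  · exact ⟨by simp [g6], by simpa using gR, by simp [g7], by simp, by simp [g11],
      by simpa using gW⟩
  · rintro k hk s ⟨g6, gR, g7, g13, g11, gW⟩
    obtain ⟨j, hj⟩ : ∃ j, m - a - k = j + 1 := ⟨m - a - k - 1, by omega⟩
    have hj' : m - a - (k + 1) = j := by omega
    -- For `k = 0` the index `a` belongs to the lower branch of `canonicalX`; both branches agree
    -- there since `z (m - a) = a`.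
    have e1 : canonicalX a m z (a + k) = z (j + 1) := by
      rw [canonicalX]
      split_ifs with h
      · rw [← hj, show m - a - k = m - a by omega, hz.last]
        push_cast
        omega
      · rw [← hj, Nat.sub_sub]
    have e2 : canonicalX a m z (a + k + 1) = z j := by
      rw [canonicalX, if_neg (by omega), show m - (a + k + 1) = j by omega]
    have e3 : canonicalY a m P Q C (a + k) = C + Q j + 1 := by
      rw [canonicalY, if_neg (by omega), show m - 1 - (a + k) = j by omega]
      ring
    have bR := abs_le.1 (hR (j + 1) (by omega))
    rw [shifted] at bR
    have bz := hzb j (by omega)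
    have bz' := hzb (j + 1) (by omega)
    rw [hj] at g13
    refine ⟨by rw [Test.holds_lt, Operand.val_const, Operand.val_reg, g13]; omega, ?_⟩
    refine terminates_load (T := 12) (j + 1) (Q j) (by simp [g13]) (gR (j + 1) (by omega))
      (by omega) (abs_le.2 ⟨by omega, by omega⟩) ?_
    refine terminates_op (T := 11) (C + Q j) (by simp [g6]) (abs_le.2 ⟨by omega, by omega⟩) ?_
    refine terminates_op (T := 10) (C + Q j + 1) (by simp) (abs_le.2 ⟨by omega, by omega⟩) ?_
    refine terminates_load (T := 9) (j + 1) (z (j + 1)) (by simp [g13]) (by simp [g7])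
      (by omega) (abs_le.2 ⟨by omega, by omega⟩) ?_
    refine terminates_store (T := 8) (2 * (a + k)) (z (j + 1)) (by simp [g11]) (by simp)
      (by omega) (abs_le.2 ⟨by omega, by omega⟩) ?_
    refine terminates_store (T := 7) (2 * (a + k)) (C + Q j + 1) (by simp [g11]) (by simp)
      (by omega) (abs_le.2 ⟨by omega, by omega⟩) ?_
    refine terminates_op (T := 6) (2 * (a + k) + 1 : ℕ) (by simp [g11])
      (abs_le.2 ⟨by omega, by omega⟩) ?_
    refine terminates_op (T := 5) j (by simp [g13]) (abs_le.2 ⟨by omega, by omega⟩) ?_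
    refine terminates_load (T := 4) j (z j) (by simp) (by simp [g7])
      (by omega) (abs_le.2 ⟨by omega, by omega⟩) ?_
    refine terminates_store (T := 3) (2 * (a + k) + 1) (z j) (by simp) (by simp)
      (by omega) (abs_le.2 ⟨by omega, by omega⟩) ?_
    refine terminates_store (T := 2) (2 * (a + k) + 1) (C + Q j + 1) (by simp) (by simp)
      (by omega) (abs_le.2 ⟨by omega, by omega⟩) ?_
    refine terminates_op (T := 1) (2 * (a + (k + 1)) : ℕ) (by simp; ring)
      (abs_le.2 ⟨by omega, by omega⟩) ?_
    refine terminates_skip ⟨by simp [g6], by simpa using gR, ?_, by simp [hj'], by simp,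
      gW.succ (fun e => ?_) fun e => ?_⟩
    · funext e
      simp [← g7]
    · rw [e1, e2]
      simp
    · rw [e3]
      simp
  · rintro s ⟨-, -, -, g13, -⟩
    simp [g13]
  · rintro s ⟨-, -, -, -, -, gW⟩
    rw [show a + (m - a) = m by omega] at gW
    exact terminates_skip gW

/-- The whole algorithm. -/
def minPerimeterProgram : Program :=
  .seq readInput <| .seq searchStart <| .seq computeHeights <| .seq fillTable <|
    .seq traceBack writePolygon

theorem terminates_minPerimeterProgram {n : ℕ} [NeZero n] {W : ℕ} (S : Fin n → Turn)
    (hS : IsXMonotoneSeq S) (hW : 8 * n ≤ W) (hW2 : n ^ 2 ≤ W) :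
    Terminates W minPerimeterProgram (200 * n ^ 2)
      (fun s => IsMinPerimeterRealization (outputVertices n s) S) (inputState S) := by
  have hex := exists_isPattern hS
  obtain ⟨m, hn, hm⟩ : ∃ m, n = 2 * m ∧ 2 ≤ m := by
    obtain ⟨k, m, a, h, -⟩ := hex
    exact ⟨m, h.length, by have := h.pos; have := h.lt; omega⟩
  have hex' : ∃ k a, IsPattern S k m a ∧ m ≤ 2 * a := by
    obtain ⟨k, m', a, h⟩ := hex
    have h1 := h.1.length
    obtain rfl : m = m' := by omega
    exact ⟨k, a, h⟩
  refine terminates_seq ((terminates_readInput S hn (by omega)).mono le_rfl fun s hs => ?_)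
    (T := 200 * n ^ 2 - (10 * n + 10)) (by
      nlinarith [Nat.sub_add_cancel (show 10 * n + 10 ≤ 200 * n ^ 2 by nlinarith)])
  refine terminates_seq ((terminates_searchStart S hn hW hex' hs).mono le_rfl fun s hs => ?_)
    (T := 110 * n ^ 2) (by
      have h1 : 10 * n + 10 ≤ 200 * n ^ 2 := by nlinarith
      have h2 : n * (13 * m + 20) + 10 + 110 * n ^ 2 + (10 * n + 10) ≤ 200 * n ^ 2 := by
        subst hn
        nlinarith
      omega)
  obtain ⟨hs, K, a, h2, h3, hK, hp, hma⟩ := hs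
  have hpos := hp.pos
  have hlt := hp.lt
  refine terminates_seq ((terminates_computeHeights S hW hK hp hs h2 h3).mono le_rfl
    fun s hs => ?_) (T := 95 * n ^ 2) (by nlinarith)
  have hTabs : ∀ i, |code S (idx 0 K) i| = 1 := abs_code S (idx 0 K)
  set P := lowerHeight (code S (idx 0 K))
  set Q := upperHeight (code S (idx 0 K)) m
  have hP : ∀ i < a, |P i| ≤ i := fun i _ => abs_lowerHeight_le hTabs i
  have hQ : ∀ j, |Q j| ≤ j := fun j => abs_upperHeight_le hTabs m j
  have hR : ∀ j ≤ m - a, |shifted Q j| ≤ j := fun j _ => by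
    cases j with
    | zero => simp [shifted]
    | succ j =>
      have := hQ j
      rw [shifted]
      push_cast
      omega
  have hPn : ∀ i < a, |P i| ≤ n := fun i hi => by have := hP i hi; omega
  have hRn : ∀ j ≤ m - a, |shifted Q j| ≤ n := fun j hj => by have := hR j hj; omega
  have hPR : ∀ i < a, ∀ j ≤ m - a, |P i - shifted Q j| ≤ n := fun i hi j hj => by
    have h4 := abs_le.1 (hP i hi)
    have h5 := abs_le.1 (hR j hj)
    rw [abs_le]
    omega
  have hPQ : ∀ i < a, ∀ j < m - a, P i - Q j < n := fun i hi j hj => by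
    have h4 := abs_le.1 (hP i hi)
    have h5 := abs_le.1 (hQ j)
    omega
  have hWab : (a + 1) * (m - a + 1) ≤ W := by
    have := Nat.mul_le_mul (show a + 1 ≤ n by omega) (show m - a + 1 ≤ n by omega)
    nlinarith
  refine terminates_seq ((terminates_fillTable hW hWab hpos (by omega) (by omega) hPn hRn hPR
    hs).mono le_rfl fun s hs => ?_) (T := 40 * n ^ 2) (by
      have h4 := Nat.mul_le_mul (show a ≤ m by omega)
        (show 23 * (m - a) + 20 ≤ 23 * m + 20 by omega)
      subst hn
      nlinarith [show m - a ≤ m by omega])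
  obtain ⟨hs, h11, h6⟩ := hs
  obtain ⟨C, hC⟩ : ∃ C, bottleneck P (shifted Q) n (a - 1) (m - a) = C := ⟨_, rfl⟩
  -- The last table entry is at most the `C'` of every realization, and `canonicalPerimeter`
  -- increases with `C`. Existence of one realization then shows that the entry is below `n`, so the
  -- traceback starts from a reachable cell.
  have hopt : ∀ w : Vertices n, Realizes w S →
      C < n ∧ canonicalPerimeter (code S (idx 0 K)) m a C ≤ perimeter w := by
    intro w hw
    obtain ⟨z, C', hz, hle⟩ := exists_admissible_le_perimeter hp hma hw
    have h4 := (hz.min hPQ).bottleneck_le (inf := n) hpos (by omega) rfl rfl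
    rw [hC] at h4
    refine ⟨by omega, le_trans ?_ hle⟩
    rw [canonicalPerimeter, canonicalPerimeter]
    omega
  have hCn : C < n := by
    obtain ⟨w, hw, -⟩ := hS
    exact (hopt w hw).1
  refine terminates_seq ((terminates_traceBack (P := P) (Q := Q) hW hWab hpos (by omega) (by omega)
    rfl rfl hPR hC hCn hs h11 h6).mono le_rfl fun s hs => ?_) (T := 20 * n + 20) (by nlinarith)
  obtain ⟨hs, h6, hz⟩ := hs
  have hCabs : |C| ≤ n := hC ▸ abs_bottleneck_le hPR (a - 1) (m - a) (by omega) le_rfl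
  refine (terminates_writePolygon hW hn hlt hPn hRn hCabs hz hs h6 rfl).mono le_rfl
    fun s' hs' => ?_
  obtain ⟨h7, h8⟩ := realizes_canonical hp hz (fun i hi => (hs' i hi).1) fun i hi => (hs' i hi).2
  exact ⟨h7, fun w hw => h8.le.trans (hopt w hw).2⟩

end RectPoly

/-- There is one word-RAM program that, for every `x`-monotone angle sequence `S` of length `n`,
computes a minimum-perimeter polygon realizing `S` in at most `C * n ^ 2` steps, with words of
`O(log n)` bits (all numbers and array indices are bounded by `n ^ c`). -/
theorem mainTheorem8 :
    ∃ (prog : WordRAM.Program) (C c : ℕ),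
      ∀ (n : ℕ) [NeZero n] (S : Fin n → RectPoly.Turn), RectPoly.IsXMonotoneSeq S →
        ∃ (t : ℕ) (s : WordRAM.State),
          WordRAM.Runs (n ^ c) prog (RectPoly.inputState S) t s ∧
          t ≤ C * n ^ 2 ∧
          RectPoly.IsMinPerimeterRealization (RectPoly.outputVertices n s) S := by
  refine ⟨RectPoly.minPerimeterProgram, 200, 3, fun n _ S hS => ?_⟩
  -- A pattern has `1 ≤ a < m`; `4 ≤ n` gives `8 * n ≤ n ^ 3`, so the exponent `3` covers both word
  -- size requirements.
  have hn : 4 ≤ n := by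
    obtain ⟨k, m, a, h, -⟩ := RectPoly.exists_isPattern hS
    have := h.length
    have := h.pos
    have := h.lt
    omega
  refine RectPoly.terminates_minPerimeterProgram S hS ?_ (Nat.pow_le_pow_right (by omega) (by omega))
  have h1 : 4 * 4 ≤ n * n := Nat.mul_le_mul hn hn
  calc 8 * n ≤ n * n * n := Nat.mul_le_mul_right n (by omega)
    _ = n ^ 3 := by ring
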